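/- **Setting.** Let $A=(A_{\mathsf{yes}},A_{\mathsf{no}})$ be a promise problem in $\mathsf{QMA}$, with a fixed quantum polynomial-time (QPT) verification procedure $V_A$ (completeness $\alpha$, soundness $\beta$, $0\le\beta<\alpha\le 1$, $\alpha-\beta\ge 1/\mathrm{poly}(|x|)$), and for $x\in A_{\mathsf{yes}}$ let $R_A(x)$ be the set of witness states $w$ with $\Pr[V_A(x,w)=\top]\ge 2/3$. The security parameter is $\lambda=|x|$, and a function $f$ is negligible if for every constant $c$ one has $f(\lambda)<\lambda^{-c}$ for all large $\lambda$. A *quantum interactive protocol* is an interaction, in polynomially many rounds, between a QPT prover $P$, whose private input is $w^{\otimes k(|x|)}$ for a polynomial $k$, and a QPT verifier $V$; at the end each outputs $\top$ or $\bot$. For a malicious verifier $V^*$ (a family of polynomial-size quantum circuits) with quantum input $\xi$, $\mathrm{OUT}_{V^*}\langle P(w^{\otimes k}),V^*(\xi)\rangle(x)$ is its final quantum state, and $\mathrm{OUT}'_{P,V^*}\langle P(w^{\otimes k}),V^*(\xi)\rangle(x)$ is $(\top,\mathrm{OUT}_{V^*})$ if $P$ outputs $\top$ and $(\bot,\bot)$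 otherwise. The protocol is a *certified everlasting zero-knowledge proof for $A$ with $c$-completeness and $s$-soundness* if * ($c$-completeness) for all $x\in A_{\mathsf{yes}}$ and $w\in R_A(x)$, $V$ outputs $\top$ with probability at least $c(|x|)$ in the honest execution; * ($s$-soundness) for all $x\in A_{\mathsf{no}}$ and every unbounded prover $P^*$, $V$ outputs $\top$ with probability at most $s(|x|)$; * (computational zero-knowledge) there is a QPT simulator $S$ such that for every $V^*$ the channels $\mathrm{OUT}_{V^*}\langle P(w^{\otimes k}),V^*(\cdot)\rangle(x)$ and $S(x,V^*,\cdot)$ are computationally indistinguishable (by polynomial-size circuits, on an arbitrary state of the input and auxiliary qubits), with negligible advantage in $|x|$, uniformly over $x\in A_{\mathsf{yes}}$ and $w\in R_A(x)$; * (prover's completeness) for all $x\in A_{\mathsf{yes}}$ and $w\in R_A(x)$, $P$ outputs $\top$ with probability at least $1-\mathrm{negl}(|x|)$ in the honest execution; * (certified everlasting zero-knowledge) there is a QPT simulator $S$ such that for every $V^*$ the channels $\mathrm{OUT}'_{P,V^*}\langle P(w^{\otimes k}),V^*(\cdot)\rangle(x)$ and $S(x,V^*,\cdot)$ are statistically indistinguishable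 (by arbitrary measurements, on an arbitrary state of the input and auxiliary qubits), with negligible advantage in $|x|$, uniformly over $x\in A_{\mathsf{yes}}$ and $w\in R_A(x)$. **Theorem.** Let $\Sigma$ be a certified everlasting zero-knowledge proof for $A$ with $(1-\mathrm{negl}(\lambda))$-completeness and $\left(1-\frac1{q(\lambda)}\right)$-soundness, where $q$ is a polynomial with positive integer values. For a polynomial $N=N(\lambda)$ with natural coefficients let $\Sigma^N$ be the $N$-fold sequential repetition of $\Sigma$: prover and verifier run $\Sigma$ one after the other $N$ times, the prover using $k$ fresh copies of the witness in each run, and each of them outputs $\top$ if and only if it outputs $\top$ in all $N$ runs. 1. For every polynomial $N$, $\Sigma^N$ is a certified everlasting zero-knowledge proof for $A$ with $(1-\mathrm{negl}(\lambda))$-completeness and $\left(1-\frac1{q(\lambda)}\right)^{N(\lambda)}$-soundness. 2. If $N$ is large enough that $\dfrac{N(\lambda)}{q(\lambda)\log\lambda}\to\infty$ (for example $N(\lambda)=\lambda\,q(\lambda)$), then $\Sigma^N$ is a certified everlasting zero-knowledge proof for $A$ with $(1-\mathrm{negl}(\lambda))$-completeness and $\mathrm{negl}(\lambda)$-soundness.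 -/

import Mathlib

open Matrix Filter Topology
open scoped Kronecker ComplexOrder

namespace QZK

/-! ## Negligible functions -/

/-- `f` is negligible: for every constant `c`, `f n < n ^ (-c)` for all large `n`. -/
def Negligible (f : ℕ → ℝ) : Prop :=
  ∀ c : ℕ, ∃ n₀ : ℕ, ∀ n : ℕ, n₀ < n → f n < 1 / (n : ℝ) ^ c

/-! ## Deterministic polynomial time

A WHILE language over binary trees with an explicit step count.  Executing an instruction on a tree
costs the size of that tree, so the output of a run is never larger than its cost, and the
language is polynomially equivalent to multi-tape Turing machines. -/

/-- The data on which programs work: binary trees. -/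
inductive Val : Type
  | nil : Val
  | pair (a b : Val) : Val

/-- Number of nodes. -/
def Val.size : Val → ℕ
  | .nil => 1
  | .pair a b => 1 + a.size + b.size

/-- Programs; each maps one tree to one tree. -/
inductive Code : Type
  | id : Code
  | nil : Code
  | fst : Code
  | snd : Code
  | pair (f g : Code) : Code
  | comp (g f : Code) : Code
  | ite (c f g : Code) : Code
  | loop (c f : Code) : Code

/-- `Runs p v out t`: on the tree `v` the program `p` halts with output `out` after `t` steps.
`ite c f g` runs `f` if `c` returns a pair and `g` if `c` returns `nil`;
`loop c f` replaces the current tree `v` by `f v` as long as `c v` is a pair. -/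
inductive Runs : Code → Val → Val → ℕ → Prop
  | id (v : Val) : Runs .id v v v.size
  | nil (v : Val) : Runs .nil v .nil v.size
  | fst_nil : Runs .fst .nil .nil Val.nil.size
  | fst_pair (a b : Val) : Runs .fst (.pair a b) a (Val.pair a b).size
  | snd_nil : Runs .snd .nil .nil Val.nil.size
  | snd_pair (a b : Val) : Runs .snd (.pair a b) b (Val.pair a b).size
  | pair {f g : Code} {v a b : Val} {s t : ℕ} (hf : Runs f v a s) (hg : Runs g v b t) :
      Runs (.pair f g) v (.pair a b) (v.size + s + t)
  | comp {f g : Code} {v u out : Val} {s t : ℕ} (hf : Runs f v u s) (hg : Runs g u out t) :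
      Runs (.comp g f) v out (v.size + s + t)
  | ite_pair {c f g : Code} {v a b out : Val} {s t : ℕ} (hc : Runs c v (.pair a b) s)
      (hf : Runs f v out t) : Runs (.ite c f g) v out (v.size + s + t)
  | ite_nil {c f g : Code} {v out : Val} {s t : ℕ} (hc : Runs c v .nil s)
      (hg : Runs g v out t) : Runs (.ite c f g) v out (v.size + s + t)
  | loop_done {c f : Code} {v : Val} {s : ℕ} (hc : Runs c v .nil s) :
      Runs (.loop c f) v v (v.size + s)
  | loop_step {c f : Code} {v a b u out : Val} {s t r : ℕ} (hc : Runs c v (.pair a b) s)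
      (hf : Runs f v u t) (hl : Runs (.loop c f) u out r) :
      Runs (.loop c f) v out (v.size + s + t + r)

/-- Data that programs can read and write, through an injective encoding by trees. -/
class TreeData (α : Type) where
  enc : α → Val
  inj : Function.Injective enc

/-- Length of the encoding of a datum. -/
def dataSize {α : Type} [TreeData α] (a : α) : ℕ := (TreeData.enc a).size

/-- `f` is computed by a program in polynomial time. -/
def PolyTime {α β : Type} [TreeData α] [TreeData β] (f : α → β) : Prop :=
  ∃ (p : Code) (b : Polynomial ℕ), ∀ a : α,
    ∃ t : ℕ, t ≤ b.eval (dataSize a) ∧ Runs p (TreeData.enc a) (TreeData.enc (f a)) t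

/-- A family indexed by bit strings whose members have polynomial size. -/
def PolySize {α : Type} [TreeData α] (f : List Bool → α) : Prop :=
  ∃ b : Polynomial ℕ, ∀ x : List Bool, dataSize (f x) ≤ b.eval x.length

def encBool : Bool → Val
  | false => .nil
  | true => .pair .nil .nil

/-- Natural numbers are written in unary. -/
def encNat : ℕ → Val
  | 0 => .nil
  | n + 1 => .pair .nil (encNat n)

def encList {α : Type} (e : α → Val) : List α → Val
  | [] => .nil
  | a :: l => .pair (e a) (encList e l)

instance : TreeData Bool where
  enc := encBool
  inj := by intro a b h; cases a <;> cases b <;> simp_all [encBool]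

theorem encNat_injective : Function.Injective encNat := by
  intro a
  induction a with
  | zero => intro b h; cases b <;> simp_all [encNat]
  | succ n ih =>
    intro b h
    cases b with
    | zero => simp [encNat] at h
    | succ m => simp only [encNat, Val.pair.injEq, true_and] at h; rw [ih h]

instance : TreeData ℕ where
  enc := encNat
  inj := encNat_injective

theorem encList_injective {α : Type} {e : α → Val} (he : Function.Injective e) :
    Function.Injective (encList e) := by
  intro a
  induction a with
  | nil => intro b h; cases b <;> simp_all [encList]
  | cons y l ih =>
    intro b h
    cases b with
    | nil => simp [encList] at h
    | cons z m =>
      simp only [encList, Val.pair.injEq] at h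
      rw [he h.1, ih h.2]

instance {α : Type} [TreeData α] : TreeData (List α) where
  enc := encList TreeData.enc
  inj := encList_injective TreeData.inj

instance {α β : Type} [TreeData α] [TreeData β] : TreeData (α × β) where
  enc p := .pair (TreeData.enc p.1) (TreeData.enc p.2)
  inj := by
    rintro ⟨a, b⟩ ⟨c, d⟩ h
    simp only [Val.pair.injEq] at h
    rw [TreeData.inj h.1, TreeData.inj h.2]

/-! ## States and channels -/

/-- Computational basis of `n` qubits. -/
abbrev Q (n : ℕ) : Type := Fin n → Bool

/-- Linear maps from operators on `ℂ^α` to operators on `ℂ^β`. -/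
abbrev SOp (α β : Type) : Type := Matrix α α ℂ →ₗ[ℂ] Matrix β β ℂ

/-- Density operators. -/
def IsState {α : Type} [Fintype α] (ρ : Matrix α α ℂ) : Prop :=
  ρ.PosSemidef ∧ ρ.trace = 1

/-- `ρ ↦ K ρ K†`. -/
noncomputable def conj {α β : Type} [Fintype α] (K : Matrix β α ℂ) : SOp α β where
  toFun ρ := K * ρ * Kᴴ
  map_add' := by intro ρ σ; simp [Matrix.mul_add, Matrix.add_mul]
  map_smul' := by intro c ρ; simp

/-- Quantum channels, in Kraus form. -/
def IsChannel {α β : Type} [Fintype α] [DecidableEq α] [Fintype β] (Φ : SOp α β) : Prop :=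
  ∃ (r : ℕ) (K : Fin r → Matrix β α ℂ), ∑ i, (K i)ᴴ * K i = 1 ∧ Φ = ∑ i, conj (K i)

/-- Relabelling of the basis. -/
noncomputable def relabel {α β : Type} (e : α ≃ β) : SOp α β :=
  (Matrix.reindexLinearEquiv ℂ ℂ e e).toLinearMap

/-- `Φ ⊗ id`. -/
def amplify {α β : Type} (γ : Type) (Φ : SOp α β) : SOp (α × γ) (β × γ) where
  toFun ρ := Matrix.of fun i j => Φ (Matrix.of fun a a' => ρ (a, i.2) (a', j.2)) i.1 j.1
  map_add' := by
    intro ρ σ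
    ext i j
    have h : (Matrix.of fun a a' => (ρ + σ) (a, i.2) (a', j.2)) =
        (Matrix.of fun a a' => ρ (a, i.2) (a', j.2)) +
          (Matrix.of fun a a' => σ (a, i.2) (a', j.2)) := rfl
    simp only [Matrix.of_apply, Matrix.add_apply]
    rw [← Matrix.add_apply, ← map_add]
    rfl
  map_smul' := by
    intro c ρ
    ext i j
    have h : (Matrix.of fun a a' => (c • ρ) (a, i.2) (a', j.2)) =
        c • (Matrix.of fun a a' => ρ (a, i.2) (a', j.2)) := rfl
    simp only [Matrix.of_apply, Matrix.smul_apply, RingHom.id_apply]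
    rw [← Matrix.smul_apply, ← map_smul]
    rfl

/-- `ρ ↦ ρ ⊗ τ`. -/
noncomputable def tensorRight {γ : Type} (α : Type) (τ : Matrix γ γ ℂ) : SOp α (α × γ) where
  toFun ρ := ρ ⊗ₖ τ
  map_add' := by intro ρ σ; exact Matrix.add_kronecker ρ σ τ
  map_smul' := by intro c ρ; exact Matrix.smul_kronecker c ρ τ

/-- `ρ ↦ τ ⊗ ρ`. -/
noncomputable def tensorLeft {γ : Type} (α : Type) (τ : Matrix γ γ ℂ) : SOp α (γ × α) where
  toFun ρ := τ ⊗ₖ ρ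
  map_add' := by intro ρ σ; exact Matrix.kronecker_add τ ρ σ
  map_smul' := by intro c ρ; exact Matrix.kronecker_smul c τ ρ

open scoped Classical in
/-- Measure the first factor in the computational basis, keep only the outcomes in `S`, and
discard that factor. -/
noncomputable def traceLeftOn {α β : Type} [Fintype α] (S : α → Prop) :
    SOp (α × β) β where
  toFun ρ := Matrix.of fun b b' => ∑ a with S a, ρ (a, b) (a, b')
  map_add' := by intro ρ σ; ext b b'; simp [Finset.sum_add_distrib]
  map_smul' := by intro c ρ; ext b b'; simp [Finset.mul_sum]

/-- Partial trace over the first factor. -/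
noncomputable def traceLeft (α β : Type) [Fintype α] : SOp (α × β) β :=
  traceLeftOn fun _ => True

/-- Partial trace over the second factor. -/
noncomputable def traceRight (α β : Type) [Fintype β] : SOp (α × β) α :=
  traceLeft β α ∘ₗ relabel (Equiv.prodComm α β)

/-- The operator `|f⟩⟨f|`. -/
def ketbra {α : Type} [DecidableEq α] (f : α) : Matrix α α ℂ := Matrix.single f f 1

/-- `|0…0⟩⟨0…0|` on `n` qubits. -/
def zeros (n : ℕ) : Matrix (Q n) (Q n) ℂ := ketbra fun _ => false

/-- Put `m` qubits and then `n` qubits side by side: wires `0, …, m-1` and `m, …, m+n-1`. -/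
noncomputable def join (m n : ℕ) : SOp (Q m × Q n) (Q (m + n)) := relabel (Fin.appendEquiv m n)

/-- The inverse of `join`. -/
noncomputable def split (m n : ℕ) : SOp (Q (m + n)) (Q m × Q n) :=
  relabel (Fin.appendEquiv m n).symm

/-- All the wires listed in `l` exist and hold the bit `1`. -/
def AllOnes {n : ℕ} (l : List ℕ) (f : Q n) : Prop :=
  ∀ i ∈ l, ∃ h : i < n, f ⟨i, h⟩ = true

/-- Probability that measuring the first factor in the computational basis gives an outcome
in `S`. -/
noncomputable def probLeft {α β : Type} [Fintype α] [Fintype β] (S : α → Prop)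
    (ρ : Matrix (α × β) (α × β) ℂ) : ℝ :=
  (traceLeftOn S ρ).trace.re

/-! ## Quantum circuits -/

/-- Elementary gates on numbered wires: Hadamard, `T = diag(1, e^{iπ/4})`, Pauli `X`,
controlled NOT, Toffoli, and the non-unitary gate that resets a wire to `|0⟩`. -/
inductive Gate : Type
  | h (i : ℕ) : Gate
  | t (i : ℕ) : Gate
  | x (i : ℕ) : Gate
  | cnot (c i : ℕ) : Gate
  | toffoli (c d i : ℕ) : Gate
  | reset (i : ℕ) : Gate

/-- A circuit is a list of gates, applied from left to right. -/
abbrev Circuit : Type := List Gate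

def Gate.enc : Gate → Val
  | .h i => .pair (encNat 0) (encNat i)
  | .t i => .pair (encNat 1) (encNat i)
  | .x i => .pair (encNat 2) (encNat i)
  | .cnot c i => .pair (encNat 3) (.pair (encNat c) (encNat i))
  | .toffoli c d i => .pair (encNat 4) (.pair (encNat c) (.pair (encNat d) (encNat i)))
  | .reset i => .pair (encNat 5) (encNat i)

instance : TreeData Gate where
  enc := Gate.enc
  inj := by
    intro a b h
    cases a <;> cases b <;>
      simp_all [Gate.enc, encNat_injective.eq_iff]

/-- Rename the wires of a gate. -/
def Gate.map (f : ℕ → ℕ) : Gate → Gate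
  | .h i => .h (f i)
  | .t i => .t (f i)
  | .x i => .x (f i)
  | .cnot c i => .cnot (f c) (f i)
  | .toffoli c d i => .toffoli (f c) (f d) (f i)
  | .reset i => .reset (f i)

/-- The one-qubit operator `U` on wire `i`, identity elsewhere. -/
noncomputable def onWire {n : ℕ} (U : Matrix Bool Bool ℂ) (i : Fin n) : Matrix (Q n) (Q n) ℂ :=
  Matrix.of fun f g => if ∀ j, j ≠ i → f j = g j then U (f i) (g i) else 0

/-- The operator `|g⟩ ↦ |φ g⟩`. -/
def basisMap {n : ℕ} (φ : Q n → Q n) : Matrix (Q n) (Q n) ℂ :=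
  Matrix.of fun f g => if f = φ g then 1 else 0

noncomputable def hadamardGate : Matrix Bool Bool ℂ :=
  Matrix.of fun a b => (if a && b then -1 else 1) / (Real.sqrt 2 : ℂ)

noncomputable def tGate : Matrix Bool Bool ℂ :=
  Matrix.diagonal fun a => if a then Complex.exp (Complex.I * (Real.pi / 4 : ℝ)) else 1

/-- The action of a gate on `n` wires.  An ill-formed gate (a wire that does not exist, or
a target that is also a control, or equal controls) acts as the identity. -/
noncomputable def Gate.sem (n : ℕ) : Gate → SOp (Q n) (Q n)
  | .h i => if hi : i < n then conj (onWire hadamardGate ⟨i, hi⟩) else LinearMap.id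
  | .t i => if hi : i < n then conj (onWire tGate ⟨i, hi⟩) else LinearMap.id
  | .x i =>
      if hi : i < n then
        conj (basisMap fun g => Function.update g ⟨i, hi⟩ (!g ⟨i, hi⟩))
      else LinearMap.id
  | .cnot c i =>
      if h : c < n ∧ i < n ∧ c ≠ i then
        conj (basisMap fun g => Function.update g ⟨i, h.2.1⟩ (g ⟨i, h.2.1⟩ ^^ g ⟨c, h.1⟩))
      else LinearMap.id
  | .toffoli c d i =>
      if h : c < n ∧ d < n ∧ i < n ∧ c ≠ i ∧ d ≠ i ∧ c ≠ d then
        conj (basisMap fun g => Function.update g ⟨i, h.2.2.1⟩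
          (g ⟨i, h.2.2.1⟩ ^^ (g ⟨c, h.1⟩ && g ⟨d, h.2.1⟩)))
      else LinearMap.id
  | .reset i =>
      if hi : i < n then
        ∑ b : Bool, conj (onWire (Matrix.single false b 1) ⟨i, hi⟩)
      else LinearMap.id

/-- The action of a circuit on `n` wires. -/
noncomputable def Circuit.sem (n : ℕ) : Circuit → SOp (Q n) (Q n)
  | [] => LinearMap.id
  | g :: c => Circuit.sem n c ∘ₗ g.sem n

/-- A circuit together with a number of ancilla qubits. -/
structure AncCircuit where
  anc : ℕ
  gates : Circuit

instance : TreeData AncCircuit where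
  enc C := TreeData.enc (C.anc, C.gates)
  inj := by
    rintro ⟨a, b⟩ ⟨c, d⟩ h
    have := TreeData.inj h
    simp_all

/-- Run the circuit on `n` qubits followed by the ancillas in state `|0…0⟩`. -/
noncomputable def AncCircuit.run (C : AncCircuit) (n : ℕ) : SOp (Q n) (Q (n + C.anc)) :=
  Circuit.sem (n + C.anc) C.gates ∘ₗ join n C.anc ∘ₗ tensorRight (Q n) (zeros C.anc)

/-- The channel on `n` qubits: run the circuit and discard the ancillas. -/
noncomputable def AncCircuit.chan (C : AncCircuit) (n : ℕ) : SOp (Q n) (Q n) :=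
  traceRight (Q n) (Q C.anc) ∘ₗ split n C.anc ∘ₗ C.run n

open scoped Classical in
/-- The circuit as a decision procedure: the probability that wire `0` is measured to be `1`. -/
noncomputable def AncCircuit.acceptProb (C : AncCircuit) (n : ℕ) (ρ : Matrix (Q n) (Q n) ℂ) : ℝ :=
  ∑ f : Q (n + C.anc) with AllOnes [0] f, (C.run n ρ f f).re

/-! ## QMA -/

/-- A promise problem. -/
structure PromiseProblem where
  yes : Set (List Bool)
  no : Set (List Bool)
  disjoint : Disjoint yes no

/-- A candidate QMA verification procedure: witness length and verification circuits. -/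
structure QMAVerifier where
  wit : Polynomial ℕ
  circ : List Bool → AncCircuit

/-- Number of witness qubits for the instance `x`. -/
noncomputable def QMAVerifier.witQubits (V : QMAVerifier) (x : List Bool) : ℕ :=
  V.wit.eval x.length

/-- `Pr[V(x, w) = ⊤]`. -/
noncomputable def QMAVerifier.acceptProb (V : QMAVerifier) (x : List Bool)
    (w : Matrix (Q (V.witQubits x)) (Q (V.witQubits x)) ℂ) : ℝ :=
  (V.circ x).acceptProb (V.witQubits x) w

/-- `V` is a quantum polynomial-time procedure witnessing that `A` is in QMA. -/
def QMAVerifier.Decides (V : QMAVerifier) (A : PromiseProblem) : Prop :=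
  PolyTime V.circ ∧
  ∃ (α β : ℕ → ℝ) (r : Polynomial ℕ),
    (∀ n, 0 ≤ β n ∧ β n < α n ∧ α n ≤ 1) ∧
    (∀ n, 0 < r.eval n ∧ 1 / ((r.eval n : ℕ) : ℝ) ≤ α n - β n) ∧
    (∀ x ∈ A.yes, ∃ w, IsState w ∧ α x.length ≤ V.acceptProb x w) ∧
    (∀ x ∈ A.no, ∀ w, IsState w → V.acceptProb x w ≤ β x.length)

/-- A yes-instance `x` together with a witness `w ∈ R_A(x)`, that is, a state accepted with
probability at least `2/3`. -/
structure WitnessedYes (A : PromiseProblem) (V : QMAVerifier) where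
  x : List Bool
  w : Matrix (Q (V.witQubits x)) (Q (V.witQubits x)) ℂ
  mem : x ∈ A.yes
  state : IsState w
  accepted : 2 / 3 ≤ V.acceptProb x w

/-! ## Interaction -/

/-- `Φ` acting on the prover's and the message register. -/
noncomputable def actProver {α μ : Type} (β : Type) (Φ : SOp (α × μ) (α × μ)) :
    SOp (α × μ × β) (α × μ × β) :=
  relabel (Equiv.prodAssoc α μ β) ∘ₗ amplify β Φ ∘ₗ relabel (Equiv.prodAssoc α μ β).symm

/-- Move the prover's register to the end and put the verifier's before the message register. -/
def toVerifier (α μ β : Type) : (α × μ × β) ≃ ((β × μ) × α) where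
  toFun p := ((p.2.2, p.2.1), p.1)
  invFun p := (p.2, p.1.2, p.1.1)
  left_inv _ := rfl
  right_inv _ := rfl

/-- `Ψ` acting on the verifier's and the message register. -/
noncomputable def actVerifier {μ β : Type} (α : Type) (Ψ : SOp (β × μ) (β × μ)) :
    SOp (α × μ × β) (α × μ × β) :=
  relabel (toVerifier α μ β).symm ∘ₗ amplify α Ψ ∘ₗ relabel (toVerifier α μ β)

/-- `r` rounds of interaction between a prover (register `α`) and a verifier (register `β`) who
exchange the message register `μ`.  In round `t` the prover moves first, then the verifier. -/
noncomputable def interact {α μ β : Type} (P : ℕ → SOp (α × μ) (α × μ))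
    (V : ℕ → SOp (β × μ) (β × μ)) : ℕ → SOp (α × μ × β) (α × μ × β)
  | 0 => LinearMap.id
  | r + 1 => actVerifier α (V r) ∘ₗ actProver β (P r) ∘ₗ interact P V r

/-- The moves described by a list of circuits on `n` private wires followed by `m` message wires
(no action after the end of the list). -/
noncomputable def moves (n m : ℕ) (l : List Circuit) (t : ℕ) : SOp (Q n × Q m) (Q n × Q m) :=
  split n m ∘ₗ Circuit.sem (n + m) (l.getD t []) ∘ₗ join n m

/-- An honest machine: number of work qubits, one circuit for each of its moves, and the
private wires that are measured at the end; it outputs `⊤` iff all of them give `1`. -/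
structure Party where
  work : ℕ
  circs : List Circuit
  out : List ℕ

instance : TreeData Party where
  enc P := TreeData.enc (P.work, P.circs, P.out)
  inj := by
    rintro ⟨a, b, c⟩ ⟨d, e, f⟩ h
    have := TreeData.inj h
    simp_all

/-- A quantum interactive protocol.  On the instance `x` the parties exchange a register of
`msg x` qubits (initially `|0…0⟩`) in `rounds x` rounds.  The prover holds `copies |x|` copies of
the witness followed by its work qubits; the verifier has only work qubits. -/
structure Protocol where
  copies : Polynomial ℕ
  msg : List Bool → ℕ
  rounds : List Bool → ℕ
  prover : List Bool → Party
  verifier : List Bool → Party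

/-- Prover and verifier are quantum polynomial-time machines: the descriptions of their circuits
are computed from the instance in polynomial time. -/
def Protocol.IsQPT (prot : Protocol) : Prop :=
  PolyTime prot.msg ∧ PolyTime prot.rounds ∧ PolyTime prot.prover ∧ PolyTime prot.verifier

/-- Number of qubits of the prover's input when a witness has `n` qubits. -/
noncomputable def Protocol.inQubits (prot : Protocol) (x : List Bool) (n : ℕ) : ℕ :=
  prot.copies.eval x.length * n

/-- Number of the prover's private qubits when a witness has `n` qubits. -/
noncomputable def Protocol.privQubits (prot : Protocol) (x : List Bool) (n : ℕ) : ℕ :=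
  prot.inQubits x n + (prot.prover x).work

/-- `w^{⊗ k}`; copy number `c` occupies the wires `c * n, …, c * n + n - 1`. -/
noncomputable def tensorPower {n : ℕ} (k : ℕ) (w : Matrix (Q n) (Q n) ℂ) :
    Matrix (Q (k * n)) (Q (k * n)) ℂ :=
  Matrix.of fun f g =>
    ∏ c : Fin k, w (fun i => f (finProdFinEquiv (c, i))) (fun i => g (finProdFinEquiv (c, i)))

/-- The joint state at the end of the execution of the honest prover with witness `w` on the
instance `x` against the verifier moves `V`, as a function of the verifier's initial state. -/
noncomputable def Protocol.execute (prot : Protocol) (x : List Bool) {n : ℕ}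
    (w : Matrix (Q n) (Q n) ℂ) {β : Type} (V : ℕ → SOp (β × Q (prot.msg x)) (β × Q (prot.msg x))) :
    SOp β (Q (prot.privQubits x n) × Q (prot.msg x) × β) :=
  interact (moves (prot.privQubits x n) (prot.msg x) (prot.prover x).circs) V (prot.rounds x) ∘ₗ
    tensorLeft _ (join (prot.inQubits x n) (prot.prover x).work
      (tensorPower (prot.copies.eval x.length) w ⊗ₖ zeros (prot.prover x).work)) ∘ₗ
    tensorLeft β (zeros (prot.msg x))

/-- The joint state at the end of the execution of the honest prover and the honest verifier. -/
noncomputable def Protocol.honest (prot : Protocol) (x : List Bool) {n : ℕ}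
    (w : Matrix (Q n) (Q n) ℂ) :
    Matrix (Q (prot.privQubits x n) × Q (prot.msg x) × Q (prot.verifier x).work)
      (Q (prot.privQubits x n) × Q (prot.msg x) × Q (prot.verifier x).work) ℂ :=
  prot.execute x w (moves (prot.verifier x).work (prot.msg x) (prot.verifier x).circs)
    (zeros (prot.verifier x).work)

/-- Probability that the verifier outputs `⊤` when the joint final state is `ρ`. -/
noncomputable def verifierAccepts {α μ : Type} [Fintype α] [Fintype μ] {n : ℕ} (out : List ℕ)
    (ρ : Matrix (α × μ × Q n) (α × μ × Q n) ℂ) : ℝ :=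
  probLeft (fun p : Q n × μ => AllOnes out p.1) (relabel (toVerifier α μ (Q n)) ρ)

/-- `Pr[OUT_V⟨P(w^{⊗k}), V⟩(x) = ⊤]` for the honest parties. -/
noncomputable def Protocol.verifierProb (prot : Protocol) (x : List Bool) {n : ℕ}
    (w : Matrix (Q n) (Q n) ℂ) : ℝ :=
  verifierAccepts (prot.verifier x).out (prot.honest x w)

/-- `Pr[OUT_P⟨P(w^{⊗k}), V⟩(x) = ⊤]` for the honest parties. -/
noncomputable def Protocol.proverProb (prot : Protocol) (x : List Bool) {n : ℕ}
    (w : Matrix (Q n) (Q n) ℂ) : ℝ :=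
  probLeft (AllOnes (prot.prover x).out) (prot.honest x w)

/-- A malicious verifier on one instance: number of private qubits and one circuit for each of its
moves, on the private wires followed by the message wires.  Its input is a state of all private
qubits and its output is the final state of all private qubits; it can reset wires, so inputs and
outputs on fewer qubits and work qubits in state `|0⟩` are covered. -/
structure MalVerifier where
  priv : ℕ
  circs : List Circuit

instance : TreeData MalVerifier where
  enc P := TreeData.enc (P.priv, P.circs)
  inj := by
    rintro ⟨a, b⟩ ⟨c, d⟩ h
    have := TreeData.inj h
    simp_all

/-- The joint final state of the honest prover and a malicious verifier. -/
noncomputable def Protocol.malExecute (prot : Protocol) (x : List Bool) {n : ℕ}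
    (w : Matrix (Q n) (Q n) ℂ) (W : MalVerifier) :
    SOp (Q W.priv) (Q (prot.privQubits x n) × Q (prot.msg x) × Q W.priv) :=
  prot.execute x w (moves W.priv (prot.msg x) W.circs)

/-- The channel `OUT_{V*}⟨P(w^{⊗k}), V*(·)⟩(x)`. -/
noncomputable def Protocol.outV (prot : Protocol) (x : List Bool) {n : ℕ}
    (w : Matrix (Q n) (Q n) ℂ) (W : MalVerifier) : SOp (Q W.priv) (Q W.priv) :=
  traceLeft _ _ ∘ₗ traceLeft _ _ ∘ₗ prot.malExecute x w W

/-- The channel `OUT'_{P,V*}⟨P(w^{⊗k}), V*(·)⟩(x)`.  The verifier's output is followed by a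
flag qubit: `(⊤, ξ)` is `ξ ⊗ |1⟩⟨1|` and `(⊥, ⊥)` is `|0…0⟩⟨0…0| ⊗ |0⟩⟨0|`. -/
noncomputable def Protocol.outPV (prot : Protocol) (x : List Bool) {n : ℕ}
    (w : Matrix (Q n) (Q n) ℂ) (W : MalVerifier) : SOp (Q W.priv) (Q (W.priv + 1)) :=
  join W.priv 1 ∘ₗ
    (tensorRight (Q W.priv) (ketbra fun _ : Fin 1 => true) ∘ₗ traceLeft _ _ ∘ₗ
        traceLeftOn (AllOnes (prot.prover x).out) +
      (Matrix.traceLinearMap _ ℂ ℂ ∘ₗ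
        traceLeftOn fun f => ¬ AllOnes (prot.prover x).out f).smulRight
          (zeros W.priv ⊗ₖ zeros 1)) ∘ₗ
    prot.malExecute x w W

/-! ## Indistinguishability of families of channels -/

/-- Computational indistinguishability of two families of channels; `len i` is the security
parameter of the index `i`.  For all polynomial-size distinguishing circuits, which may be given
any state of the input and polynomially many further qubits, the advantage is bounded by
a negligible function of the security parameter. -/
def CompIndist {I : Type} (len a b : I → ℕ) (C₀ C₁ : ∀ i, SOp (Q (a i)) (Q (b i))) : Prop :=
  ∀ s : Polynomial ℕ, ∃ ε : ℕ → ℝ, Negligible ε ∧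
    ∀ (i : I) (k : ℕ) (σ : Matrix (Q (a i) × Q k) (Q (a i) × Q k) ℂ) (D : AncCircuit),
      k ≤ s.eval (len i) → IsState σ → dataSize D ≤ s.eval (len i) →
      |D.acceptProb (b i + k) (join (b i) k (amplify (Q k) (C₀ i) σ)) -
        D.acceptProb (b i + k) (join (b i) k (amplify (Q k) (C₁ i) σ))| ≤ ε (len i)

/-- Statistical indistinguishability: as before, but the distinguisher performs an arbitrary
two-outcome measurement `{E, 1 - E}`. -/
def StatIndist {I : Type} (len a b : I → ℕ) (C₀ C₁ : ∀ i, SOp (Q (a i)) (Q (b i))) : Prop :=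
  ∃ ε : ℕ → ℝ, Negligible ε ∧
    ∀ (i : I) (k : ℕ) (σ : Matrix (Q (a i) × Q k) (Q (a i) × Q k) ℂ)
      (E : Matrix (Q (b i) × Q k) (Q (b i) × Q k) ℂ),
      IsState σ → E.PosSemidef → (1 - E).PosSemidef →
      |(E * amplify (Q k) (C₀ i) σ).trace.re - (E * amplify (Q k) (C₁ i) σ).trace.re| ≤ ε (len i)

/-! ## Proof systems -/

/-- `c`-completeness. -/
def Protocol.Complete (prot : Protocol) (A : PromiseProblem) (V : QMAVerifier) (c : ℕ → ℝ) : Prop :=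
  ∀ i : WitnessedYes A V, c i.x.length ≤ prot.verifierProb i.x i.w

/-- Prover's completeness. -/
def Protocol.ProverComplete (prot : Protocol) (A : PromiseProblem) (V : QMAVerifier) : Prop :=
  ∃ ε : ℕ → ℝ, Negligible ε ∧
    ∀ i : WitnessedYes A V, 1 - ε i.x.length ≤ prot.proverProb i.x i.w

/-- `s`-soundness against unbounded provers: arbitrary finite-dimensional private register,
arbitrary initial state, arbitrary channels as moves. -/
def Protocol.Sound (prot : Protocol) (A : PromiseProblem) (s : ℕ → ℝ) : Prop :=
  ∀ x ∈ A.no, ∀ (α : Type) [Fintype α] [DecidableEq α] (ρ : Matrix α α ℂ)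
    (P : ℕ → SOp (α × Q (prot.msg x)) (α × Q (prot.msg x))),
    IsState ρ → (∀ t, IsChannel (P t)) →
    verifierAccepts (prot.verifier x).out
      (interact P (moves (prot.verifier x).work (prot.msg x) (prot.verifier x).circs)
        (prot.rounds x) (ρ ⊗ₖ (zeros (prot.msg x) ⊗ₖ zeros (prot.verifier x).work))) ≤ s x.length

/-- Computational zero-knowledge.  The simulator is a polynomial-time program that computes from
the instance and the circuits of the malicious verifier the quantum circuit to be applied to the
input of the malicious verifier. -/
def Protocol.CompZK (prot : Protocol) (A : PromiseProblem) (V : QMAVerifier) : Prop :=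
  ∃ S : List Bool × MalVerifier → AncCircuit, PolyTime S ∧
    ∀ W : List Bool → MalVerifier, PolySize W →
      CompIndist (fun i : WitnessedYes A V => i.x.length)
        (fun i => (W i.x).priv) (fun i => (W i.x).priv)
        (fun i => prot.outV i.x i.w (W i.x))
        (fun i => (S (i.x, W i.x)).chan (W i.x).priv)

/-- Certified everlasting zero-knowledge. -/
def Protocol.CertEverlastingZK (prot : Protocol) (A : PromiseProblem) (V : QMAVerifier) : Prop :=
  ∃ S : List Bool × MalVerifier → AncCircuit, PolyTime S ∧
    ∀ W : List Bool → MalVerifier, PolySize W →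
      StatIndist (fun i : WitnessedYes A V => i.x.length)
        (fun i => (W i.x).priv) (fun i => (W i.x).priv + 1)
        (fun i => prot.outPV i.x i.w (W i.x))
        (fun i => (S (i.x, W i.x)).chan ((W i.x).priv + 1) ∘ₗ join (W i.x).priv 1 ∘ₗ
          tensorRight (Q (W i.x).priv) (zeros 1))

/-- `c`-complete `s`-sound computational zero-knowledge proof for `A`. -/
structure Protocol.IsCompZKProof (prot : Protocol) (A : PromiseProblem) (V : QMAVerifier)
    (c s : ℕ → ℝ) : Prop where
  qpt : prot.IsQPT
  complete : prot.Complete A V c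
  sound : prot.Sound A s
  compZK : prot.CompZK A V

/-- Certified everlasting zero-knowledge proof for `A` with `c`-completeness and
`s`-soundness. -/
structure Protocol.IsCEZKProof (prot : Protocol) (A : PromiseProblem) (V : QMAVerifier)
    (c s : ℕ → ℝ) : Prop extends prot.IsCompZKProof A V c s where
  proverComplete : prot.ProverComplete A V
  certEverlastingZK : prot.CertEverlastingZK A V

/-! ## Sequential repetition -/

/-- The wires used in run `j` out of `N` by a party with `a` input wires and `b` work wires,
followed by the message wires: in the repetition the private wires are `N` input blocks of size `a`
and then `N` work blocks of size `b`, and run `j` uses the blocks number `j`. -/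
def runWire (N a b j i : ℕ) : ℕ :=
  if i < a then j * a + i
  else if i < a + b then N * a + j * b + (i - a)
  else N * a + N * b + (i - (a + b))

/-- The party that plays `N` runs of `r` rounds one after the other with a fresh part of its input
and fresh work qubits in each run, and outputs `⊤` iff it does so in every run.  The circuit `start`
is executed at the beginning of each run. -/
def Party.repeat (P : Party) (N r a : ℕ) (start : Circuit) : Party where
  work := N * P.work
  circs := (List.range N).flatMap fun j => (List.range r).map fun t =>
    (if t = 0 then start else []) ++
      (P.circs.getD t []).map (Gate.map (runWire N a P.work j))
  out := (List.range N).flatMap fun j => P.out.map (runWire N a P.work j)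

/-- The `N`-fold sequential repetition of a protocol.  The prover uses `k` fresh copies of the
witness in each run, and resets the message register when it starts a run. -/
noncomputable def Protocol.seqRep (prot : Protocol) (V : QMAVerifier) (N : Polynomial ℕ) :
    Protocol where
  copies := N * prot.copies
  msg := prot.msg
  rounds x := N.eval x.length * prot.rounds x
  prover x :=
    let M := N.eval x.length
    let a := prot.inQubits x (V.witQubits x)
    (prot.prover x).repeat M (prot.rounds x) a
      ((List.range (prot.msg x)).map fun i =>
        Gate.reset (M * a + M * (prot.prover x).work + i))
  verifier x := (prot.verifier x).repeat (N.eval x.length) (prot.rounds x) 0 []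

end QZK

open QZK

set_option linter.unusedSectionVars false

namespace QZK

/-! ## Polynomial bounds -/

/-! A run of the honest prover uses fresh copies of the witness and fresh work qubits, which no
other run touches, and it begins by resetting the message register. Seen from the verifier's
register, a run is therefore a single completely positive map, `Protocol.accept`, and N runs are the
composite of N such maps, with the verifier's moves shifted by the rounds already played
(`Protocol.accept_seqRep`). The map can be restricted to an event of the prover's final measurement;
for "the prover outputs ⊤ in all runs" the composite is that of the accepting branches. The core is
`traceLeftOn_seqComp`: if step j acts on block j of a product state and on a common system, the
blocks can be measured and discarded one at a time. Subsystems are described by lenses, and renaming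
the wires of a circuit is lifting its action along a lens (`Circuit.sem_map`).

Completeness: against the honest verifier, whose register is a product of fresh blocks too, the runs
are independent and both acceptance probabilities are exact N-th powers
(`Protocol.verifierProb_seqRep`, `Protocol.proverProb_seqRep`). Bernoulli's inequality bounds the
error by N times a negligible function.

Soundness: a cheating prover may carry any state from run to run, so there is no independence.
However, up to normalisation, the prover's state given that all runs so far were accepted is a
legitimate initial state for a cheating prover in a single run. So each run multiplies its trace by
at most s (`Protocol.Sound.runOp_trace_le`). The message left over from the previous run is kept
privately by a prover who swaps it in at the start (`restoring`). Finally (1 - 1/q)^N ≤ exp(-N/q).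

Zero-knowledge: both properties follow from a hybrid argument over the runs (`abs_sub_seqComp_le`).
Run j is simulated for the malicious verifier whose earlier moves are dropped. Neighbouring hybrids
differ in one run. The real runs before it only prepare its input, which may be any state; the
simulated runs after it are absorbed into the distinguisher, as a polynomial-size circuit
(`simulateThen`) or as a measurement pulled back along a channel (`exists_effect`). Since the number
of runs grows with the instance, one negligible bound must serve all of them;
`exists_negligible_forall` gets it by selecting the worst run on each instance, which yields another
non-uniform malicious verifier.

In the certified everlasting case the output is determined by the accepting branch (`flagged`). The
simulator collects failures in an extra wire and erases everything if one has occurred (`repeatSim`,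
`chan_repeatSim`). The hybrids are subnormalised, and the rest of the simulation has to be completed
to a channel (`continueWith`) before a measurement can be pulled back through it
(`flagged_seqComp_close`).

Efficiency of parties and simulators rests on the closure properties of `PolyTime`, in which
`PolyTime.foldl` is the only use of a loop. -/

theorem polyEval_mono (p : Polynomial ℕ) : Monotone fun n : ℕ => p.eval n := by
  intro m n h
  induction p using Polynomial.induction_on' with
  | add p q hp hq => simpa using Nat.add_le_add hp hq
  | monomial k a => simpa using Nat.mul_le_mul_left a (Nat.pow_le_pow_left h k)

/-- `f` is bounded by a polynomial in `s`. -/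
def PolyBdd {α : Type} (s f : α → ℕ) : Prop :=
  ∃ b : Polynomial ℕ, ∀ a, f a ≤ b.eval (s a)

namespace PolyBdd

variable {α : Type} {s f g : α → ℕ}

theorem self : PolyBdd s s := ⟨Polynomial.X, by simp⟩

theorem const (c : ℕ) : PolyBdd s fun _ => c := ⟨Polynomial.C c, by simp⟩

theorem add (hf : PolyBdd s f) (hg : PolyBdd s g) : PolyBdd s fun a => f a + g a := by
  obtain ⟨b, hb⟩ := hf
  obtain ⟨c, hc⟩ := hg
  exact ⟨b + c, fun a => by simpa using Nat.add_le_add (hb a) (hc a)⟩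

theorem mul (hf : PolyBdd s f) (hg : PolyBdd s g) : PolyBdd s fun a => f a * g a := by
  obtain ⟨b, hb⟩ := hf
  obtain ⟨c, hc⟩ := hg
  exact ⟨b * c, fun a => by simpa using Nat.mul_le_mul (hb a) (hc a)⟩

theorem mono (hf : PolyBdd s f) (h : ∀ a, g a ≤ f a) : PolyBdd s g := by
  obtain ⟨b, hb⟩ := hf
  exact ⟨b, fun a => (h a).trans (hb a)⟩

theorem eval (hf : PolyBdd s f) (p : Polynomial ℕ) : PolyBdd s fun a => p.eval (f a) := by
  obtain ⟨b, hb⟩ := hf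
  exact ⟨p.comp b, fun a => by simpa using polyEval_mono p (hb a)⟩

theorem trans (hg : PolyBdd f g) (hf : PolyBdd s f) : PolyBdd s g := by
  obtain ⟨p, hp⟩ := hg
  exact (hf.eval p).mono hp

theorem comp {β : Type} (hf : PolyBdd s f) (k : β → α) : PolyBdd (s ∘ k) (f ∘ k) := by
  obtain ⟨b, hb⟩ := hf
  exact ⟨b, fun a => hb (k a)⟩

end PolyBdd

/-! ## Running programs -/

theorem Val.size_pos (v : Val) : 0 < v.size := by
  cases v <;> simp [Val.size]

/-- Every instruction is charged the size of its input, and `pair` pays for the new node with it.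
This is what makes polynomial time closed under composition: intermediate results are polynomially
bounded. -/
theorem Runs.size_le {p : Code} {v out : Val} {t : ℕ} (h : Runs p v out t) : out.size ≤ t := by
  induction h with
  | nil v => exact v.size_pos
  | @pair f g v a b s t _ _ _ _ => have := v.size_pos; simp only [Val.size]; omega
  | _ => all_goals (try simp only [Val.size] at *); omega

/-- On `v` the program `p` halts with output `out` after at most `T` steps. -/
def RunsIn (p : Code) (v out : Val) (T : ℕ) : Prop := ∃ t, t ≤ T ∧ Runs p v out t

namespace RunsIn

variable {p f g c : Code} {v u out a b : Val} {S T : ℕ}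

theorem size_le (h : RunsIn p v out T) : out.size ≤ T := by
  obtain ⟨t, ht, h⟩ := h
  exact h.size_le.trans ht

theorem id (v : Val) : RunsIn .id v v v.size := ⟨_, le_rfl, .id v⟩

theorem nil (v : Val) : RunsIn .nil v .nil v.size := ⟨_, le_rfl, .nil v⟩

theorem fst (a b : Val) : RunsIn .fst (.pair a b) a (Val.pair a b).size := ⟨_, le_rfl, .fst_pair a b⟩

theorem snd (a b : Val) : RunsIn .snd (.pair a b) b (Val.pair a b).size := ⟨_, le_rfl, .snd_pair a b⟩

theorem comp (hf : RunsIn f v u S) (hg : RunsIn g u out T) :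
    RunsIn (.comp g f) v out (v.size + S + T) := by
  obtain ⟨s, hs, hf⟩ := hf
  obtain ⟨t, ht, hg⟩ := hg
  exact ⟨_, by omega, .comp hf hg⟩

theorem pair (hf : RunsIn f v a S) (hg : RunsIn g v b T) :
    RunsIn (.pair f g) v (.pair a b) (v.size + S + T) := by
  obtain ⟨s, hs, hf⟩ := hf
  obtain ⟨t, ht, hg⟩ := hg
  exact ⟨_, by omega, .pair hf hg⟩

theorem ite_pair (hc : RunsIn c v (.pair a b) S) (hf : RunsIn f v out T) :
    RunsIn (.ite c f g) v out (v.size + S + T) := by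
  obtain ⟨s, hs, hc⟩ := hc
  obtain ⟨t, ht, hf⟩ := hf
  exact ⟨_, by omega, .ite_pair hc hf⟩

theorem ite_nil (hc : RunsIn c v .nil S) (hg : RunsIn g v out T) :
    RunsIn (.ite c f g) v out (v.size + S + T) := by
  obtain ⟨s, hs, hc⟩ := hc
  obtain ⟨t, ht, hg⟩ := hg
  exact ⟨_, by omega, .ite_nil hc hg⟩

theorem mono (h : RunsIn p v out S) (hST : S ≤ T) : RunsIn p v out T := by
  obtain ⟨s, hs, h⟩ := h
  exact ⟨s, hs.trans hST, h⟩

/-- The sequence `v` lists the successive trees. One bound `S` covers tree, condition and body, so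
each of the `n + 1` tests of the condition accounts for at most `3 * S` steps. -/
theorem loop (n : ℕ) : ∀ (v : ℕ → Val),
    (∀ i < n, ∃ a b, RunsIn c (v i) (.pair a b) S) →
    (∀ i < n, RunsIn f (v i) (v (i + 1)) S) → RunsIn c (v n) .nil S → (∀ i ≤ n, (v i).size ≤ S) →
    RunsIn (.loop c f) (v 0) (v n) ((n + 1) * (3 * S)) := by
  induction n with
  | zero =>
    intro v _ _ hend hs
    obtain ⟨t, ht, h⟩ := hend
    refine ⟨_, ?_, .loop_done h⟩
    have := hs 0 le_rfl
    omega
  | succ n ih =>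
    intro v hc hf hend hs
    obtain ⟨r, hr, hl⟩ := ih (fun i => v (i + 1)) (fun i hi => hc (i + 1) (by omega))
      (fun i hi => hf (i + 1) (by omega)) hend (fun i hi => hs (i + 1) (by omega))
    obtain ⟨a, b, s, hs', h1⟩ := hc 0 (by omega)
    obtain ⟨t, ht, h2⟩ := hf 0 (by omega)
    refine ⟨_, ?_, .loop_step h1 h2 hl⟩
    have := hs 0 (by omega)
    have e : (n + 1 + 1) * (3 * S) = (n + 1) * (3 * S) + 3 * S := by ring
    omega

end RunsIn

/-! ## Closure properties of polynomial time -/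

/-- With trees as data in their own right, functions on encodings can be composed with typed
functions; `of_val` turns the result into a typed function again. -/
instance : TreeData Val where
  enc := _root_.id
  inj := Function.injective_id

/-- Replacing the polynomial by a cost function bounded by one lets costs be added up without
choosing polynomials. -/
theorem polyTime_iff {α β : Type} [TreeData α] [TreeData β] {f : α → β} :
    PolyTime f ↔ ∃ (p : Code) (t : α → ℕ), PolyBdd dataSize t ∧
      ∀ a, RunsIn p (TreeData.enc a) (TreeData.enc (f a)) (t a) := by
  constructor
  · rintro ⟨p, b, h⟩
    exact ⟨p, fun a => b.eval (dataSize a), ⟨b, fun _ => le_rfl⟩, h⟩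
  · rintro ⟨p, t, ⟨b, hb⟩, h⟩
    exact ⟨p, b, fun a => (h a).mono (hb a)⟩

namespace PolyTime

variable {α β γ δ : Type} [TreeData α] [TreeData β] [TreeData γ] [TreeData δ]

theorem polyBdd {f : α → β} (hf : PolyTime f) : PolyBdd dataSize fun a => dataSize (f a) := by
  obtain ⟨p, t, ht, h⟩ := polyTime_iff.1 hf
  exact ht.mono fun a => (h a).size_le

/-- Only the encodings of input and output matter. -/
theorem of_enc {α' β' : Type} [TreeData α'] [TreeData β'] {f : α → β} {f' : α' → β'}
    (hf : PolyTime f) (k : α' → α) (h₁ : ∀ a, TreeData.enc (k a) = TreeData.enc a)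
    (h₂ : ∀ a, TreeData.enc (f (k a)) = TreeData.enc (f' a)) : PolyTime f' := by
  obtain ⟨p, b, h⟩ := hf
  refine ⟨p, b, fun a => ?_⟩
  have := h (k a)
  rwa [dataSize, h₁, h₂] at this

theorem id : PolyTime (fun a : α => a) :=
  polyTime_iff.2 ⟨.id, dataSize, PolyBdd.self, fun _ => RunsIn.id _⟩

theorem comp {g : β → γ} {f : α → β} (hg : PolyTime g) (hf : PolyTime f) :
    PolyTime fun a => g (f a) := by
  have hs := hf.polyBdd
  obtain ⟨p, s, hs', h⟩ := polyTime_iff.1 hf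
  obtain ⟨q, t, ht, k⟩ := polyTime_iff.1 hg
  refine polyTime_iff.2 ⟨.comp q p, fun a => dataSize a + s a + t (f a),
    (PolyBdd.self.add hs').add ((ht.comp f).trans hs), fun a => (h a).comp (k _)⟩

theorem prod {f : α → β} {g : α → γ} (hf : PolyTime f) (hg : PolyTime g) :
    PolyTime fun a => (f a, g a) := by
  obtain ⟨p, s, hs, h⟩ := polyTime_iff.1 hf
  obtain ⟨q, t, ht, k⟩ := polyTime_iff.1 hg
  exact polyTime_iff.2 ⟨.pair p q, fun a => dataSize a + s a + t a,
    (PolyBdd.self.add hs).add ht, fun a => (h a).pair (k _)⟩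

theorem fst : PolyTime (Prod.fst : α × β → α) :=
  polyTime_iff.2 ⟨.fst, dataSize, PolyBdd.self, fun _ => RunsIn.fst _ _⟩

theorem snd : PolyTime (Prod.snd : α × β → β) :=
  polyTime_iff.2 ⟨.snd, dataSize, PolyBdd.self, fun _ => RunsIn.snd _ _⟩

theorem fst' {f : α → β × γ} (hf : PolyTime f) : PolyTime fun a => (f a).1 := fst.comp hf

theorem snd' {f : α → β × γ} (hf : PolyTime f) : PolyTime fun a => (f a).2 := snd.comp hf

theorem valNil : PolyTime fun _ : α => Val.nil :=
  polyTime_iff.2 ⟨.nil, dataSize, PolyBdd.self, fun _ => RunsIn.nil _⟩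

theorem valPair {f g : α → Val} (hf : PolyTime f) (hg : PolyTime g) :
    PolyTime fun a => Val.pair (f a) (g a) :=
  (hf.prod hg).of_enc _root_.id (fun _ => rfl) fun _ => rfl

theorem enc {f : α → β} (hf : PolyTime f) : PolyTime fun a => TreeData.enc (f a) :=
  hf.of_enc _root_.id (fun _ => rfl) fun _ => rfl

theorem of_val {f : α → Val} (hf : PolyTime f) {g : α → β} (h : ∀ a, f a = TreeData.enc (g a)) :
    PolyTime g :=
  hf.of_enc _root_.id (fun _ => rfl) h

theorem const (c : β) : PolyTime fun _ : α => c := by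
  have h : ∀ v : Val, PolyTime fun _ : α => v := by
    intro v
    induction v with
    | nil => exact valNil
    | pair a b ha hb => exact ha.valPair hb
  exact (h (TreeData.enc c)).of_val fun _ => rfl

/-- Case distinction on whether a tree is a pair. -/
theorem valIte {c : α → Val} {f g h : α → β} (hc : PolyTime c) (hf : PolyTime f) (hg : PolyTime g)
    (h₁ : ∀ x, c x = Val.nil → h x = g x) (h₂ : ∀ x a b, c x = Val.pair a b → h x = f x) :
    PolyTime h := by
  obtain ⟨p, s, hs, k⟩ := polyTime_iff.1 hf
  obtain ⟨q, t, ht, l⟩ := polyTime_iff.1 hg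
  obtain ⟨r, u, hu, m⟩ := polyTime_iff.1 hc
  refine polyTime_iff.2 ⟨.ite r p q, fun a => dataSize a + u a + (s a + t a),
    (PolyBdd.self.add hu).add (hs.add ht), fun x => ?_⟩
  have hm : RunsIn r (TreeData.enc x) (c x) (u x) := m x
  cases hx : c x with
  | nil =>
    rw [hx] at hm
    rw [h₁ x hx]
    exact (RunsIn.ite_nil hm (l x)).mono (by simp only [dataSize]; omega)
  | pair a b =>
    rw [hx] at hm
    rw [h₂ x a b hx]
    exact (RunsIn.ite_pair hm (k x)).mono (by simp only [dataSize]; omega)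

theorem ite {c : α → Prop} [DecidablePred c] {f g : α → β} (hc : PolyTime fun x => decide (c x))
    (hf : PolyTime f) (hg : PolyTime g) : PolyTime fun x => if c x then f x else g x := by
  refine valIte (c := fun x => TreeData.enc (decide (c x))) hc.enc hf hg ?_ ?_
  · intro x h
    have : ¬ c x := by
      intro hx
      simp only [hx, decide_true] at h
      exact Val.noConfusion h
    simp [this]
  · intro x a b h
    have : c x := by
      by_contra hx
      simp only [hx, decide_false] at h
      exact Val.noConfusion h
    simp [this]

/-! ### Lists -/

theorem cons {f : α → β} {l : α → List β} (hf : PolyTime f) (hl : PolyTime l) :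
    PolyTime fun a => f a :: l a :=
  (hf.prod hl).of_enc _root_.id (fun _ => rfl) fun _ => rfl

theorem valFst {f : α → Val} (hf : PolyTime f) :
    PolyTime fun a => (match f a with | .nil => Val.nil | .pair x _ => x) := by
  have : PolyTime fun v : Val => (match v with | .nil => Val.nil | .pair x _ => x) := by
    refine polyTime_iff.2 ⟨.fst, dataSize, PolyBdd.self, fun v => ?_⟩
    cases v with
    | nil => exact ⟨_, le_rfl, .fst_nil⟩
    | pair a b => exact RunsIn.fst _ _
  exact this.comp hf

theorem valSnd {f : α → Val} (hf : PolyTime f) :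
    PolyTime fun a => (match f a with | .nil => Val.nil | .pair _ x => x) := by
  have : PolyTime fun v : Val => (match v with | .nil => Val.nil | .pair _ x => x) := by
    refine polyTime_iff.2 ⟨.snd, dataSize, PolyBdd.self, fun v => ?_⟩
    cases v with
    | nil => exact ⟨_, le_rfl, .snd_nil⟩
    | pair a b => exact RunsIn.snd _ _
  exact this.comp hf

theorem tail {l : α → List β} (hl : PolyTime l) : PolyTime fun a => (l a).tail :=
  (valSnd hl.enc).of_val fun a => by cases l a <;> rfl

theorem headD_nil {l : α → List (List β)} (hl : PolyTime l) : PolyTime fun a => (l a).headD [] :=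
  (valFst hl.enc).of_val fun a => by cases l a <;> rfl

end PolyTime

theorem length_le_dataSize {β : Type} [TreeData β] (l : List β) : l.length ≤ dataSize l := by
  induction l with
  | nil => simp
  | cons a l ih =>
    change _ ≤ 1 + (TreeData.enc a).size + dataSize l
    simp only [List.length_cons]; omega

theorem dataSize_cons {β : Type} [TreeData β] (a : β) (l : List β) :
    dataSize (a :: l) = 1 + dataSize a + dataSize l := rfl

theorem dataSize_nil {β : Type} [TreeData β] : dataSize ([] : List β) = 1 := rfl

theorem dataSize_prod {α β : Type} [TreeData α] [TreeData β] (p : α × β) :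
    dataSize p = 1 + dataSize p.1 + dataSize p.2 := rfl

theorem dataSize_append {β : Type} [TreeData β] (l m : List β) :
    dataSize (l ++ m) + 1 = dataSize l + dataSize m := by
  induction l with
  | nil => simp [dataSize_nil]; omega
  | cons a l ih => simp only [List.cons_append, dataSize_cons]; omega

theorem dataSize_drop_le {β : Type} [TreeData β] (l : List β) (n : ℕ) :
    dataSize (l.drop n) ≤ dataSize l := by
  induction l generalizing n with
  | nil => simp
  | cons a l ih =>
    cases n with
    | zero => simp
    | succ n => have := ih n; simp only [List.drop_succ_cons, dataSize_cons]; omega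

theorem dataSize_mem_le {β : Type} [TreeData β] {l : List β} {a : β} (h : a ∈ l) :
    dataSize a ≤ dataSize l := by
  induction l with
  | nil => simp at h
  | cons b l ih =>
    rw [dataSize_cons]
    rcases List.mem_cons.1 h with rfl | h
    · omega
    · have := ih h; omega

theorem dataSize_le_of_forall {β : Type} [TreeData β] (l : List β) (s : ℕ)
    (h : ∀ a ∈ l, dataSize a ≤ s) : dataSize l ≤ 1 + l.length * (1 + s) := by
  induction l with
  | nil => simp [dataSize_nil]
  | cons b l ih =>
    have h₁ := h b (by simp)
    have h₂ := ih fun a ha => h a (by simp [ha])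
    rw [dataSize_cons, List.length_cons, add_mul]; omega

@[simp] theorem dataSize_nat (n : ℕ) : dataSize n = 2 * n + 1 := by
  induction n with
  | zero => rfl
  | succ n ih =>
    have : dataSize (n + 1) = 1 + 1 + dataSize n := rfl
    omega

namespace PolyTime

variable {α β γ δ : Type} [TreeData α] [TreeData β] [TreeData γ] [TreeData δ]

/-- The loop works on the triple of parameter, remaining list and accumulator, and stops when the
list is empty. The size bound on all partial results is essential: iterating a polynomial-time
function may let its values grow exponentially. -/
theorem foldl {F : γ × (α × δ) → α} {i : γ → α} {L : γ → List δ} (hF : PolyTime F)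
    (hi : PolyTime i) (hL : PolyTime L)
    (hb : ∃ B : γ → ℕ, PolyBdd dataSize B ∧ ∀ x (n : ℕ), n ≤ (L x).length →
      dataSize (((L x).take n).foldl (fun a d => F (x, (a, d))) (i x)) ≤ B x) :
    PolyTime fun x => (L x).foldl (fun a d => F (x, (a, d))) (i x) := by
  obtain ⟨B, hB, hBd⟩ := hb
  have hinit := PolyTime.id.prod (hL.prod hi)
  have hLb := hL.polyBdd
  obtain ⟨p, tp, htp, hp⟩ := polyTime_iff.1 hF
  obtain ⟨q, tq, htq, hq⟩ := polyTime_iff.1 hinit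
  obtain ⟨bp, hbp⟩ := htp
  let st : γ → ℕ → Val := fun x n => .pair (TreeData.enc x) (.pair (TreeData.enc ((L x).drop n))
    (TreeData.enc (((L x).take n).foldl (fun a d => F (x, (a, d))) (i x))))
  -- `M` bounds the size of every state of the loop.
  let M : γ → ℕ := fun x => 2 + dataSize x + dataSize (L x) + B x
  have hM : PolyBdd dataSize M := ((PolyBdd.const 2).add PolyBdd.self).add hLb |>.add hB
  -- The argument of `p` has size at most `2 * M x`; the generous factor 40 pays for the projections
  -- and pairings around the call.
  let S : γ → ℕ := fun x => 40 * M x + bp.eval (2 * M x)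
  have hS : PolyBdd dataSize S :=
    ((PolyBdd.const 40).mul hM).add (((PolyBdd.const 2).mul hM).eval bp)
  -- The tree of `(x, (d :: l, a))` becomes that of `(x, (l, F (x, (a, d))))`.
  let body : Code := .pair .fst (.pair (.comp .snd (.comp .fst .snd))
    (.comp p (.pair .fst (.pair (.comp .snd .snd) (.comp .fst (.comp .fst .snd))))))
  let cond : Code := .comp .fst .snd
  have hst : ∀ x n, n ≤ (L x).length → (st x n).size ≤ M x := by
    intro x n hn
    have h1 := hBd x n hn
    have h2 := dataSize_drop_le (L x) n
    simp only [dataSize] at h1 h2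
    simp only [st, M, Val.size, dataSize]
    omega
  have hcond : ∀ x n, n ≤ (L x).length →
      RunsIn cond (st x n) (TreeData.enc ((L x).drop n)) (S x) := by
    intro x n hn
    refine ((RunsIn.snd _ _).comp (RunsIn.fst _ _)).mono ?_
    have := hst x n hn
    simp only [st, Val.size] at this
    simp only [S, Val.size]
    omega
  have hloop : ∀ x, RunsIn (.loop cond body) (st x 0) (st x (L x).length)
      (((L x).length + 1) * (3 * S x)) := by
    intro x
    apply RunsIn.loop
    · intro n hn
      have := hcond x n hn.le
      rw [List.drop_eq_getElem_cons hn] at this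
      exact ⟨_, _, this⟩
    · intro n hn
      have h1 := hst x n hn.le
      have e : st x n = .pair (TreeData.enc x) (.pair (.pair (TreeData.enc (L x)[n])
          (TreeData.enc ((L x).drop (n + 1))))
          (TreeData.enc (((L x).take n).foldl (fun a d => F (x, (a, d))) (i x)))) := by
        simp only [st]
        rw [List.drop_eq_getElem_cons hn]
        rfl
      have e' : st x (n + 1) = .pair (TreeData.enc x) (.pair
          (TreeData.enc ((L x).drop (n + 1)))
          (TreeData.enc (F (x, (((L x).take n).foldl (fun a d => F (x, (a, d))) (i x),
            (L x)[n]))))) := by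
        simp only [st]
        rw [List.take_succ_eq_append_getElem hn, List.foldl_append]
        rfl
      rw [e']
      rw [e] at h1 ⊢
      have hpn := hp (x, (((L x).take n).foldl (fun a d => F (x, (a, d))) (i x), (L x)[n]))
      have hle := hbp (x, (((L x).take n).foldl (fun a d => F (x, (a, d))) (i x), (L x)[n]))
      have hds : dataSize (x, (((L x).take n).foldl (fun a d => F (x, (a, d))) (i x), (L x)[n]))
          ≤ 2 * M x := by
        simp only [dataSize_prod]
        simp only [Val.size] at h1
        simp only [dataSize]
        omega
      have hle' : _ ≤ bp.eval (2 * M x) := hle.trans (polyEval_mono bp hds)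
      refine (((RunsIn.fst _ _).pair ((((RunsIn.snd _ _).comp (RunsIn.fst _ _)).comp
        (RunsIn.snd _ _)).pair ((((RunsIn.fst _ _).pair (((RunsIn.snd _ _).comp
        (RunsIn.snd _ _)).pair (((RunsIn.snd _ _).comp (RunsIn.fst _ _)).comp
          (RunsIn.fst _ _)))).comp hpn))))).mono ?_
      simp only [Val.size] at h1 ⊢
      simp only [S]
      omega
    · have := hcond x _ le_rfl
      rw [List.drop_length] at this
      exact this
    · intro n hn
      have := hst x n hn
      simp only [S]
      omega
  refine polyTime_iff.2 ⟨.comp (.comp .snd .snd) (.comp (.loop cond body) q),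
    fun x => dataSize x + (dataSize x + tq x + (((L x).length + 1) * (3 * S x))) +
      3 * M x, ?_, ?_⟩
  · exact (PolyBdd.self.add ((PolyBdd.self.add htq).add
      (((hLb.mono fun a => length_le_dataSize _).add (PolyBdd.const 1)).mul
        ((PolyBdd.const 3).mul hS)))).add ((PolyBdd.const 3).mul hM)
  · intro x
    have h0 : TreeData.enc (x, (L x, i x)) = st x 0 := by simp [st]; rfl
    have h1 := hq x
    rw [h0] at h1
    have h2 := hst x _ le_rfl
    have h3 : st x (L x).length = .pair (TreeData.enc x) (.pair .nil
        (TreeData.enc ((L x).foldl (fun a d => F (x, (a, d))) (i x)))) := by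
      simp only [st, List.drop_length, List.take_length]
      rfl
    have h4 := hloop x
    rw [h3] at h4 h2
    refine ((h1.comp h4).comp ((RunsIn.snd _ _).comp (RunsIn.snd _ _))).mono ?_
    simp only [Val.size] at h2 ⊢
    simp only [dataSize]
    omega

end PolyTime

namespace PolyTime

variable {α β γ δ : Type} [TreeData α] [TreeData β] [TreeData γ] [TreeData δ]

/-- A left fold with cons builds the list backwards. The special case of a projection is `reverse`,
and the two together give `map`. -/
theorem revMap {F : γ × δ → β} {L : γ → List δ} (hF : PolyTime F) (hL : PolyTime L) :
    PolyTime fun x => ((L x).map fun d => F (x, d)).reverse := by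
  have e : ∀ (x : γ) (l : List δ) (a : List β),
      l.foldl (fun a d => F (x, d) :: a) a = (l.map fun d => F (x, d)).reverse ++ a := by
    intro x l
    induction l with
    | nil => simp
    | cons d l ih => intro a; simp [ih]
  have := PolyTime.foldl (F := fun p : γ × (List β × δ) => F (p.1, p.2.2) :: p.2.1)
    (i := fun _ => []) (L := L)
    ((hF.comp (fst.prod (snd.comp snd))).cons (fst.comp snd)) (const _) hL ?_
  · simpa only [e, List.append_nil] using this
  · obtain ⟨b, hb⟩ := hF.polyBdd
    refine ⟨fun x => 1 + dataSize (L x) * (1 + b.eval (1 + dataSize x + dataSize (L x))), ?_, ?_⟩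
    · exact (PolyBdd.const 1).add (hL.polyBdd.mul ((PolyBdd.const 1).add
        ((((PolyBdd.const 1).add PolyBdd.self).add hL.polyBdd).eval b)))
    · intro x n _
      rw [e, List.append_nil]
      refine (dataSize_le_of_forall _ (b.eval (1 + dataSize x + dataSize (L x))) ?_).trans ?_
      · intro a ha
        simp only [List.mem_reverse, List.mem_map] at ha
        obtain ⟨d, hd, rfl⟩ := ha
        refine (hb _).trans (polyEval_mono b ?_)
        have := dataSize_mem_le (List.mem_of_mem_take hd)
        rw [dataSize_prod]; simp only; omega
      · have := length_le_dataSize (L x)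
        simp only [List.length_reverse, List.length_map, List.length_take]
        gcongr
        omega

theorem reverse {L : γ → List β} (hL : PolyTime L) : PolyTime fun x => (L x).reverse := by
  simpa using revMap (F := fun p : γ × β => p.2) snd hL

theorem map {F : γ × δ → β} {L : γ → List δ} (hF : PolyTime F) (hL : PolyTime L) :
    PolyTime fun x => (L x).map fun d => F (x, d) := by
  simpa using reverse (revMap hF hL)

theorem append {l m : γ → List β} (hl : PolyTime l) (hm : PolyTime m) :
    PolyTime fun x => l x ++ m x := by
  have e : ∀ (k : List β) (a : List β), k.foldl (fun a d => d :: a) a = k.reverse ++ a := by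
    intro k
    induction k with
    | nil => simp
    | cons d l ih => intro a; simp [ih]
  have := PolyTime.foldl (F := fun p : γ × (List β × β) => p.2.2 :: p.2.1)
    (i := m) (L := fun x => (l x).reverse)
    ((snd.comp snd).cons (fst.comp snd)) hm hl.reverse ?_
  · simpa only [e, List.reverse_reverse] using this
  · refine ⟨fun x => dataSize (l x) + dataSize (m x), hl.polyBdd.add hm.polyBdd, ?_⟩
    intro x n _
    rw [e]
    have h1 := dataSize_append ((((l x).reverse).take n).reverse) (m x)
    rw [List.take_reverse, List.reverse_reverse] at h1 ⊢
    have := dataSize_drop_le (l x) ((l x).length - n)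
    simp only
    omega

theorem flatten {L : γ → List (List β)} (hL : PolyTime L) : PolyTime fun x => (L x).flatten := by
  have e : ∀ (k : List (List β)) (a : List β), k.foldl (fun a d => a ++ d) a = a ++ k.flatten := by
    intro k
    induction k with
    | nil => simp
    | cons d l ih => intro a; simp [ih]
  have hs : ∀ (k : List (List β)), dataSize k.flatten ≤ dataSize k := by
    intro k
    induction k with
    | nil => simp [dataSize_nil]
    | cons d l ih =>
      have := dataSize_append d l.flatten
      rw [List.flatten_cons, dataSize_cons]; omega
  have ht : ∀ (k : List (List β)) n, dataSize (k.take n) ≤ dataSize k := by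
    intro k n
    have := dataSize_append (k.take n) (k.drop n)
    rw [List.take_append_drop] at this
    have h1 : 0 < dataSize (k.drop n) := Val.size_pos _
    omega
  have := PolyTime.foldl (F := fun p : γ × (List β × List β) => p.2.1 ++ p.2.2)
    (i := fun _ => []) (L := L)
    (append (fst.comp snd) (snd.comp snd)) (const _) hL ?_
  · simpa only [e, List.nil_append] using this
  · refine ⟨fun x => dataSize (L x), hL.polyBdd, ?_⟩
    intro x n _
    rw [e]
    exact (hs _).trans (ht _ _)

theorem flatMap {F : γ × δ → List β} {L : γ → List δ} (hF : PolyTime F) (hL : PolyTime L) :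
    PolyTime fun x => (L x).flatMap fun d => F (x, d) := by
  simpa only [List.flatMap_def] using flatten (map hF hL)

/-! ### Natural numbers -/

theorem succ_iterate (m k : ℕ) : (fun a => a + 1)^[k] m = m + k := Nat.succ_iterate m k

/-- The unary number and the list have the same tree. So iterating over a number is folding over a
list. -/
theorem replicate_false {n : γ → ℕ} (hn : PolyTime n) :
    PolyTime fun x => List.replicate (n x) false := by
  refine hn.of_enc _root_.id (fun _ => rfl) fun x => ?_
  simp only [_root_.id]
  generalize n x = k
  induction k with
  | zero => rfl
  | succ k ih => exact congrArg (Val.pair .nil) ih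

theorem iterate {F : γ × α → α} {i : γ → α} {n : γ → ℕ} (hF : PolyTime F) (hi : PolyTime i)
    (hn : PolyTime n) {B : γ → ℕ} (hB : PolyBdd dataSize B)
    (hb : ∀ x, ∀ k ≤ n x, dataSize ((fun a => F (x, a))^[k] (i x)) ≤ B x) :
    PolyTime fun x => (fun a => F (x, a))^[n x] (i x) := by
  have := PolyTime.foldl (F := fun p : γ × (α × Bool) => F (p.1, p.2.1))
    (i := i) (L := fun x => List.replicate (n x) false)
    (hF.comp (fst.prod (fst.comp snd))) hi (replicate_false hn) ⟨B, hB, fun x k hk => ?_⟩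
  · simpa only [List.foldl_const, List.length_replicate] using this
  · rw [List.length_replicate] at hk
    simp only [List.foldl_const, List.length_take, List.length_replicate]
    exact hb x _ (by omega)

theorem succ {n : γ → ℕ} (hn : PolyTime n) : PolyTime fun x => n x + 1 :=
  (valNil.valPair hn.enc).of_val fun _ => rfl

theorem pred {n : γ → ℕ} (hn : PolyTime n) : PolyTime fun x => n x - 1 :=
  (valSnd hn.enc).of_val fun a => by cases n a <;> rfl

theorem nat_polyBdd {n : γ → ℕ} (hn : PolyTime n) : PolyBdd dataSize n :=
  hn.polyBdd.mono fun x => by simp only [dataSize_nat]; omega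

theorem add {m n : γ → ℕ} (hm : PolyTime m) (hn : PolyTime n) : PolyTime fun x => m x + n x := by
  have := iterate (F := fun p : γ × ℕ => p.2 + 1) (succ snd) hm hn
    (((PolyBdd.const 2).mul (hm.nat_polyBdd.add hn.nat_polyBdd)).add (PolyBdd.const 1))
    fun x k hk => by
      simp only [succ_iterate, dataSize_nat]; omega
  simpa only [succ_iterate] using this

theorem mul {m n : γ → ℕ} (hm : PolyTime m) (hn : PolyTime n) : PolyTime fun x => m x * n x := by
  have e : ∀ c k : ℕ, (fun a => a + c)^[k] 0 = c * k := by
    intro c k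
    induction k with
    | zero => simp
    | succ k ih => rw [Function.iterate_succ_apply', ih]; ring
  have := iterate (F := fun p : γ × ℕ => p.2 + m p.1) (add snd (hm.comp fst)) (const 0) hn
    (((PolyBdd.const 2).mul (hm.nat_polyBdd.mul hn.nat_polyBdd)).add (PolyBdd.const 1))
    fun x k hk => by
      simp only [e, dataSize_nat]
      have := Nat.mul_le_mul_left (m x) hk
      omega
  simpa only [e] using this

theorem sub {m n : γ → ℕ} (hm : PolyTime m) (hn : PolyTime n) : PolyTime fun x => m x - n x := by
  have e : ∀ c k : ℕ, (fun a => a - 1)^[k] c = c - k := by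
    intro c k
    induction k with
    | zero => simp
    | succ k ih => rw [Function.iterate_succ_apply', ih]; omega
  have := iterate (F := fun p : γ × ℕ => p.2 - 1) (pred snd) hm hn
    (((PolyBdd.const 2).mul hm.nat_polyBdd).add (PolyBdd.const 1))
    fun x k hk => by
      simp only [e, dataSize_nat]; omega
  simpa only [e] using this

theorem lt {m n : γ → ℕ} (hm : PolyTime m) (hn : PolyTime n) :
    PolyTime fun x => decide (m x < n x) := by
  refine valIte (c := fun x => TreeData.enc (n x - m x)) (sub hn hm).enc (const true) (const false)
    ?_ ?_
  · intro x h
    have : n x - m x = 0 := TreeData.inj (h.trans (show Val.nil = TreeData.enc 0 from rfl))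
    simp only [decide_eq_false_iff_not]; omega
  · intro x a b h
    simp only [decide_eq_true_eq]
    by_contra hlt
    rw [show n x - m x = 0 by omega] at h
    exact Val.noConfusion h

theorem natEq {m : γ → ℕ} (hm : PolyTime m) (c : ℕ) : PolyTime fun x => decide (m x = c) := by
  have h := ite (lt hm (const c)) (const false) (ite (lt (const c) hm) (const false) (const true))
  refine h.of_enc _root_.id (fun _ => rfl) fun x => congrArg TreeData.enc ?_
  simp only [_root_.id]
  split_ifs <;> simp <;> omega

theorem polyEval {n : γ → ℕ} (hn : PolyTime n) (p : Polynomial ℕ) :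
    PolyTime fun x => p.eval (n x) := by
  induction p using Polynomial.induction_on' with
  | add p q hp hq => simpa only [Polynomial.eval_add] using add hp hq
  | monomial k a =>
    have : PolyTime fun x => n x ^ k := by
      induction k with
      | zero => simpa using const 1
      | succ k ih => simpa only [pow_succ] using mul ih hn
    simpa only [Polynomial.eval_monomial] using mul (const a) this

theorem length {L : γ → List β} (hL : PolyTime L) : PolyTime fun x => (L x).length := by
  have := PolyTime.foldl (F := fun p : γ × (ℕ × β) => p.2.1 + 1)
    (i := fun _ => 0) (L := L) (succ (fst.comp snd)) (const _) hL
    ⟨fun x => 2 * dataSize (L x) + 1, ((PolyBdd.const 2).mul hL.polyBdd).add (PolyBdd.const 1),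
      fun x n _ => by
        have := length_le_dataSize (L x)
        simp only [List.foldl_const, succ_iterate, dataSize_nat, List.length_take]; omega⟩
  simpa only [List.foldl_const, succ_iterate, zero_add] using this

theorem range {n : γ → ℕ} (hn : PolyTime n) : PolyTime fun x => List.range (n x) := by
  have e : ∀ k : ℕ, (fun l : List ℕ => l.length :: l)^[k] [] = (List.range k).reverse := by
    intro k
    induction k with
    | zero => simp
    | succ k ih => rw [Function.iterate_succ_apply', ih]; simp [List.range_succ]
  have := iterate (F := fun p : γ × List ℕ => p.2.length :: p.2) ((length snd).cons snd)
    (const []) hn (B := fun x => 1 + n x * (1 + (2 * n x + 1)))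
    ((PolyBdd.const 1).add (hn.nat_polyBdd.mul ((PolyBdd.const 1).add
      (((PolyBdd.const 2).mul hn.nat_polyBdd).add (PolyBdd.const 1)))))
    fun x k hk => by
      simp only [e]
      refine (dataSize_le_of_forall _ (2 * n x + 1) ?_).trans ?_
      · intro a ha
        simp only [List.mem_reverse, List.mem_range] at ha
        simp only [dataSize_nat]; omega
      · simp only [List.length_reverse, List.length_range]
        gcongr
  simpa only [e, List.reverse_reverse] using reverse this

theorem drop {L : γ → List β} {n : γ → ℕ} (hL : PolyTime L) (hn : PolyTime n) :
    PolyTime fun x => (L x).drop (n x) := by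
  have e : ∀ (k : ℕ) (l : List β), (fun l : List β => l.tail)^[k] l = l.drop k := by
    intro k l
    induction k with
    | zero => simp
    | succ k ih => rw [Function.iterate_succ_apply', ih]; simp
  have := iterate (F := fun p : γ × List β => p.2.tail) (tail snd) hL hn hL.polyBdd
    fun x k _ => by simpa only [e] using dataSize_drop_le _ _
  simpa only [e] using this

theorem getD_nil {L : γ → List (List β)} {n : γ → ℕ} (hL : PolyTime L) (hn : PolyTime n) :
    PolyTime fun x => (L x).getD (n x) [] := by
  refine (headD_nil (drop hL hn)).of_enc _root_.id (fun _ => rfl) fun x => congrArg TreeData.enc ?_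
  simp [List.headD_eq_head?_getD, List.getD_eq_getElem?_getD]

/-! ### Gates and circuits -/

theorem gate_map {φ : γ × ℕ → ℕ} (hφ : PolyTime φ) :
    PolyTime fun p : γ × Gate => p.2.map fun i => φ (p.1, i) := by
  -- A gate is decoded into its kind and three wire numbers. Wires that it does not have get the
  -- value 0, which is dropped when the gate is encoded again.
  let tag : Gate → ℕ := fun
    | .h _ => 0 | .t _ => 1 | .x _ => 2 | .cnot _ _ => 3 | .toffoli _ _ _ => 4 | .reset _ => 5
  let w₀ : Gate → ℕ := fun
    | .h i => i | .t i => i | .x i => i | .cnot c _ => c | .toffoli c _ _ => c | .reset i => i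
  let w₁ : Gate → ℕ := fun
    | .h _ => 0 | .t _ => 0 | .x _ => 0 | .cnot _ i => i | .toffoli _ d _ => d | .reset _ => 0
  let w₂ : Gate → ℕ := fun
    | .h _ => 0 | .t _ => 0 | .x _ => 0 | .cnot _ _ => 0 | .toffoli _ _ i => i | .reset _ => 0
  have hg : PolyTime fun g : Gate => TreeData.enc g := PolyTime.id.enc
  have ht : PolyTime tag := (valFst hg).of_val fun g => by cases g <;> rfl
  have h₀ : PolyTime w₀ := by
    refine (ite (natEq ht 3) (valFst (valSnd hg)) (ite (natEq ht 4) (valFst (valSnd hg))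
      (valSnd hg))).of_val fun g => ?_
    cases g <;> rfl
  have h₁ : PolyTime w₁ := by
    refine (ite (natEq ht 3) (valSnd (valSnd hg)) (ite (natEq ht 4)
      (valFst (valSnd (valSnd hg))) (const .nil))).of_val fun g => ?_
    cases g <;> rfl
  have h₂ : PolyTime w₂ := by
    refine (ite (natEq ht 4) (valSnd (valSnd (valSnd hg))) (const .nil)).of_val fun g => ?_
    cases g <;> rfl
  have k : ∀ {w : Gate → ℕ}, PolyTime w → PolyTime fun p : γ × Gate => φ (p.1, w p.2) :=
    fun hw => hφ.comp (fst.prod (hw.comp snd))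
  refine (valPair (ht.comp (snd (α := γ))).enc (ite (natEq (ht.comp snd) 3)
    ((k h₀).enc.valPair (k h₁).enc) (ite (natEq (ht.comp snd) 4)
      ((k h₀).enc.valPair ((k h₁).enc.valPair (k h₂).enc)) (k h₀).enc))).of_val ?_
  rintro ⟨x, g⟩
  cases g <;> rfl

theorem circuit_map {φ : γ × ℕ → ℕ} {c : γ → Circuit} (hφ : PolyTime φ) (hc : PolyTime c) :
    PolyTime fun x => (c x).map (Gate.map fun i => φ (x, i)) :=
  map (gate_map hφ) hc

theorem gate_reset {i : γ → ℕ} (hi : PolyTime i) : PolyTime fun x => Gate.reset (i x) :=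
  (valPair (const (encNat 5)) hi.enc).of_val fun _ => rfl

theorem gate_x {i : γ → ℕ} (hi : PolyTime i) : PolyTime fun x => Gate.x (i x) :=
  (valPair (const (encNat 2)) hi.enc).of_val fun _ => rfl

theorem gate_cnot {i j : γ → ℕ} (hi : PolyTime i) (hj : PolyTime j) :
    PolyTime fun x => Gate.cnot (i x) (j x) :=
  (valPair (const (encNat 3)) (valPair hi.enc hj.enc)).of_val fun _ => rfl

theorem gate_toffoli {i j k : γ → ℕ} (hi : PolyTime i) (hj : PolyTime j) (hk : PolyTime k) :
    PolyTime fun x => Gate.toffoli (i x) (j x) (k x) :=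
  (valPair (const (encNat 4)) (valPair hi.enc (valPair hj.enc hk.enc))).of_val fun _ => rfl

theorem ancCircuit {a : γ → ℕ} {c : γ → Circuit} (ha : PolyTime a) (hc : PolyTime c) :
    PolyTime fun x => AncCircuit.mk (a x) (c x) :=
  (ha.prod hc).of_enc _root_.id (fun _ => rfl) fun _ => rfl

theorem anc {C : γ → AncCircuit} (hC : PolyTime C) : PolyTime fun x => (C x).anc :=
  (valFst hC.enc).of_val fun _ => rfl

theorem gates {C : γ → AncCircuit} (hC : PolyTime C) : PolyTime fun x => (C x).gates :=
  (valSnd hC.enc).of_val fun _ => rfl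

theorem malVerifier {a : γ → ℕ} {c : γ → List Circuit} (ha : PolyTime a) (hc : PolyTime c) :
    PolyTime fun x => MalVerifier.mk (a x) (c x) :=
  (ha.prod hc).of_enc _root_.id (fun _ => rfl) fun _ => rfl

theorem priv {W : γ → MalVerifier} (hW : PolyTime W) : PolyTime fun x => (W x).priv :=
  (valFst hW.enc).of_val fun _ => rfl

theorem mal_circs {W : γ → MalVerifier} (hW : PolyTime W) : PolyTime fun x => (W x).circs :=
  (valSnd hW.enc).of_val fun _ => rfl

theorem party {a : γ → ℕ} {c : γ → List Circuit} {o : γ → List ℕ} (ha : PolyTime a)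
    (hc : PolyTime c) (ho : PolyTime o) : PolyTime fun x => Party.mk (a x) (c x) (o x) :=
  (ha.prod (hc.prod ho)).of_enc _root_.id (fun _ => rfl) fun _ => rfl

theorem work {P : γ → Party} (hP : PolyTime P) : PolyTime fun x => (P x).work :=
  (valFst hP.enc).of_val fun _ => rfl

theorem circs {P : γ → Party} (hP : PolyTime P) : PolyTime fun x => (P x).circs :=
  (valFst (valSnd hP.enc)).of_val fun _ => rfl

theorem out {P : γ → Party} (hP : PolyTime P) : PolyTime fun x => (P x).out :=
  (valSnd (valSnd hP.enc)).of_val fun _ => rfl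

/-! ### Repeated parties -/

theorem runWire {N a b j i : γ → ℕ} (hN : PolyTime N) (ha : PolyTime a) (hb : PolyTime b)
    (hj : PolyTime j) (hi : PolyTime i) :
    PolyTime fun x => runWire (N x) (a x) (b x) (j x) (i x) :=
  ite (lt hi ha) (add (mul hj ha) hi)
    (ite (lt hi (add ha hb)) (add (add (mul hN ha) (mul hj hb)) (sub hi ha))
      (add (add (mul hN ha) (mul hN hb)) (sub hi (add ha hb))))

theorem party_repeat {P : γ → Party} {N r a : γ → ℕ} {start : γ → Circuit} (hP : PolyTime P)
    (hN : PolyTime N) (hr : PolyTime r) (ha : PolyTime a) (hs : PolyTime start) :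
    PolyTime fun x => (P x).repeat (N x) (r x) (a x) (start x) := by
  refine party (mul hN hP.work) ?_ ?_
  · refine flatMap (F := fun p : γ × ℕ => (List.range (r p.1)).map fun t =>
      (if t = 0 then start p.1 else []) ++ ((P p.1).circs.getD t []).map
        (Gate.map (QZK.runWire (N p.1) (a p.1) (P p.1).work p.2))) ?_ (range hN)
    refine map (F := fun p : (γ × ℕ) × ℕ => (if p.2 = 0 then start p.1.1 else []) ++
      ((P p.1.1).circs.getD p.2 []).map
        (Gate.map (QZK.runWire (N p.1.1) (a p.1.1) (P p.1.1).work p.1.2))) ?_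
      (range (hr.comp fst))
    have f : PolyTime fun p : (γ × ℕ) × ℕ => p.1.1 := fst.comp fst
    refine append (ite (natEq snd 0) (hs.comp f) (const [])) ?_
    have f' : PolyTime fun p : ((γ × ℕ) × ℕ) × ℕ => p.1.1.1 := f.comp fst
    exact circuit_map (φ := fun p : ((γ × ℕ) × ℕ) × ℕ =>
      QZK.runWire (N p.1.1.1) (a p.1.1.1) (P p.1.1.1).work p.1.1.2 p.2)
      (runWire (hN.comp f') (ha.comp f') (hP.work.comp f') (snd.comp (fst.comp fst)) snd)
      (getD_nil (hP.circs.comp f) snd)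
  · refine flatMap (F := fun p : γ × ℕ => (P p.1).out.map
        (QZK.runWire (N p.1) (a p.1) (P p.1).work p.2)) ?_ (range hN)
    exact map (F := fun p : (γ × ℕ) × ℕ =>
      QZK.runWire (N p.1.1) (a p.1.1) (P p.1.1).work p.1.2 p.2)
      (runWire (hN.comp (fst.comp fst)) (ha.comp (fst.comp fst)) (hP.work.comp (fst.comp fst))
        (snd.comp fst) snd) (hP.out.comp fst)

end PolyTime

/-- Number of runs, number of witness qubits and all wire numbers are polynomial-time functions of
the instance, so the renamed circuits can be written down in polynomial time. -/
theorem Protocol.IsQPT.seqRep {prot : Protocol} (h : prot.IsQPT) (V : QMAVerifier)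
    (N : Polynomial ℕ) : (prot.seqRep V N).IsQPT := by
  obtain ⟨hm, hr, hp, hv⟩ := h
  have hl : PolyTime fun x : List Bool => x.length := PolyTime.id.length
  have hN := hl.polyEval N
  have ha : PolyTime fun x => prot.inQubits x (V.witQubits x) :=
    (hl.polyEval prot.copies).mul (hl.polyEval V.wit)
  refine ⟨hm, hN.mul hr, hp.party_repeat hN hr ha ?_, hv.party_repeat hN hr (.const 0) (.const [])⟩
  exact PolyTime.map (F := fun p : List Bool × ℕ => Gate.reset
    (N.eval p.1.length * prot.inQubits p.1 (V.witQubits p.1) +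
      N.eval p.1.length * (prot.prover p.1).work + p.2))
    (PolyTime.gate_reset ((((hN.comp .fst).mul (ha.comp .fst)).add
      ((hN.comp .fst).mul (hp.work.comp .fst))).add .snd)) (.range hm)

open scoped Classical in
theorem traceLeftOn_apply {α β : Type} [Fintype α] (S : α → Prop)
    (ρ : Matrix (α × β) (α × β) ℂ) (b b' : β) :
    traceLeftOn S ρ b b' = ∑ a with S a, ρ (a, b) (a, b') := rfl

/-! ## Lenses and local operations -/

/-- A subsystem with basis `α` of a system with basis `σ`. -/
@[ext] structure Lens (σ α : Type) where
  get : σ → α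
  put : σ → α → σ
  get_put : ∀ s a, get (put s a) = a
  put_get : ∀ s, put s (get s) = s
  put_put : ∀ s a b, put (put s a) b = put s b

namespace Lens

variable {σ σ' τ α β γ κ : Type}

/-- The operation `Φ` on the subsystem, identity elsewhere. -/
def lift (L : Lens σ α) (Φ : SOp α α) : SOp σ σ where
  toFun ρ := Matrix.of fun s s' =>
    Φ (Matrix.of fun a a' => ρ (L.put s a) (L.put s' a')) (L.get s) (L.get s')
  map_add' := by
    intro ρ ω
    ext s s'
    simp only [Matrix.of_apply, Matrix.add_apply]
    rw [← Matrix.add_apply, ← map_add]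
    rfl
  map_smul' := by
    intro c ρ
    ext s s'
    simp only [Matrix.of_apply, Matrix.smul_apply, RingHom.id_apply]
    rw [← Matrix.smul_apply, ← map_smul]
    rfl

theorem lift_apply (L : Lens σ α) (Φ : SOp α α) (ρ : Matrix σ σ ℂ) (s s' : σ) :
    L.lift Φ ρ s s' =
      Φ (Matrix.of fun a a' => ρ (L.put s a) (L.put s' a')) (L.get s) (L.get s') := rfl

@[simp] theorem lift_id (L : Lens σ α) : L.lift LinearMap.id = LinearMap.id := by
  ext1 ρ
  ext s s'
  simp [lift_apply, L.put_get]

theorem lift_comp (L : Lens σ α) (Φ Ψ : SOp α α) : L.lift (Φ ∘ₗ Ψ) = L.lift Φ ∘ₗ L.lift Ψ := by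
  ext1 ρ
  ext s s'
  simp only [LinearMap.comp_apply, lift_apply, L.put_put, L.get_put]
  rfl

theorem lift_add (L : Lens σ α) (Φ Ψ : SOp α α) : L.lift (Φ + Ψ) = L.lift Φ + L.lift Ψ := rfl

theorem lift_zero (L : Lens σ α) : L.lift 0 = 0 := rfl

/-- A subsystem of a subsystem. -/
def comp (L : Lens σ τ) (K : Lens τ α) : Lens σ α where
  get s := K.get (L.get s)
  put s a := L.put s (K.put (L.get s) a)
  get_put s a := by rw [L.get_put, K.get_put]
  put_get s := by rw [K.put_get, L.put_get]
  put_put s a b := by rw [L.get_put, L.put_put, K.put_put]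

theorem lift_lift (L : Lens σ τ) (K : Lens τ α) (Φ : SOp α α) :
    L.lift (K.lift Φ) = (L.comp K).lift Φ := by
  ext1 ρ
  ext s s'
  simp only [lift_apply, comp]
  rfl

/-- The whole system, relabelled. -/
def ofEquiv (e : σ ≃ α) : Lens σ α where
  get := e
  put _ a := e.symm a
  get_put := by simp
  put_get := by simp
  put_put := by simp

theorem lift_ofEquiv (e : σ ≃ α) (Φ : SOp α α) :
    (ofEquiv e).lift Φ = relabel e.symm ∘ₗ Φ ∘ₗ relabel e := rfl

/-- The right factor. -/
def onSnd (κ : Type) (L : Lens σ α) : Lens (κ × σ) α where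
  get p := L.get p.2
  put p a := (p.1, L.put p.2 a)
  get_put p a := L.get_put _ _
  put_get p := by rw [L.put_get]
  put_put p a b := by rw [L.put_put]

/-- A subsystem consisting of the left factor and a subsystem of the right factor. -/
def withFst (κ : Type) (L : Lens σ α) : Lens (κ × σ) (κ × α) where
  get p := (p.1, L.get p.2)
  put p a := (a.1, L.put p.2 a.2)
  get_put p a := by rw [L.get_put]
  put_get p := by rw [L.put_get]
  put_put p a b := by rw [L.put_put]

/-- A subsystem consisting of the right factor and a subsystem of the left factor. -/
def withSnd (κ : Type) (L : Lens σ α) : Lens (σ × κ) (α × κ) where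
  get p := (L.get p.1, p.2)
  put p a := (L.put p.1 a.1, a.2)
  get_put p a := by rw [L.get_put]
  put_get p := by rw [L.put_get]
  put_put p a b := by rw [L.put_put]

/-- The left factor. -/
def left (α γ : Type) : Lens (α × γ) α where
  get p := p.1
  put p a := (a, p.2)
  get_put _ _ := rfl
  put_get _ := rfl
  put_put _ _ _ := rfl

theorem lift_left (Φ : SOp α α) : (left α γ).lift Φ = amplify γ Φ := rfl

/-- The prover's and the message register. -/
def proverLens (α μ β : Type) : Lens (α × μ × β) (α × μ) where
  get p := (p.1, p.2.1)
  put p a := (a.1, a.2, p.2.2)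
  get_put _ _ := rfl
  put_get _ := rfl
  put_put _ _ _ := rfl

/-- The verifier's and the message register. -/
def verifierLens (α μ β : Type) : Lens (α × μ × β) (β × μ) where
  get p := (p.2.2, p.2.1)
  put p a := (p.1, a.2, a.1)
  get_put _ _ := rfl
  put_get _ := rfl
  put_put _ _ _ := rfl

/-- With the moves of both parties written as lifts, comparing interactions reduces to comparing
lenses. -/
theorem actProver_eq {μ : Type} (Φ : SOp (α × μ) (α × μ)) :
    actProver β Φ = (proverLens α μ β).lift Φ := rfl

theorem actVerifier_eq {μ : Type} (Ψ : SOp (β × μ) (β × μ)) :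
    actVerifier α Ψ = (verifierLens α μ β).lift Ψ := rfl

section Fintype

variable [Fintype κ]

/-- The operations concern different factors; linearity of `Φ` moves it past the sum over outcomes.
-/
theorem traceLeftOn_lift_onSnd (S : κ → Prop) (L : Lens σ α) (Φ : SOp α α) :
    traceLeftOn S ∘ₗ (L.onSnd κ).lift Φ = L.lift Φ ∘ₗ traceLeftOn S := by
  classical
  ext1 ρ
  ext s s'
  simp only [LinearMap.comp_apply, lift_apply, traceLeftOn_apply]
  have e : (Matrix.of fun a a' => ∑ k with S k, ρ (k, L.put s a) (k, L.put s' a')) =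
      ∑ k with S k, Matrix.of fun a a' => ρ (k, L.put s a) (k, L.put s' a') := by
    ext a a'
    simp [Matrix.sum_apply]
  rw [e, map_sum, Matrix.sum_apply]
  rfl

theorem traceLeftOn_lift_withFst_tensorLeft (S : κ → Prop) (τ : Matrix κ κ ℂ) (L : Lens σ α)
    (Φ : SOp (κ × α) (κ × α)) :
    traceLeftOn S ∘ₗ (L.withFst κ).lift Φ ∘ₗ tensorLeft σ τ =
      L.lift (traceLeftOn S ∘ₗ Φ ∘ₗ tensorLeft α τ) := rfl

end Fintype

theorem lift_onSnd_tensorLeft (τ : Matrix κ κ ℂ) (L : Lens σ α) (Φ : SOp α α) :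
    (L.onSnd κ).lift Φ ∘ₗ tensorLeft σ τ = tensorLeft σ τ ∘ₗ L.lift Φ := by
  ext1 ρ
  ext ⟨k, s⟩ ⟨k', s'⟩
  simp only [LinearMap.comp_apply, lift_apply]
  change Φ (τ k k' • Matrix.of fun a a' => ρ (L.put s a) (L.put s' a')) (L.get s) (L.get s') = _
  rw [map_smul]
  rfl

/-- A subsystem of a relabelled system. -/
def pre (e : σ' ≃ σ) (L : Lens σ α) : Lens σ' α := (ofEquiv e).comp L

theorem lift_pre (e : σ' ≃ σ) (L : Lens σ α) (Φ : SOp α α) :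
    (L.pre e).lift Φ = relabel e.symm ∘ₗ L.lift Φ ∘ₗ relabel e := by
  rw [pre, ← lift_lift, lift_ofEquiv]

end Lens

section relabel

variable {α β γ : Type}

theorem relabel_apply (e : α ≃ β) (ρ : Matrix α α ℂ) (i j : β) :
    relabel e ρ i j = ρ (e.symm i) (e.symm j) := rfl

@[simp] theorem relabel_symm_relabel (e : α ≃ β) (ρ : Matrix α α ℂ) :
    relabel e.symm (relabel e ρ) = ρ := by
  ext i j
  simp [relabel_apply]

@[simp] theorem relabel_relabel_symm (e : α ≃ β) (ρ : Matrix β β ℂ) :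
    relabel e (relabel e.symm ρ) = ρ := by
  ext i j
  simp [relabel_apply]

end relabel

theorem traceLeft_apply {α β : Type} [Fintype α] (ρ : Matrix (α × β) (α × β) ℂ) (b b' : β) :
    traceLeft α β ρ b b' = ∑ a, ρ (a, b) (a, b') := by
  simp only [traceLeft, traceLeftOn_apply, Finset.filter_true]

theorem traceRight_apply {α β : Type} [Fintype β] (ρ : Matrix (α × β) (α × β) ℂ) (a a' : α) :
    traceRight α β ρ a a' = ∑ b, ρ (a, b) (a', b) :=
  traceLeft_apply _ _ _

/-! ## Completely positive and trace preserving maps -/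

section CP

set_option linter.unusedSectionVars false

variable {α β γ σ κ : Type} [Fintype α] [Fintype β] [Fintype γ] [Fintype σ] [Fintype κ]

/-- Complete positivity, in Kraus form. -/
def IsCP (Φ : SOp α β) : Prop :=
  Φ ∈ AddSubmonoid.closure (Set.range (conj : Matrix β α ℂ → SOp α β))

/-- Preservation of the trace. -/
def IsTP (Φ : SOp α β) : Prop := ∀ ρ, (Φ ρ).trace = ρ.trace

theorem conj_apply (K : Matrix β α ℂ) (ρ : Matrix α α ℂ) : conj K ρ = K * ρ * Kᴴ := rfl

theorem conj_apply_apply (K : Matrix β α ℂ) (ρ : Matrix α α ℂ) (i j : β) :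
    conj K ρ i j = ∑ a, ∑ b, K i a * ρ a b * star (K j b) := by
  simp only [conj_apply, Matrix.mul_apply, Matrix.conjTranspose_apply, Finset.sum_mul]
  exact Finset.sum_comm

theorem conj_comp (K : Matrix γ β ℂ) (K' : Matrix β α ℂ) : conj K ∘ₗ conj K' = conj (K * K') := by
  ext1 ρ
  simp [conj_apply, Matrix.mul_assoc]

namespace IsCP

theorem conj (K : Matrix β α ℂ) : IsCP (conj K) := AddSubmonoid.subset_closure ⟨K, rfl⟩

theorem zero : IsCP (0 : SOp α β) := AddSubmonoid.zero_mem _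

theorem add {Φ Ψ : SOp α β} (h : IsCP Φ) (h' : IsCP Ψ) : IsCP (Φ + Ψ) :=
  AddSubmonoid.add_mem _ h h'

theorem sum {ι : Type} (s : Finset ι) {Φ : ι → SOp α β} (h : ∀ i ∈ s, IsCP (Φ i)) :
    IsCP (∑ i ∈ s, Φ i) :=
  AddSubmonoid.sum_mem _ h

theorem induction {P : SOp α β → Prop} {Φ : SOp α β} (h : IsCP Φ)
    (hc : ∀ K : Matrix β α ℂ, P (QZK.conj K)) (h0 : P 0)
    (ha : ∀ Φ Ψ, P Φ → P Ψ → P (Φ + Ψ)) : P Φ := by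
  refine AddSubmonoid.closure_induction (motive := fun Φ _ => P Φ) ?_ h0 (fun _ _ _ _ => ha _ _) h
  rintro _ ⟨K, rfl⟩
  exact hc K

theorem comp {Ψ : SOp β γ} {Φ : SOp α β} (h : IsCP Ψ) (h' : IsCP Φ) : IsCP (Ψ ∘ₗ Φ) := by
  refine h.induction (P := fun Ψ => IsCP (Ψ ∘ₗ Φ)) (fun K => ?_) (by simpa using zero)
    fun _ _ h₁ h₂ => by rw [LinearMap.add_comp]; exact h₁.add h₂
  refine h'.induction (P := fun Φ => IsCP (QZK.conj K ∘ₗ Φ)) (fun K' => ?_) (by simpa using zero)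
    fun _ _ h₁ h₂ => by rw [LinearMap.comp_add]; exact h₁.add h₂
  rw [conj_comp]
  exact conj _

theorem id [DecidableEq α] : IsCP (LinearMap.id : SOp α α) := by
  have : (LinearMap.id : SOp α α) = QZK.conj 1 := by ext1 ρ; simp [conj_apply]
  rw [this]
  exact conj 1

theorem posSemidef {Φ : SOp α β} (h : IsCP Φ) {ρ : Matrix α α ℂ} (hρ : ρ.PosSemidef) :
    (Φ ρ).PosSemidef := by
  refine h.induction (P := fun Φ => (Φ ρ).PosSemidef) (fun K => ?_) ?_ fun _ _ h₁ h₂ => h₁.add h₂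
  · exact hρ.mul_mul_conjTranspose_same K
  · exact Matrix.PosSemidef.zero

end IsCP

/-- The matrix `K` acting on a subsystem. -/
def Lens.liftMat [DecidableEq σ] (L : Lens σ α) (K : Matrix α α ℂ) : Matrix σ σ ℂ :=
  Matrix.of fun s t => if L.put s (L.get t) = t then K (L.get s) (L.get t) else 0

/-- Row `s` of the lifted matrix lives on the basis vectors obtained from `s` by changing the
subsystem only. The function `f` allows this to be used inside the double sum for `conj`, once for
rows and once for columns. -/
theorem Lens.sum_liftMat [DecidableEq σ] (L : Lens σ α) (K : Matrix α α ℂ) (s : σ) (f : ℂ → σ → ℂ)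
    (hf : ∀ t, f 0 t = 0) :
    ∑ t, f (L.liftMat K s t) t = ∑ a, f (K (L.get s) a) (L.put s a) := by
  have h : ∀ t, f (L.liftMat K s t) t =
      if L.put s (L.get t) = t then f (K (L.get s) (L.get t)) t else 0 := by
    intro t
    simp only [liftMat, Matrix.of_apply]
    split_ifs
    · rfl
    · exact hf t
  simp only [h]
  rw [← Finset.sum_filter]
  refine Finset.sum_bij' (fun t _ => L.get t) (fun a _ => L.put s a) ?_ ?_ ?_ ?_ ?_
  · simp
  · intro a _
    simp [L.get_put]
  · intro t ht
    exact (Finset.mem_filter.1 ht).2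
  · intro a _
    exact L.get_put s a
  · intro t ht
    rw [(Finset.mem_filter.1 ht).2]

theorem Lens.lift_conj [DecidableEq σ] (L : Lens σ α) (K : Matrix α α ℂ) :
    L.lift (conj K) = conj (L.liftMat K) := by
  ext1 ρ
  ext s s'
  rw [Lens.lift_apply, conj_apply_apply, conj_apply_apply]
  rw [L.sum_liftMat K s (fun k t => ∑ t', k * ρ t t' * star (L.liftMat K s' t'))
    (by simp)]
  refine Finset.sum_congr rfl fun a _ => ?_
  rw [L.sum_liftMat K s' (fun k t' => K (L.get s) a * ρ (L.put s a) t' * star k) (by simp)]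
  rfl

theorem IsCP.lift [DecidableEq σ] (L : Lens σ α) {Φ : SOp α α} (h : IsCP Φ) :
    IsCP (L.lift Φ) := by
  refine h.induction (P := fun Φ => IsCP (L.lift Φ)) (fun K => ?_) (by rw [L.lift_zero]; exact zero)
    fun _ _ h₁ h₂ => by rw [L.lift_add]; exact h₁.add h₂
  rw [L.lift_conj]
  exact conj _

theorem amplify_comp (Ψ : SOp β γ) (Φ : SOp α β) :
    amplify κ (Ψ ∘ₗ Φ) = amplify κ Ψ ∘ₗ amplify κ Φ := rfl

theorem amplify_conj [DecidableEq κ] (K : Matrix β α ℂ) :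
    amplify κ (conj K) = conj (K ⊗ₖ (1 : Matrix κ κ ℂ)) := by
  ext1 ρ
  ext ⟨i, k⟩ ⟨j, l⟩
  change conj K (Matrix.of fun a a' => ρ (a, k) (a', l)) i j = _
  rw [conj_apply_apply, conj_apply_apply]
  simp only [Fintype.sum_prod_type, Matrix.kronecker_apply, Matrix.one_apply, Matrix.of_apply]
  refine Finset.sum_congr rfl fun a _ => ?_
  rw [Finset.sum_comm]
  simp [apply_ite]

theorem IsCP.amplify [DecidableEq κ] {Φ : SOp α β} (h : IsCP Φ) : IsCP (amplify κ Φ) := by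
  refine h.induction (P := fun Φ => IsCP (QZK.amplify κ Φ)) (fun K => ?_) zero
    fun _ _ h₁ h₂ => h₁.add h₂
  rw [amplify_conj]
  exact conj _

theorem IsTP.comp {Ψ : SOp β γ} {Φ : SOp α β} (h : IsTP Ψ) (h' : IsTP Φ) : IsTP (Ψ ∘ₗ Φ) :=
  fun ρ => (h _).trans (h' ρ)

theorem IsTP.id : IsTP (LinearMap.id : SOp α α) := fun _ => rfl

/-- A lens gives no complementary factor to sum over. Instead, summing over all `s` and all contents
of the subsystem counts each diagonal entry `card α` times; for fixed `s` the inner sum is the trace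
of a block, which `Φ` preserves. -/
theorem IsTP.lift (L : Lens σ α) {Φ : SOp α α} (h : IsTP Φ) : IsTP (L.lift Φ) := by
  intro ρ
  rcases isEmpty_or_nonempty α with hα | hα
  · have : IsEmpty σ := ⟨fun s => hα.false (L.get s)⟩
    simp [Matrix.trace]
  have key : ∀ g : σ → ℂ, ∑ s, ∑ a, g (L.put s a) = (Fintype.card α : ℂ) * ∑ s, g s := by
    intro g
    have e : ∑ p : σ × α, g (L.put p.1 p.2) = ∑ p : σ × α, g p.1 := by
      -- Exchanging the content of the subsystem with `a` is an involution.
      let E : σ × α ≃ σ × α :=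
        { toFun := fun p => (L.put p.1 p.2, L.get p.1)
          invFun := fun p => (L.put p.1 p.2, L.get p.1)
          left_inv := fun p => by simp [L.put_put, L.get_put, L.put_get]
          right_inv := fun p => by simp [L.put_put, L.get_put, L.put_get] }
      exact Equiv.sum_comp E fun p => g p.1
    rw [Fintype.sum_prod_type, Fintype.sum_prod_type] at e
    rw [e, Finset.mul_sum]
    simp
  have hc : (Fintype.card α : ℂ) ≠ 0 := by simp
  apply mul_left_cancel₀ hc
  simp only [Matrix.trace, Matrix.diag_apply]
  rw [← key, ← key]
  refine Finset.sum_congr rfl fun s _ => ?_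
  have := h (Matrix.of fun a a' => ρ (L.put s a) (L.put s a'))
  simp only [Matrix.trace, Matrix.diag_apply, Matrix.of_apply] at this
  rw [← this]
  simp only [Lens.lift_apply, L.put_put, L.get_put]

theorem trace_amplify (Φ : SOp α β) (ρ : Matrix (α × κ) (α × κ) ℂ) :
    (amplify κ Φ ρ).trace = ∑ k, (Φ (Matrix.of fun a a' => ρ (a, k) (a', k))).trace := by
  simp only [Matrix.trace, Matrix.diag_apply, Fintype.sum_prod_type]
  rw [Finset.sum_comm]
  rfl

theorem IsTP.amplify {Φ : SOp α β} (h : IsTP Φ) : IsTP (amplify κ Φ) := by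
  intro ρ
  rw [trace_amplify]
  simp only [h _]
  simp only [Matrix.trace, Matrix.diag_apply, Fintype.sum_prod_type, Matrix.of_apply]
  rw [Finset.sum_comm]

theorem trace_relabel (e : α ≃ β) (ρ : Matrix α α ℂ) : (relabel e ρ).trace = ρ.trace := by
  simp only [Matrix.trace, Matrix.diag_apply, relabel_apply]
  exact Equiv.sum_comp e.symm fun i => ρ i i

theorem IsTP.relabel (e : α ≃ β) : IsTP (relabel e) := trace_relabel e

theorem IsCP.relabel [DecidableEq α] (e : α ≃ β) : IsCP (relabel e) := by
  have : QZK.relabel e = QZK.conj (Matrix.of fun b a => if e.symm b = a then 1 else 0) := by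
    ext1 ρ
    ext i j
    rw [relabel_apply, conj_apply_apply]
    simp [apply_ite]
  rw [this]
  exact conj _

theorem IsCP.traceLeftOn [DecidableEq α] [DecidableEq β] (S : α → Prop) :
    IsCP (traceLeftOn S : SOp (α × β) β) := by
  classical
  have : (QZK.traceLeftOn S : SOp (α × β) β) = ∑ a with S a,
      QZK.conj (Matrix.of fun b p => if p = (a, b) then 1 else 0) := by
    ext1 ρ
    ext i j
    rw [traceLeftOn_apply, LinearMap.sum_apply, Matrix.sum_apply]
    refine Finset.sum_congr rfl fun a _ => ?_
    rw [conj_apply_apply]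
    simp [apply_ite]
  rw [this]
  exact sum _ fun a _ => conj _

theorem IsTP.traceLeft : IsTP (traceLeft α β) := by
  intro ρ
  simp only [Matrix.trace, Matrix.diag_apply, QZK.traceLeft, traceLeftOn_apply,
    Fintype.sum_prod_type, Finset.filter_true]
  exact Finset.sum_comm

theorem IsCP.traceLeft [DecidableEq α] [DecidableEq β] : IsCP (traceLeft α β) := traceLeftOn _

theorem IsCP.traceRight [DecidableEq α] [DecidableEq β] : IsCP (traceRight α β) :=
  traceLeft.comp (relabel _)

theorem IsTP.traceRight : IsTP (traceRight α β) := traceLeft.comp (relabel _)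

open scoped MatrixOrder in
theorem exists_eq_conjTranspose_mul_self {τ : Matrix γ γ ℂ} (hτ : τ.PosSemidef) :
    ∃ B : Matrix γ γ ℂ, τ = Bᴴ * B := by
  classical
  exact CStarAlgebra.nonneg_iff_eq_star_mul_self.mp hτ.nonneg

theorem IsCP.tensorLeft [DecidableEq α] {τ : Matrix γ γ ℂ} (hτ : τ.PosSemidef) :
    IsCP (tensorLeft α τ) := by
  classical
  obtain ⟨B, rfl⟩ := exists_eq_conjTranspose_mul_self hτ
  have : QZK.tensorLeft α (Bᴴ * B) = ∑ c,
      QZK.conj (Matrix.of fun (p : γ × α) a => if p.2 = a then star (B c p.1) else 0) := by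
    ext1 ρ
    ext ⟨c, i⟩ ⟨d, j⟩
    rw [LinearMap.sum_apply, Matrix.sum_apply]
    change (Bᴴ * B) c d * ρ i j = _
    rw [Matrix.mul_apply, Finset.sum_mul]
    refine Finset.sum_congr rfl fun e _ => ?_
    rw [conj_apply_apply]
    simp [apply_ite]
    ring
  rw [this]
  exact sum _ fun a _ => conj _

theorem IsTP.tensorLeft {τ : Matrix γ γ ℂ} (hτ : τ.trace = 1) : IsTP (tensorLeft α τ) := by
  intro ρ
  change (τ ⊗ₖ ρ).trace = _
  rw [Matrix.trace_kronecker, hτ, one_mul]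

theorem tensorRight_eq (τ : Matrix γ γ ℂ) :
    tensorRight α τ = relabel (Equiv.prodComm γ α) ∘ₗ tensorLeft α τ := by
  ext1 ρ
  ext ⟨i, c⟩ ⟨j, d⟩
  exact mul_comm _ _

theorem IsCP.tensorRight [DecidableEq α] [DecidableEq γ] {τ : Matrix γ γ ℂ} (hτ : τ.PosSemidef) :
    IsCP (tensorRight α τ) := by
  rw [tensorRight_eq]
  exact (relabel _).comp (tensorLeft hτ)

theorem IsTP.tensorRight {τ : Matrix γ γ ℂ} (hτ : τ.trace = 1) : IsTP (tensorRight α τ) := by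
  rw [tensorRight_eq]
  exact (relabel _).comp (tensorLeft hτ)

theorem IsCP.traceSMul [DecidableEq α] [DecidableEq β] {τ : Matrix β β ℂ} (hτ : τ.PosSemidef) :
    IsCP ((Matrix.traceLinearMap α ℂ ℂ).smulRight τ) := by
  have : (Matrix.traceLinearMap α ℂ ℂ).smulRight τ = QZK.traceLeft α β ∘ₗ QZK.tensorRight α τ := by
    ext1 ρ
    ext i j
    have e : ∀ a, QZK.tensorRight α τ ρ (a, i) (a, j) = ρ a a * τ i j := fun a => rfl
    simp only [LinearMap.comp_apply, QZK.traceLeft, traceLeftOn_apply, e]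
    simp [Matrix.trace, Finset.sum_mul]
  rw [this]
  exact traceLeft.comp (tensorRight hτ)

/-- The adjoint of a completely positive map. -/
theorem IsCP.exists_adjoint {Φ : SOp α β} (h : IsCP Φ) :
    ∃ D : SOp β α, (∀ E ρ, (E * Φ ρ).trace = (D E * ρ).trace) ∧
      ∀ E : Matrix β β ℂ, E.PosSemidef → (D E).PosSemidef := by
  refine h.induction (P := fun Φ => ∃ D : SOp β α, (∀ E ρ, (E * Φ ρ).trace = (D E * ρ).trace) ∧
      ∀ E : Matrix β β ℂ, E.PosSemidef → (D E).PosSemidef) (fun K => ?_) ?_ ?_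
  · refine ⟨QZK.conj Kᴴ, fun E ρ => ?_, fun E hE => (conj Kᴴ).posSemidef hE⟩
    rw [conj_apply, conj_apply, Matrix.conjTranspose_conjTranspose, ← Matrix.mul_assoc,
      ← Matrix.mul_assoc, Matrix.trace_mul_comm, ← Matrix.mul_assoc, ← Matrix.mul_assoc]
  · exact ⟨0, by simp, fun E _ => Matrix.PosSemidef.zero⟩
  · rintro Φ Ψ ⟨D, h₁, h₂⟩ ⟨D', h₁', h₂'⟩
    refine ⟨D + D', fun E ρ => ?_, fun E hE => (h₂ E hE).add (h₂' E hE)⟩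
    simp [Matrix.mul_add, Matrix.add_mul, h₁, h₁']

theorem eq_of_trace_mul [DecidableEq α] {A B : Matrix α α ℂ}
    (h : ∀ ρ : Matrix α α ℂ, (A * ρ).trace = (B * ρ).trace) : A = B := by
  ext i j
  have := h (Matrix.single j i 1)
  simpa [Matrix.trace_mul_single] using this

/-- Pulling a measurement back along a channel. -/
theorem exists_effect [DecidableEq α] [DecidableEq β] {Φ : SOp α β} (h : IsCP Φ) (h' : IsTP Φ)
    {E : Matrix β β ℂ} (hE : E.PosSemidef) (hE' : (1 - E).PosSemidef) :
    ∃ F : Matrix α α ℂ, F.PosSemidef ∧ (1 - F).PosSemidef ∧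
      ∀ ρ, (E * Φ ρ).trace = (F * ρ).trace := by
  obtain ⟨D, h₁, h₂⟩ := h.exists_adjoint
  have hone : D 1 = 1 := eq_of_trace_mul fun ρ => by rw [← h₁]; simpa using h' ρ
  refine ⟨D E, h₂ E hE, ?_, h₁ E⟩
  rw [← hone, ← map_sub]
  exact h₂ _ hE'

theorem IsChannel.isCP [DecidableEq α] {Φ : SOp α β} (h : IsChannel Φ) : IsCP Φ := by
  obtain ⟨r, K, -, rfl⟩ := h
  exact IsCP.sum _ fun i _ => IsCP.conj _

theorem trace_sum_conj {ι : Type} [Fintype ι] (K : ι → Matrix β α ℂ) (ρ : Matrix α α ℂ) :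
    ((∑ i, conj (K i)) ρ).trace = ((∑ i, (K i)ᴴ * K i) * ρ).trace := by
  rw [LinearMap.sum_apply, Matrix.trace_sum, Finset.sum_mul, Matrix.trace_sum]
  refine Finset.sum_congr rfl fun i _ => ?_
  rw [conj_apply, Matrix.trace_mul_comm, Matrix.mul_assoc]

theorem IsChannel.isTP [DecidableEq α] {Φ : SOp α β} (h : IsChannel Φ) : IsTP Φ := by
  obtain ⟨r, K, hK, rfl⟩ := h
  intro ρ
  rw [trace_sum_conj, hK, one_mul]

/-- Elements of the closure are finite sums of `conj`s, and preservation of the trace forces the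
normalisation of the Kraus operators because the trace pairing is nondegenerate. Needed to feed
composite provers into the soundness hypothesis. -/
theorem isChannel_of_isCP_isTP [DecidableEq α] {Φ : SOp α β} (h : IsCP Φ) (h' : IsTP Φ) :
    IsChannel Φ := by
  have : ∃ (r : ℕ) (K : Fin r → Matrix β α ℂ), Φ = ∑ i, conj (K i) := by
    refine h.induction (P := fun Φ => ∃ (r : ℕ) (K : Fin r → Matrix β α ℂ), Φ = ∑ i, conj (K i))
      (fun K => ⟨1, fun _ => K, by simp⟩) ⟨0, Fin.elim0, by simp⟩ ?_
    rintro _ _ ⟨r, K, rfl⟩ ⟨s, L, rfl⟩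
    refine ⟨r + s, Fin.append K L, ?_⟩
    simp [Fin.sum_univ_add]
  obtain ⟨r, K, rfl⟩ := this
  refine ⟨r, K, eq_of_trace_mul fun ρ => ?_, rfl⟩
  rw [← trace_sum_conj, h', one_mul]

theorem IsState.map {Φ : SOp α β} (h : IsCP Φ) (h' : IsTP Φ) {ρ : Matrix α α ℂ} (hρ : IsState ρ) :
    IsState (Φ ρ) := ⟨h.posSemidef hρ.1, (h' ρ).trans hρ.2⟩

theorem posSemidef_trace_re_nonneg {ρ : Matrix α α ℂ} (h : ρ.PosSemidef) : 0 ≤ ρ.trace.re :=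
  (Complex.le_def.1 h.trace_nonneg).1

theorem posSemidef_trace_eq {ρ : Matrix α α ℂ} (h : ρ.PosSemidef) : ρ.trace = (ρ.trace.re : ℂ) := by
  apply Complex.ext
  · simp
  · simpa using (Complex.le_def.1 h.trace_nonneg).2.symm

/-- A positive operator is a multiple of a state. -/
theorem eq_smul_state {ρ : Matrix α α ℂ} (h : ρ.PosSemidef) (h0 : ρ ≠ 0) :
    ∃ ω, IsState ω ∧ ρ = (ρ.trace.re : ℂ) • ω ∧ 0 < ρ.trace.re := by
  have ht : ρ.trace ≠ 0 := fun h' => h0 ((h.trace_eq_zero_iff).1 h')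
  have hre : ρ.trace.re ≠ 0 := fun h' => ht (by rw [posSemidef_trace_eq h, h']; simp)
  have hpos : 0 < ρ.trace.re := lt_of_le_of_ne (posSemidef_trace_re_nonneg h) hre.symm
  have hc : (ρ.trace.re : ℂ) ≠ 0 := by exact_mod_cast hre
  refine ⟨(ρ.trace.re : ℂ)⁻¹ • ρ, ⟨h.smul ?_, ?_⟩, ?_, hpos⟩
  · rw [← Complex.ofReal_inv]
    exact_mod_cast (inv_pos.2 hpos).le
  · rw [Matrix.trace_smul, smul_eq_mul]
    nth_rw 2 [posSemidef_trace_eq h]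
    exact inv_mul_cancel₀ hc
  · rw [smul_smul, mul_inv_cancel₀ hc, one_smul]

theorem ketbra_isState [DecidableEq α] (f : α) : IsState (ketbra f) := by
  refine ⟨?_, by simp [ketbra]⟩
  have : ketbra f = (ketbra f)ᴴ * ketbra f := by simp [ketbra]
  rw [this]
  exact Matrix.posSemidef_conjTranspose_mul_self _

theorem zeros_isState (n : ℕ) : IsState (zeros n) := ketbra_isState _

theorem IsState.kronecker [DecidableEq α] [DecidableEq β] {ρ : Matrix α α ℂ} {τ : Matrix β β ℂ}
    (hρ : IsState ρ) (hτ : IsState τ) : IsState (ρ ⊗ₖ τ) :=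
  IsState.map (IsCP.tensorRight hτ.1) (IsTP.tensorRight hτ.2) hρ

end CP

/-! ## Circuits on a subset of the wires -/

/-- The wires in the range of an injection. -/
noncomputable def wireLens {m n : ℕ} (ι : Fin m → Fin n) (hι : Function.Injective ι) :
    Lens (Q n) (Q m) where
  get f := f ∘ ι
  put f a := Function.extend ι a f
  get_put f a := by
    ext i
    simp [hι.extend_apply]
  put_get f := by
    ext i
    by_cases h : ∃ j, ι j = i
    · obtain ⟨j, rfl⟩ := h
      simp [hι.extend_apply]
    · rw [Function.extend_apply' _ _ _ h]
  put_put f a b := by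
    ext i
    by_cases h : ∃ j, ι j = i
    · obtain ⟨j, rfl⟩ := h
      simp [hι.extend_apply]
    · simp [Function.extend_apply' _ _ _ h]

/-- What `put` does on the range of `ι` is forced by `get_put`, so only the wires that it leaves
alone have to be checked. -/
theorem Lens.eq_wireLens {m n : ℕ} {ι : Fin m → Fin n} (hι : Function.Injective ι)
    (L : Lens (Q n) (Q m)) (hget : ∀ f i, L.get f i = f (ι i))
    (hput : ∀ f a i, (∀ j, ι j ≠ i) → L.put f a i = f i) : L = wireLens ι hι := by
  have hg : L.get = (wireLens ι hι).get := by
    ext f i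
    exact hget f i
  refine Lens.ext hg ?_
  ext f a i
  by_cases h : ∃ j, ι j = i
  · obtain ⟨j, rfl⟩ := h
    have h := hget (L.put f a) j
    rw [L.get_put] at h
    rw [← h]
    exact (hι.extend_apply a f j).symm
  · rw [hput f a i (by simpa using h)]
    exact (Function.extend_apply' _ _ _ h).symm

section gates

variable {m n : ℕ} {ι : Fin m → Fin n} (hι : Function.Injective ι)

theorem wireLens_put_get_eq_iff (f g : Q n) :
    (wireLens ι hι).put f ((wireLens ι hι).get g) = g ↔ ∀ i, (∀ j, ι j ≠ i) → f i = g i := by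
  constructor
  · intro h i hi
    rw [← h]
    exact (Function.extend_apply' _ _ _ (by simpa using hi)).symm
  · intro h
    ext i
    by_cases hi : ∃ j, ι j = i
    · obtain ⟨j, rfl⟩ := hi
      exact hι.extend_apply _ _ _
    · rw [← h i (by simpa using hi)]
      exact Function.extend_apply' _ _ _ hi

theorem liftMat_onWire (U : Matrix Bool Bool ℂ) (i : Fin m) :
    (wireLens ι hι).liftMat (onWire U i) = onWire U (ι i) := by
  ext f g
  simp only [Lens.liftMat, onWire, Matrix.of_apply, wireLens_put_get_eq_iff]
  rw [← ite_and]
  refine if_congr ⟨?_, ?_⟩ rfl rfl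
  · rintro ⟨h, h'⟩ k hk
    by_cases hk' : ∃ j, ι j = k
    · obtain ⟨j, rfl⟩ := hk'
      exact h' j fun e => hk (by rw [e])
    · exact h k (by simpa using hk')
  · intro h
    exact ⟨fun k hk => h k fun e => hk i e.symm, fun j hj => h (ι j) (hι.ne hj)⟩

theorem liftMat_basisMap (φ : Q m → Q m) :
    (wireLens ι hι).liftMat (basisMap φ) =
      basisMap fun g => (wireLens ι hι).put g (φ ((wireLens ι hι).get g)) := by
  ext f g
  simp only [Lens.liftMat, basisMap, Matrix.of_apply]
  rw [← ite_and]
  refine if_congr ⟨?_, ?_⟩ rfl rfl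
  · rintro ⟨h, h'⟩
    rw [← h', ← h, Lens.put_put, Lens.put_get]
  · rintro h
    rw [h, Lens.put_put, Lens.get_put, Lens.put_get]
    exact ⟨rfl, rfl⟩

theorem extend_update (g : Q n) (i : Fin m) (b : Bool) :
    (wireLens ι hι).put g (Function.update ((wireLens ι hι).get g) i b) =
      Function.update g (ι i) b := by
  ext k
  by_cases hk : ∃ j, ι j = k
  · obtain ⟨j, rfl⟩ := hk
    refine (hι.extend_apply _ _ _).trans ?_
    by_cases hj : j = i
    · simp [hj]
    · rw [Function.update_of_ne hj, Function.update_of_ne (hι.ne hj)]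
      rfl
  · refine (Function.extend_apply' _ _ _ hk).trans ?_
    rw [Function.update_of_ne]
    rintro rfl
    exact hk ⟨i, rfl⟩

/-- Renaming the wires of a gate. -/
theorem Gate.sem_map {φ : ℕ → ℕ} (hφ : Function.Injective φ) (hval : ∀ i, (ι i : ℕ) = φ i)
    (hout : ∀ i, m ≤ i → n ≤ φ i) (g : Gate) :
    (g.map φ).sem n = (wireLens ι hι).lift (g.sem m) := by
  -- A renamed wire exists exactly if the original does. Together with injectivity this keeps
  -- well-formed gates well-formed, and ill-formed gates, which act as the identity, ill-formed.
  have hlt : ∀ i, φ i < n ↔ i < m := by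
    intro i
    constructor
    · intro h
      by_contra h'
      exact absurd (hout i (by omega)) (by omega)
    · intro h
      rw [← hval ⟨i, h⟩]
      exact (ι ⟨i, h⟩).2
  have he : ∀ i (h : i < m) (h' : φ i < n), (⟨φ i, h'⟩ : Fin n) = ι ⟨i, h⟩ := by
    intro i h h'
    ext
    exact (hval ⟨i, h⟩).symm
  have hne : ∀ i j, φ i ≠ φ j ↔ i ≠ j := fun i j => hφ.ne_iff
  cases g with
  | h i =>
    simp only [Gate.map, Gate.sem, hlt]
    split_ifs with h
    · rw [Lens.lift_conj, liftMat_onWire, he i h]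
    · rw [Lens.lift_id]
  | t i =>
    simp only [Gate.map, Gate.sem, hlt]
    split_ifs with h
    · rw [Lens.lift_conj, liftMat_onWire, he i h]
    · rw [Lens.lift_id]
  | x i =>
    simp only [Gate.map, Gate.sem, hlt]
    split_ifs with h
    · rw [Lens.lift_conj, liftMat_basisMap]
      simp only [extend_update, he i h]
      rfl
    · rw [Lens.lift_id]
  | cnot c i =>
    simp only [Gate.map, Gate.sem, hlt, hne]
    split_ifs with h
    · rw [Lens.lift_conj, liftMat_basisMap]
      simp only [extend_update, he i h.2.1, he c h.1]
      rfl
    · rw [Lens.lift_id]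
  | toffoli c d i =>
    simp only [Gate.map, Gate.sem, hlt, hne]
    split_ifs with h
    · rw [Lens.lift_conj, liftMat_basisMap]
      simp only [extend_update, he i h.2.2.1, he c h.1, he d h.2.1]
      rfl
    · rw [Lens.lift_id]
  | reset i =>
    simp only [Gate.map, Gate.sem, hlt]
    split_ifs with h
    · rw [Fintype.sum_bool, Fintype.sum_bool, Lens.lift_add]
      simp only [Lens.lift_conj, liftMat_onWire, he i h]
    · rw [Lens.lift_id]

theorem Circuit.sem_map {φ : ℕ → ℕ} (hφ : Function.Injective φ) (hval : ∀ i, (ι i : ℕ) = φ i)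
    (hout : ∀ i, m ≤ i → n ≤ φ i) (c : Circuit) :
    Circuit.sem n (c.map (Gate.map φ)) = (wireLens ι hι).lift (Circuit.sem m c) := by
  induction c with
  | nil => exact (Lens.lift_id _).symm
  | cons g c ih =>
    change Circuit.sem n (c.map (Gate.map φ)) ∘ₗ (g.map φ).sem n = _
    rw [ih, Gate.sem_map hι hφ hval hout, ← Lens.lift_comp]
    rfl

end gates

theorem Circuit.sem_append (n : ℕ) (c d : Circuit) :
    Circuit.sem n (c ++ d) = Circuit.sem n d ∘ₗ Circuit.sem n c := by
  induction c with
  | nil => rfl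
  | cons g c ih =>
    change Circuit.sem n (c ++ d) ∘ₗ g.sem n = _
    rw [ih]
    rfl

/-! ### Circuits are channels -/

theorem conj_basisMap_apply {n : ℕ} {φ : Q n → Q n} (hφ : Function.Involutive φ)
    (ρ : Matrix (Q n) (Q n) ℂ) (f g : Q n) : conj (basisMap φ) ρ f g = ρ (φ f) (φ g) := by
  rw [conj_apply_apply]
  have h : ∀ f a, basisMap φ f a = if a = φ f then 1 else 0 := by
    intro f a
    refine if_congr ⟨?_, ?_⟩ rfl rfl
    · rintro rfl
      exact (hφ a).symm
    · rintro rfl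
      exact (hφ f).symm
  simp [h, apply_ite]

theorem isTP_conj {α β : Type} [Fintype α] [Fintype β] [DecidableEq α] {K : Matrix β α ℂ}
    (h : Kᴴ * K = 1) : IsTP (conj K) := by
  intro ρ
  rw [conj_apply, Matrix.trace_mul_comm, ← Matrix.mul_assoc, h, Matrix.one_mul]

theorem conj_onWire_apply {n : ℕ} (U : Matrix Bool Bool ℂ) (i : Fin n)
    (ρ : Matrix (Q n) (Q n) ℂ) (f g : Q n) :
    conj (onWire U i) ρ f g = ∑ a, ∑ b, U (f i) a *
      ρ (Function.update f i a) (Function.update g i b) * star (U (g i) b) := by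
  rw [conj_apply_apply]
  have key : ∀ (f : Q n) (F : ℂ → Q n → ℂ), (∀ t, F 0 t = 0) →
      ∑ t, F (onWire U i f t) t = ∑ a, F (U (f i) a) (Function.update f i a) := by
    intro f F hF
    have h : ∀ t, F (onWire U i f t) t =
        if ∀ j, j ≠ i → f j = t j then F (U (f i) (t i)) t else 0 := by
      intro t
      simp only [onWire, Matrix.of_apply]
      split_ifs
      · rfl
      · exact hF t
    simp only [h]
    rw [← Finset.sum_filter]
    refine Finset.sum_bij' (fun t _ => t i) (fun a _ => Function.update f i a) ?_ ?_ ?_ ?_ ?_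
    · simp
    · intro a _
      simp only [Finset.mem_filter, Finset.mem_univ, true_and]
      intro j hj
      rw [Function.update_of_ne hj]
    · intro t ht
      ext j
      by_cases hj : j = i
      · subst hj; simp
      · rw [Function.update_of_ne hj, (Finset.mem_filter.1 ht).2 j hj]
    · simp
    · intro t ht
      congr 1
      ext j
      by_cases hj : j = i
      · subst hj; simp
      · rw [Function.update_of_ne hj, (Finset.mem_filter.1 ht).2 j hj]
  rw [key f (fun k t => ∑ t', k * ρ t t' * star (onWire U i g t')) (by simp)]
  refine Finset.sum_congr rfl fun a _ => ?_
  rw [key g (fun k t' => U (f i) a * ρ (Function.update f i a) t' * star k) (by simp)]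

/-- Resetting a wire: entries. -/
theorem sem_reset_apply {n : ℕ} {i : ℕ} (hi : i < n) (ρ : Matrix (Q n) (Q n) ℂ) (f g : Q n) :
    (Gate.reset i).sem n ρ f g = if f ⟨i, hi⟩ = false ∧ g ⟨i, hi⟩ = false then
      ∑ b, ρ (Function.update f ⟨i, hi⟩ b) (Function.update g ⟨i, hi⟩ b) else 0 := by
  simp only [Gate.sem, hi, dif_pos]
  rw [LinearMap.sum_apply, Matrix.sum_apply]
  simp only [conj_onWire_apply]
  by_cases h : f ⟨i, hi⟩ = false <;> by_cases h' : g ⟨i, hi⟩ = false <;>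
    simp [Matrix.single_apply, h, h']

theorem sem_x_apply {n : ℕ} {i : ℕ} (hi : i < n) (ρ : Matrix (Q n) (Q n) ℂ) (f g : Q n) :
    (Gate.x i).sem n ρ f g = ρ (Function.update f ⟨i, hi⟩ (!f ⟨i, hi⟩))
      (Function.update g ⟨i, hi⟩ (!g ⟨i, hi⟩)) := by
  simp only [Gate.sem, hi, dif_pos]
  rw [conj_basisMap_apply]
  intro f
  simp

theorem sem_cnot_apply {n : ℕ} {c i : ℕ} (hc : c < n) (hi : i < n) (h : c ≠ i)
    (ρ : Matrix (Q n) (Q n) ℂ) (f g : Q n) :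
    (Gate.cnot c i).sem n ρ f g =
      ρ (Function.update f ⟨i, hi⟩ (f ⟨i, hi⟩ ^^ f ⟨c, hc⟩))
        (Function.update g ⟨i, hi⟩ (g ⟨i, hi⟩ ^^ g ⟨c, hc⟩)) := by
  simp only [Gate.sem, hi, hc, ne_eq, h, not_false_eq_true, and_self, dif_pos]
  rw [conj_basisMap_apply]
  intro f
  have : (⟨c, hc⟩ : Fin n) ≠ ⟨i, hi⟩ := by simpa using h
  simp [this]

theorem sem_toffoli_apply {n : ℕ} {c d i : ℕ} (hc : c < n) (hd : d < n) (hi : i < n) (h : c ≠ i)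
    (h' : d ≠ i) (h'' : c ≠ d) (ρ : Matrix (Q n) (Q n) ℂ) (f g : Q n) :
    (Gate.toffoli c d i).sem n ρ f g =
      ρ (Function.update f ⟨i, hi⟩ (f ⟨i, hi⟩ ^^ (f ⟨c, hc⟩ && f ⟨d, hd⟩)))
        (Function.update g ⟨i, hi⟩ (g ⟨i, hi⟩ ^^ (g ⟨c, hc⟩ && g ⟨d, hd⟩))) := by
  simp only [Gate.sem, hi, hc, hd, ne_eq, h, h', h'', not_false_eq_true, and_self, dif_pos]
  rw [conj_basisMap_apply]
  intro f
  have h₁ : (⟨c, hc⟩ : Fin n) ≠ ⟨i, hi⟩ := by simpa using h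
  have h₂ : (⟨d, hd⟩ : Fin n) ≠ ⟨i, hi⟩ := by simpa using h'
  simp [h₁, h₂]

theorem Gate.isCP_sem (n : ℕ) (g : Gate) : IsCP (g.sem n) := by
  cases g with
  | reset i =>
    simp only [Gate.sem]
    split_ifs
    · exact IsCP.sum _ fun _ _ => IsCP.conj _
    · exact IsCP.id
  | _ =>
    simp only [Gate.sem]
    split_ifs
    · exact IsCP.conj _
    · exact IsCP.id

/-- A single wire. -/
def bitLens {n : ℕ} (i : Fin n) : Lens (Q n) Bool where
  get f := f i
  put f b := Function.update f i b
  get_put := by simp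
  put_get := by simp
  put_put := by simp

theorem onWire_eq_liftMat {n : ℕ} (U : Matrix Bool Bool ℂ) (i : Fin n) :
    onWire U i = (bitLens i).liftMat U := by
  ext f g
  simp only [onWire, Lens.liftMat, Matrix.of_apply]
  refine if_congr ⟨fun hfg => ?_, fun hfg j hj => ?_⟩ rfl rfl
  · ext j
    by_cases hj : j = i
    · subst hj; simp [bitLens]
    · simp [bitLens, hj, hfg j hj]
  · rw [← hfg]
    simp [bitLens, hj]

theorem isTP_conj_onWire {n : ℕ} {U : Matrix Bool Bool ℂ} (hU : Uᴴ * U = 1) (i : Fin n) :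
    IsTP (conj (onWire U i)) := by
  rw [onWire_eq_liftMat, ← Lens.lift_conj]
  exact IsTP.lift _ (isTP_conj hU)

theorem hadamardGate_unitary : hadamardGateᴴ * hadamardGate = 1 := by
  have h2 : ((Real.sqrt 2 : ℝ) : ℂ) * (Real.sqrt 2 : ℝ) = 2 := by
    rw [← Complex.ofReal_mul, Real.mul_self_sqrt (by norm_num)]; norm_num
  have h0 : ((Real.sqrt 2 : ℝ) : ℂ) ≠ 0 := fun h => by rw [h] at h2; norm_num at h2
  ext a b
  simp only [hadamardGate, Matrix.mul_apply, Matrix.conjTranspose_apply, Matrix.of_apply,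
    Fintype.sum_bool]
  cases a <;> cases b <;> simp <;> field_simp <;> rw [sq, h2] <;> norm_num

theorem tGate_unitary : tGateᴴ * tGate = 1 := by
  rw [tGate, Matrix.diagonal_conjTranspose, Matrix.diagonal_mul_diagonal, ← Matrix.diagonal_one]
  congr 1
  ext a
  cases a
  · simp
  · simp only [Pi.star_apply, if_true, Complex.star_def]
    rw [← Complex.exp_conj, ← Complex.exp_add]
    simp [map_ofNat]

theorem Gate.isTP_sem (n : ℕ) (g : Gate) : IsTP (g.sem n) := by
  have hperm : ∀ {φ : Q n → Q n}, Function.Involutive φ → IsTP (conj (basisMap φ)) := by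
    intro φ hφ ρ
    simp only [Matrix.trace, Matrix.diag_apply, conj_basisMap_apply hφ]
    exact Equiv.sum_comp hφ.toPerm fun f => ρ f f
  cases g with
  | h i =>
    simp only [Gate.sem]
    split_ifs
    · exact isTP_conj_onWire hadamardGate_unitary _
    · exact IsTP.id
  | t i =>
    simp only [Gate.sem]
    split_ifs
    · exact isTP_conj_onWire tGate_unitary _
    · exact IsTP.id
  | x i =>
    simp only [Gate.sem]
    split_ifs
    · exact hperm fun f => by simp
    · exact IsTP.id
  | cnot c i =>
    simp only [Gate.sem]
    split_ifs with h
    · exact hperm fun f => by simp [h]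
    · exact IsTP.id
  | toffoli c d i =>
    simp only [Gate.sem]
    split_ifs with h
    · exact hperm fun f => by simp [h]
    · exact IsTP.id
  | reset i =>
    by_cases hi : i < n
    · have h : (Gate.reset i).sem n =
          (bitLens ⟨i, hi⟩).lift (∑ b : Bool, conj (Matrix.single false b 1)) := by
        simp only [Gate.sem, hi, dif_pos, Fintype.sum_bool, Lens.lift_add, Lens.lift_conj,
          onWire_eq_liftMat]
      rw [h]
      refine IsTP.lift _ fun ρ => ?_
      rw [trace_sum_conj]
      simp [Matrix.trace, Matrix.add_mul, Matrix.mul_apply,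
        Matrix.single_apply]
    · simp only [Gate.sem, hi]
      exact IsTP.id

theorem Circuit.isCP_sem (n : ℕ) (c : Circuit) : IsCP (Circuit.sem n c) := by
  induction c with
  | nil => exact IsCP.id
  | cons g c ih => exact ih.comp (g.isCP_sem n)

theorem Circuit.isTP_sem (n : ℕ) (c : Circuit) : IsTP (Circuit.sem n c) := by
  induction c with
  | nil => exact IsTP.id
  | cons g c ih => exact ih.comp (g.isTP_sem n)

/-! ## Sequential composition -/

/-- `Y (n - 1) ∘ ⋯ ∘ Y 0`. -/
noncomputable def seqComp {α : Type} (Y : ℕ → SOp α α) : ℕ → SOp α α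
  | 0 => LinearMap.id
  | n + 1 => Y n ∘ₗ seqComp Y n

theorem seqComp_succ' {α : Type} (Y : ℕ → SOp α α) (n : ℕ) :
    seqComp Y (n + 1) = seqComp (fun j => Y (j + 1)) n ∘ₗ Y 0 := by
  induction n with
  | zero => rfl
  | succ n ih =>
    change Y (n + 1) ∘ₗ seqComp Y (n + 1) = _
    rw [ih]
    rfl

/-- The map `A` may change the space: it relabels registers, discards a finished block, or discards
the message register. -/
theorem seqComp_intertwine {α β : Type} {Y : ℕ → SOp α α} {Z : ℕ → SOp β β} (A : SOp α β) (n : ℕ)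
    (h : ∀ j < n, A ∘ₗ Y j = Z j ∘ₗ A) : A ∘ₗ seqComp Y n = seqComp Z n ∘ₗ A := by
  induction n with
  | zero => rfl
  | succ n ih =>
    change A ∘ₗ (Y n ∘ₗ seqComp Y n) = (Z n ∘ₗ seqComp Z n) ∘ₗ A
    rw [← LinearMap.comp_assoc, h n (by omega), LinearMap.comp_assoc,
      ih fun j hj => h j (by omega), LinearMap.comp_assoc]

theorem seqComp_congr {α : Type} {Y Z : ℕ → SOp α α} (n : ℕ) (h : ∀ j < n, Y j = Z j) :
    seqComp Y n = seqComp Z n := by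
  simpa using seqComp_intertwine (Y := Y) (Z := Z) LinearMap.id n fun j hj => by rw [h j hj]; rfl

theorem IsCP.seqComp {α : Type} [Fintype α] [DecidableEq α] {Y : ℕ → SOp α α} (n : ℕ)
    (h : ∀ j < n, IsCP (Y j)) : IsCP (seqComp Y n) := by
  induction n with
  | zero => exact IsCP.id
  | succ n ih => exact (h n (by omega)).comp (ih fun j hj => h j (by omega))

theorem IsTP.seqComp {α : Type} [Fintype α] {Y : ℕ → SOp α α} (n : ℕ)
    (h : ∀ j < n, IsTP (Y j)) : IsTP (seqComp Y n) := by
  induction n with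
  | zero => exact IsTP.id
  | succ n ih => exact (h n (by omega)).comp (ih fun j hj => h j (by omega))

/-! ## Independent blocks -/

section blocks

variable {ι κ ν μ β : Type} {M : ℕ}

/-- `τ ⊗ ⋯ ⊗ τ`. -/
def prodState (M : ℕ) (τ : Matrix κ κ ℂ) : Matrix (Fin M → κ) (Fin M → κ) ℂ :=
  Matrix.of fun F G => ∏ j, τ (F j) (G j)

theorem prodState_isState [Fintype κ] {τ : Matrix κ κ ℂ} (hτ : IsState τ) (M : ℕ) :
    IsState (prodState M τ) := by
  classical
  constructor
  · obtain ⟨B, hB⟩ := exists_eq_conjTranspose_mul_self hτ.1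
    -- Positivity follows by factoring `τ`: distributivity turns a product of sums into a sum over
    -- all tuples.
    have : prodState M τ = (prodState M B)ᴴ * prodState M B := by
      ext F G
      simp only [prodState, Matrix.mul_apply, Matrix.conjTranspose_apply, Matrix.of_apply, hB,
        Finset.prod_univ_sum, Fintype.piFinset_univ, star_prod, Finset.prod_mul_distrib]
    rw [this]
    exact Matrix.posSemidef_conjTranspose_mul_self _
  · have h := hτ.2
    simp only [Matrix.trace, Matrix.diag_apply] at h ⊢
    simp only [prodState, Matrix.of_apply]
    rw [← Fintype.piFinset_univ, ← Finset.prod_univ_sum (fun _ => Finset.univ) fun _ k => τ k k]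
    simp [h]

/-- Block number `j` of the left factor, together with the right factor. -/
def blockLens (e : ι ≃ (Fin M → κ)) (j : Fin M) (ν : Type) : Lens (ι × ν) (κ × ν) where
  get p := (e p.1 j, p.2)
  put p a := (e.symm (Function.update (e p.1) j a.1), a.2)
  get_put := by simp
  put_get := by simp
  put_put := by simp

/-- The trivial lens. -/
def Lens.refl (α : Type) : Lens α α := Lens.ofEquiv (Equiv.refl α)

theorem Lens.lift_refl {α : Type} (Φ : SOp α α) : (Lens.refl α).lift Φ = Φ := rfl

/-- Split off the first block. -/
def consBlock (M : ℕ) (κ ν : Type) : ((Fin (M + 1) → κ) × ν) ≃ κ × ((Fin M → κ) × ν) where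
  toFun p := (p.1 0, (fun j => p.1 j.succ, p.2))
  invFun p := (Fin.cons p.1 p.2.1, p.2.2)
  left_inv p := by
    ext j
    · refine Fin.cases ?_ (fun j => ?_) j <;> simp
    · rfl
  right_inv p := by simp

theorem blockLens_zero : blockLens (Equiv.refl (Fin (M + 1) → κ)) 0 ν =
    (Lens.withFst κ (Lens.onSnd (Fin M → κ) (Lens.refl ν))).pre (consBlock M κ ν) := by
  refine Lens.ext rfl ?_
  funext p a
  refine Prod.ext ?_ rfl
  funext j
  refine Fin.cases ?_ (fun j => ?_) j
  · simp [blockLens, Lens.pre, Lens.comp, Lens.ofEquiv, Lens.withFst, consBlock]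
  · simp [blockLens, Lens.pre, Lens.comp, Lens.ofEquiv, Lens.withFst, consBlock, Lens.onSnd]

theorem blockLens_succ (j : Fin M) : blockLens (Equiv.refl (Fin (M + 1) → κ)) j.succ ν =
    (Lens.onSnd κ (blockLens (Equiv.refl (Fin M → κ)) j ν)).pre (consBlock M κ ν) := by
  refine Lens.ext rfl ?_
  funext p a
  refine Prod.ext ?_ rfl
  funext i
  refine Fin.cases ?_ (fun i => ?_) i
  · simp [blockLens, Lens.pre, Lens.comp, Lens.ofEquiv, consBlock, Lens.onSnd,
      Function.update_of_ne (Fin.succ_ne_zero j).symm]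
  · simp [blockLens, Lens.pre, Lens.comp, Lens.ofEquiv, consBlock, Lens.onSnd,
      Function.update_apply]

variable [Fintype κ]

theorem traceLeftOn_cons (S : κ → Prop) :
    (traceLeftOn (fun F : Fin (M + 1) → κ => ∀ j, S (F j)) : SOp _ ν) =
      traceLeftOn (fun F : Fin M → κ => ∀ j, S (F j)) ∘ₗ traceLeftOn S ∘ₗ
        relabel (consBlock M κ ν) := by
  classical
  ext1 ρ
  ext n n'
  simp only [LinearMap.comp_apply, traceLeftOn_apply, relabel_apply]
  simp only [Finset.sum_filter]
  rw [← (Fin.consEquiv fun _ : Fin (M + 1) => κ).sum_comp, Fintype.sum_prod_type, Finset.sum_comm]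
  refine Finset.sum_congr rfl fun F _ => ?_
  by_cases hF : ∀ j, S (F j)
  · rw [if_pos hF]
    refine Finset.sum_congr rfl fun k _ => ?_
    have h : (∀ j, S ((Fin.consEquiv fun _ : Fin (M + 1) => κ) (k, F) j)) ↔ S k := by
      simp [Fin.forall_fin_succ, Fin.consEquiv, hF]
    by_cases hk : S k
    · rw [if_pos hk, if_pos (h.2 hk)]
      rfl
    · rw [if_neg hk, if_neg (mt h.1 hk)]
  · rw [if_neg hF]
    refine Finset.sum_eq_zero fun k _ => if_neg fun h => hF fun j => ?_
    simpa [Fin.consEquiv] using h j.succ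

theorem tensorLeft_prodState_succ (τ : Matrix κ κ ℂ) :
    tensorLeft ν (prodState (M + 1) τ) = relabel (consBlock M κ ν).symm ∘ₗ
      tensorLeft ((Fin M → κ) × ν) τ ∘ₗ tensorLeft ν (prodState M τ) := by
  ext1 ρ
  ext ⟨F, n⟩ ⟨G, n'⟩
  change (∏ j, τ (F j) (G j)) * ρ n n' =
    τ (F 0) (G 0) * ((∏ j : Fin M, τ (F j.succ) (G j.succ)) * ρ n n')
  rw [Fin.prod_univ_succ, mul_assoc]

/-- Induction on the number of blocks. No step after the first touches block 0, so it can be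
measured and discarded right after step 0. That step has then become an operation on the common
system alone, and the remaining blocks are untouched. -/
theorem traceLeftOn_seqComp_refl (S : κ → Prop) (τ : Matrix κ κ ℂ) : ∀ (M : ℕ)
    (X : ℕ → SOp (κ × ν) (κ × ν)) (Y : ℕ → SOp ((Fin M → κ) × ν) ((Fin M → κ) × ν)),
    (∀ j : Fin M, Y j = (blockLens (Equiv.refl _) j ν).lift (X j)) →
    traceLeftOn (fun F : Fin M → κ => ∀ j, S (F j)) ∘ₗ seqComp Y M ∘ₗ
        tensorLeft ν (prodState M τ) =
      seqComp (fun j => traceLeftOn S ∘ₗ X j ∘ₗ tensorLeft ν τ) M := by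
  intro M
  induction M with
  | zero =>
    intro X Y _
    ext1 ρ
    ext n n'
    simp only [LinearMap.comp_apply, traceLeftOn_apply]
    have e : ∀ F : Fin 0 → κ, (seqComp Y 0 (tensorLeft ν (prodState 0 τ) ρ)) (F, n) (F, n') =
        ρ n n' := by
      intro F
      change (∏ j : Fin 0, τ (F j) (F j)) * ρ n n' = _
      simp
    simp only [e]
    simp [seqComp]
  | succ M ih =>
    intro X Y hY
    let A : SOp ((Fin (M + 1) → κ) × ν) ((Fin M → κ) × ν) :=
      traceLeftOn S ∘ₗ relabel (consBlock M κ ν)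
    let Z : ℕ → SOp ((Fin M → κ) × ν) ((Fin M → κ) × ν) := fun j =>
      if h : j < M then (blockLens (Equiv.refl _) ⟨j, h⟩ ν).lift (X (j + 1)) else 0
    have hA : A ∘ₗ seqComp (fun j => Y (j + 1)) M = seqComp Z M ∘ₗ A := by
      apply seqComp_intertwine
      intro j hj
      have h := hY (Fin.succ ⟨j, hj⟩)
      rw [blockLens_succ, Lens.lift_pre] at h
      simp only [Fin.val_succ] at h
      simp only [h, A, Z, hj, dif_pos]
      rw [LinearMap.comp_assoc, ← LinearMap.comp_assoc _ _ (relabel (consBlock M κ ν))]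
      have hr : relabel (consBlock M κ ν) ∘ₗ relabel (consBlock M κ ν).symm = LinearMap.id := by
        ext1 ρ
        exact relabel_relabel_symm _ _
      rw [hr, LinearMap.id_comp, ← LinearMap.comp_assoc, Lens.traceLeftOn_lift_onSnd,
        LinearMap.comp_assoc]
    have hA' : A ∘ₗ Y 0 ∘ₗ tensorLeft ν (prodState (M + 1) τ) =
        tensorLeft ν (prodState M τ) ∘ₗ (traceLeftOn S ∘ₗ X 0 ∘ₗ tensorLeft ν τ) := by
      have h : Y 0 = _ := hY 0
      rw [blockLens_zero, Lens.lift_pre] at h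
      rw [h, tensorLeft_prodState_succ]
      have e := Lens.traceLeftOn_lift_withFst_tensorLeft S τ
        (Lens.onSnd (Fin M → κ) (Lens.refl ν)) (X 0)
      have e' := Lens.lift_onSnd_tensorLeft (prodState M τ) (Lens.refl ν)
        (traceLeftOn S ∘ₗ X 0 ∘ₗ tensorLeft ν τ)
      rw [Lens.lift_refl, ← e] at e'
      rw [← e']
      ext1 ρ
      simp only [A, LinearMap.comp_apply, relabel_relabel_symm]
      rfl
    have hZ := ih (fun j => X (j + 1)) Z fun j => by simp [Z]
    rw [traceLeftOn_cons, seqComp_succ', seqComp_succ', ← hZ]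
    calc _ = traceLeftOn (fun F : Fin M → κ => ∀ j, S (F j)) ∘ₗ
          (A ∘ₗ seqComp (fun j => Y (j + 1)) M) ∘ₗ Y 0 ∘ₗ
            tensorLeft ν (prodState (M + 1) τ) := rfl
      _ = traceLeftOn (fun F : Fin M → κ => ∀ j, S (F j)) ∘ₗ seqComp Z M ∘ₗ
          (A ∘ₗ Y 0 ∘ₗ tensorLeft ν (prodState (M + 1) τ)) := by rw [hA]; rfl
      _ = _ := by rw [hA']; rfl

/-- Operations that use a fresh block in each step compose, after discarding the blocks, to the
product of the operations with a single block. -/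
theorem traceLeftOn_seqComp [Fintype ι] (e : ι ≃ (Fin M → κ)) (S : κ → Prop) {T : ι → Prop}
    (hT : ∀ f, T f ↔ ∀ j, S (e f j)) (τ : Matrix κ κ ℂ) {ω : Matrix ι ι ℂ}
    (hω : ∀ f g, ω f g = ∏ j, τ (e f j) (e g j)) (X : ℕ → SOp (κ × ν) (κ × ν))
    (Y : ℕ → SOp (ι × ν) (ι × ν)) (hY : ∀ j : Fin M, Y j = (blockLens e j ν).lift (X j)) :
    traceLeftOn T ∘ₗ seqComp Y M ∘ₗ tensorLeft ν ω =
      seqComp (fun j => traceLeftOn S ∘ₗ X j ∘ₗ tensorLeft ν τ) M := by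
  classical
  let E : (ι × ν) ≃ ((Fin M → κ) × ν) := e.prodCongr (Equiv.refl ν)
  let Z : ℕ → SOp ((Fin M → κ) × ν) ((Fin M → κ) × ν) := fun j =>
    if h : j < M then (blockLens (Equiv.refl _) ⟨j, h⟩ ν).lift (X j) else 0
  rw [← traceLeftOn_seqComp_refl S τ M X Z fun j => by simp [Z]]
  have h₁ : (traceLeftOn T : SOp (ι × ν) ν) =
      traceLeftOn (fun F : Fin M → κ => ∀ j, S (F j)) ∘ₗ relabel E := by
    ext1 ρ
    ext n n'
    simp only [LinearMap.comp_apply, traceLeftOn_apply, relabel_apply, Finset.sum_filter]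
    rw [← e.sum_comp]
    refine Finset.sum_congr rfl fun f _ => ?_
    by_cases hf : T f
    · rw [if_pos hf, if_pos ((hT f).1 hf)]
      simp [E]
    · rw [if_neg hf, if_neg (mt (hT f).2 hf)]
  have h₂ : relabel E ∘ₗ tensorLeft ν ω = tensorLeft ν (prodState M τ) := by
    ext1 ρ
    ext ⟨F, n⟩ ⟨G, n'⟩
    change ω (e.symm F) (e.symm G) * ρ n n' = (∏ j, τ (F j) (G j)) * ρ n n'
    rw [hω]
    simp
  have h₃ : relabel E ∘ₗ seqComp Y M = seqComp Z M ∘ₗ relabel E := by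
    apply seqComp_intertwine
    intro j hj
    have hp : blockLens e ⟨j, hj⟩ ν = (blockLens (Equiv.refl _) ⟨j, hj⟩ ν).pre E := rfl
    have h : Y j = _ := hY ⟨j, hj⟩
    rw [h, hp, Lens.lift_pre]
    ext1 ρ
    simp [Z, hj]
  rw [h₁, ← h₂, LinearMap.comp_assoc, ← LinearMap.comp_assoc _ _ (relabel E), h₃,
    LinearMap.comp_assoc]

end blocks

/-! ## Interactions on subsystems -/

section interact

variable {α α' μ β β' : Type}

/-- Lifting respects composition, so it is enough to compare single moves. -/
theorem interact_lift (L : Lens (α × μ × β) (α' × μ × β')) {P : ℕ → SOp (α × μ) (α × μ)}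
    {P' : ℕ → SOp (α' × μ) (α' × μ)} {V : ℕ → SOp (β × μ) (β × μ)}
    {V' : ℕ → SOp (β' × μ) (β' × μ)} (r : ℕ)
    (hP : ∀ t < r, actProver β (P t) = L.lift (actProver β' (P' t)))
    (hV : ∀ t < r, actVerifier α (V t) = L.lift (actVerifier α' (V' t))) :
    interact P V r = L.lift (interact P' V' r) := by
  induction r with
  | zero => exact (L.lift_id).symm
  | succ r ih =>
    change actVerifier α (V r) ∘ₗ actProver β (P r) ∘ₗ interact P V r = _
    rw [ih (fun t ht => hP t (by omega)) (fun t ht => hV t (by omega)), hP r (by omega),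
      hV r (by omega), ← Lens.lift_comp, ← Lens.lift_comp]
    rfl

theorem interact_add (P : ℕ → SOp (α × μ) (α × μ)) (V : ℕ → SOp (β × μ) (β × μ)) (r s : ℕ) :
    interact P V (r + s) =
      interact (fun t => P (r + t)) (fun t => V (r + t)) s ∘ₗ interact P V r := by
  induction s with
  | zero => rfl
  | succ s ih =>
    change actVerifier α (V (r + s)) ∘ₗ actProver β (P (r + s)) ∘ₗ interact P V (r + s) = _
    rw [ih]
    rfl

theorem interact_mul (P : ℕ → SOp (α × μ) (α × μ)) (V : ℕ → SOp (β × μ) (β × μ)) (M r : ℕ) :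
    interact P V (M * r) =
      seqComp (fun j => interact (fun t => P (j * r + t)) (fun t => V (j * r + t)) r) M := by
  induction M with
  | zero => rw [zero_mul]; rfl
  | succ M ih =>
    rw [add_mul, one_mul, interact_add, ih]
    rfl

/-- An operation before the first move of the prover. -/
theorem interact_first {P P' : ℕ → SOp (α × μ) (α × μ)} (V : ℕ → SOp (β × μ) (β × μ))
    (R : SOp (α × μ) (α × μ)) (h0 : P' 0 = P 0 ∘ₗ R) (h1 : ∀ t, 0 < t → P' t = P t) (r : ℕ) :
    interact P' V (r + 1) = interact P V (r + 1) ∘ₗ actProver β R := by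
  induction r with
  | zero =>
    change actVerifier α (V 0) ∘ₗ actProver β (P' 0) ∘ₗ LinearMap.id = _
    rw [h0]
    rfl
  | succ r ih =>
    change actVerifier α (V (r + 1)) ∘ₗ actProver β (P' (r + 1)) ∘ₗ interact P' V (r + 1) = _
    rw [ih, h1 _ (by omega)]
    rfl

theorem IsCP.interact [Fintype α] [Fintype μ] [Fintype β] [DecidableEq α] [DecidableEq μ]
    [DecidableEq β] {P : ℕ → SOp (α × μ) (α × μ)} {V : ℕ → SOp (β × μ) (β × μ)}
    (hP : ∀ t, IsCP (P t)) (hV : ∀ t, IsCP (V t)) (r : ℕ) : IsCP (interact P V r) := by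
  induction r with
  | zero => exact IsCP.id
  | succ r ih =>
    have h₁ := IsCP.lift (Lens.verifierLens α μ β) (hV r)
    have h₂ := IsCP.lift (Lens.proverLens α μ β) (hP r)
    exact h₁.comp (h₂.comp ih)

theorem IsTP.interact [Fintype α] [Fintype μ] [Fintype β] {P : ℕ → SOp (α × μ) (α × μ)}
    {V : ℕ → SOp (β × μ) (β × μ)}
    (hP : ∀ t, IsTP (P t)) (hV : ∀ t, IsTP (V t)) (r : ℕ) : IsTP (interact P V r) := by
  induction r with
  | zero => exact IsTP.id
  | succ r ih =>
    have h₁ := IsTP.lift (Lens.verifierLens α μ β) (hV r)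
    have h₂ := IsTP.lift (Lens.proverLens α μ β) (hP r)
    exact h₁.comp (h₂.comp ih)

theorem moves_isCP (n m : ℕ) (l : List Circuit) (t : ℕ) : IsCP (moves n m l t) :=
  IsCP.lift (Lens.ofEquiv (Fin.appendEquiv n m)) (Circuit.isCP_sem _ _)

theorem moves_isTP (n m : ℕ) (l : List Circuit) (t : ℕ) : IsTP (moves n m l t) :=
  IsTP.lift (Lens.ofEquiv (Fin.appendEquiv n m)) (Circuit.isTP_sem _ _)

end interact

/-! ## Wires of the sequential repetition -/

section runWire

variable {M a b n₁ n m : ℕ}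

theorem runWire_lt (h₁ : n₁ = a + b) (h : n = M * a + M * b) {j i : ℕ} (hj : j < M) (hi : i < n₁) :
    runWire M a b j i < n := by
  subst h₁ h
  have h1 : (j + 1) * a ≤ M * a := Nat.mul_le_mul_right a hj
  have h2 : (j + 1) * b ≤ M * b := Nat.mul_le_mul_right b hj
  rw [add_mul] at h1 h2
  unfold runWire
  split_ifs <;> omega

/-- The formula does not involve `j`: the message wires, and all nonexistent ones, are common to the
runs. -/
theorem runWire_of_ge {j i : ℕ} (hi : a + b ≤ i) :
    runWire M a b j i = M * a + M * b + (i - (a + b)) := by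
  unfold runWire
  rw [if_neg (by omega), if_neg (by omega)]

theorem block_eq {a j j' i i' : ℕ} (hi : i < a) (hi' : i' < a) (h : j * a + i = j' * a + i') :
    j = j' ∧ i = i' := by
  have hj : j = j' := by
    have h1 : (j * a + i) / a = j := by
      rw [mul_comm, Nat.mul_add_div (by omega), Nat.div_eq_of_lt hi, add_zero]
    have h2 : (j' * a + i') / a = j' := by
      rw [mul_comm, Nat.mul_add_div (by omega), Nat.div_eq_of_lt hi', add_zero]
    rw [← h1, ← h2, h]
  subst hj
  exact ⟨rfl, by omega⟩

/-- Different runs use disjoint private wires: input and work blocks lie in separate ranges, and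
within a range the run number is a quotient. -/
theorem runWire_inj_lt {j j' i i' : ℕ} (hj : j < M) (hj' : j' < M) (hi : i < a + b)
    (hi' : i' < a + b) (h : runWire M a b j i = runWire M a b j' i') : j = j' ∧ i = i' := by
  have h1 : (j + 1) * a ≤ M * a := Nat.mul_le_mul_right a hj
  have h2 : (j' + 1) * a ≤ M * a := Nat.mul_le_mul_right a hj'
  rw [add_mul] at h1 h2
  unfold runWire at h
  split_ifs at h
  · exact block_eq ‹_› ‹_› h
  · omega
  · omega
  · have := block_eq (a := b) (j := j) (j' := j') (i := i - a) (i' := i' - a) (by omega) (by omega)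
      (by omega)
    omega

theorem runWire_injective {j : ℕ} (hj : j < M) : Function.Injective (runWire M a b j) := by
  intro i i' h
  by_cases hi : i < a + b <;> by_cases hi' : i' < a + b
  · exact (runWire_inj_lt hj hj hi hi' h).2
  · have h1 := runWire_lt rfl rfl hj hi
    rw [h, runWire_of_ge (by omega)] at h1
    omega
  · have h1 := runWire_lt rfl rfl hj hi'
    rw [← h, runWire_of_ge (by omega)] at h1
    omega
  · rw [runWire_of_ge (by omega), runWire_of_ge (by omega)] at h
    omega

/-- The private wires are the disjoint union of the wires of the runs. -/
noncomputable def runWireEquiv (h₁ : n₁ = a + b) (h : n = M * a + M * b) :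
    Fin M × Fin n₁ ≃ Fin n :=
  Equiv.ofBijective (fun p => ⟨runWire M a b p.1 p.2, runWire_lt h₁ h p.1.2 p.2.2⟩) <| by
    rw [Fintype.bijective_iff_injective_and_card]
    constructor
    · rintro ⟨j, i⟩ ⟨j', i'⟩ hp
      have := runWire_inj_lt j.2 j'.2 (h₁ ▸ i.2) (h₁ ▸ i'.2) (Fin.ext_iff.1 hp)
      exact Prod.ext (Fin.ext this.1) (Fin.ext this.2)
    · simp [h₁, h, mul_add]

theorem runWireEquiv_val (h₁ : n₁ = a + b) (h : n = M * a + M * b) (j : Fin M) (i : Fin n₁) :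
    (runWireEquiv h₁ h (j, i) : ℕ) = runWire M a b j i := rfl

/-- The private qubits, run by run. -/
noncomputable def runBlocks (h₁ : n₁ = a + b) (h : n = M * a + M * b) :
    Q n ≃ (Fin M → Q n₁) :=
  ((runWireEquiv h₁ h).symm.arrowCongr (Equiv.refl Bool)).trans (Equiv.curry _ _ _)

theorem runBlocks_apply (h₁ : n₁ = a + b) (h : n = M * a + M * b) (f : Q n) (j : Fin M)
    (i : Fin n₁) : runBlocks h₁ h f j i = f (runWireEquiv h₁ h (j, i)) := rfl

theorem runBlocks_symm_apply (h₁ : n₁ = a + b) (h : n = M * a + M * b) (F : Fin M → Q n₁)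
    (j : Fin M) (i : Fin n₁) : (runBlocks h₁ h).symm F (runWireEquiv h₁ h (j, i)) = F j i := by
  refine (runBlocks_apply h₁ h _ j i).symm.trans ?_
  rw [Equiv.apply_symm_apply]

/-- A nonexistent output wire makes a run fail. Its image lies beyond the private wires of the
repetition, so it makes the repetition fail as well. -/
theorem allOnes_repeat (h₁ : n₁ = a + b) (h : n = M * a + M * b) (out : List ℕ) (f : Q n) :
    AllOnes ((List.range M).flatMap fun j => out.map (runWire M a b j)) f ↔
      ∀ j, AllOnes out (runBlocks h₁ h f j) := by
  simp only [AllOnes, List.mem_flatMap, List.mem_range, List.mem_map]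
  constructor
  · intro H j i hi
    obtain ⟨hlt, hf⟩ := H _ ⟨j, j.2, i, hi, rfl⟩
    have hi₁ : i < n₁ := by
      by_contra hge
      rw [runWire_of_ge (by omega)] at hlt
      omega
    exact ⟨hi₁, hf⟩
  · rintro H _ ⟨j, hj, i, hi, rfl⟩
    obtain ⟨hi₁, hf⟩ := H ⟨j, hj⟩ i hi
    exact ⟨runWire_lt h₁ h hj hi₁, hf⟩

/-- A circuit of one run, in the repetition. -/
theorem sem_map_runWire (h₁ : n₁ = a + b) (h : n = M * a + M * b) (j : Fin M) (c : Circuit) :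
    split n m ∘ₗ Circuit.sem (n + m) (c.map (Gate.map (runWire M a b j))) ∘ₗ join n m =
      (blockLens (runBlocks h₁ h) j (Q m)).lift
        (split n₁ m ∘ₗ Circuit.sem (n₁ + m) c ∘ₗ join n₁ m) := by
  have hlt : ∀ i, i < n₁ + m → runWire M a b j i < n + m := by
    intro i hi
    by_cases hi₁ : i < n₁
    · have := runWire_lt h₁ h j.2 hi₁
      omega
    · rw [runWire_of_ge (by omega)]
      omega
  let ι : Fin (n₁ + m) → Fin (n + m) := fun i => ⟨runWire M a b j i, hlt i i.2⟩
  have hι : Function.Injective ι := fun i i' hii =>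
    Fin.ext (runWire_injective j.2 (Fin.ext_iff.1 hii))
  have hc : ∀ i : Fin n₁, ι (Fin.castAdd m i) = Fin.castAdd m (runWireEquiv h₁ h (j, i)) :=
    fun i => rfl
  have hn : ∀ i : Fin m, ι (Fin.natAdd n₁ i) = Fin.natAdd n i := by
    intro i
    apply Fin.ext
    simp only [ι, Fin.val_natAdd]
    rw [runWire_of_ge (by omega)]
    omega
  rw [Circuit.sem_map hι (runWire_injective j.2) (fun _ => rfl)
    (fun i hi => by rw [runWire_of_ge (by omega)]; omega)]
  -- The renamed circuit is a lift along the lens of its wires, and that lens consists of block `j`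
  -- and the message register.
  have hL : ((blockLens (runBlocks h₁ h) j (Q m)).comp
      (Lens.ofEquiv (Fin.appendEquiv n₁ m))).pre (Fin.appendEquiv n m).symm = wireLens ι hι := by
    apply Lens.eq_wireLens
    · intro f i
      refine Fin.addCases (fun i => ?_) (fun i => ?_) i
      · rw [hc]
        simp [Lens.pre, Lens.comp, Lens.ofEquiv, blockLens, runBlocks_apply, Fin.appendEquiv]
      · rw [hn]
        simp [Lens.pre, Lens.comp, Lens.ofEquiv, blockLens, Fin.appendEquiv]
    · intro f A i hi
      revert hi
      refine Fin.addCases (fun i => ?_) (fun i => ?_) i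
      · intro hi
        obtain ⟨⟨j', i'⟩, rfl⟩ := (runWireEquiv h₁ h).surjective i
        have hj : j' ≠ j := by
          rintro rfl
          exact hi _ (hc i')
        simp [Lens.pre, Lens.comp, Lens.ofEquiv, blockLens, Fin.appendEquiv,
          runBlocks_symm_apply, hj, runBlocks_apply]
      · intro hi
        exact absurd (hn i) (hi _)
  rw [← hL, Lens.lift_pre]
  change relabel (Fin.appendEquiv n m).symm ∘ₗ _ ∘ₗ relabel (Fin.appendEquiv n m) = _
  rw [← Lens.lift_lift, Lens.lift_ofEquiv]
  ext1 ρ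
  simp only [LinearMap.comp_apply]
  exact (relabel_symm_relabel (Fin.appendEquiv n m) _).trans
    (congrArg _ (relabel_symm_relabel (Fin.appendEquiv n m) _))

end runWire

theorem getD_flatMap_range {α : Type} (M r : ℕ) (F : ℕ → ℕ → α) (d : α) {j t : ℕ} (hj : j < M)
    (ht : t < r) : ((List.range M).flatMap fun j => (List.range r).map (F j)).getD (j * r + t) d =
      F j t := by
  have hlen : ∀ M, ((List.range M).flatMap fun j => (List.range r).map (F j)).length = M * r := by
    intro M
    simp [List.length_flatMap]
  induction M with
  | zero => omega
  | succ M ih =>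
    rw [List.range_succ, List.flatMap_append]
    by_cases h : j < M
    · have h1 : (j + 1) * r ≤ M * r := Nat.mul_le_mul_right r h
      rw [add_mul] at h1
      rw [List.getD_append _ _ _ _ (by rw [hlen]; omega), ih h]
    · obtain rfl : j = M := by omega
      rw [List.getD_append_right _ _ _ _ (by rw [hlen]; omega), hlen]
      simp [ht]

/-! ## Runs of the repeated parties -/

section runs

variable {M a n₁ n m r : ℕ} {β : Type}

/-- The moves of a party in one run, with `start` executed before the first of them. -/
noncomputable def startMoves (n m : ℕ) (start : Circuit) (l : List Circuit) (t : ℕ) :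
    SOp (Q n × Q m) (Q n × Q m) :=
  split n m ∘ₗ Circuit.sem (n + m) ((if t = 0 then start else []) ++ l.getD t []) ∘ₗ join n m

theorem moves_repeat (P : Party) (start start₁ : Circuit) (h₁ : n₁ = a + P.work)
    (h : n = M * a + M * P.work) (j : Fin M) {t : ℕ} (ht : t < r)
    (hs : start = start₁.map (Gate.map (runWire M a P.work j))) :
    moves n m (P.repeat M r a start).circs (j * r + t) =
      (blockLens (runBlocks h₁ h) j (Q m)).lift (startMoves n₁ m start₁ P.circs t) := by
  rw [startMoves, ← sem_map_runWire, moves, Party.repeat, getD_flatMap_range _ _ _ _ j.2 ht]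
  congr 3
  rw [List.map_append, hs]
  congr 1
  split_ifs <;> rfl

/-- After `k` resets, entries whose row or column has a 1 on one of the first `k` wires vanish. In
the end only the all-zero entry is left, and preservation of the trace determines it. -/
theorem sem_reset_range (m : ℕ) (ρ : Matrix (Q m) (Q m) ℂ) :
    Circuit.sem m ((List.range m).map Gate.reset) ρ = ρ.trace • zeros m := by
  have key : ∀ k ≤ m, ∀ f g : Q m, (∃ i : Fin m, (i : ℕ) < k ∧ (f i = true ∨ g i = true)) →
      Circuit.sem m ((List.range k).map Gate.reset) ρ f g = 0 := by
    intro k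
    induction k with
    | zero => simp
    | succ k ih =>
      rintro hk f g ⟨i, hi, hfg⟩
      rw [List.range_succ, List.map_append, Circuit.sem_append]
      change (Gate.reset k).sem m (Circuit.sem m ((List.range k).map Gate.reset) ρ) f g = 0
      rw [sem_reset_apply (by omega)]
      by_cases hik : (i : ℕ) = k
      · have : (⟨k, by omega⟩ : Fin m) = i := Fin.ext hik.symm
        rw [this, if_neg]
        rcases hfg with h | h <;> simp [h]
      · split_ifs
        · refine Finset.sum_eq_zero fun b _ => ih (by omega) _ _ ⟨i, by omega, ?_⟩
          have : i ≠ ⟨k, by omega⟩ := fun h => hik (by rw [h])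
          rwa [Function.update_of_ne this, Function.update_of_ne this]
        · rfl
  set σ := Circuit.sem m ((List.range m).map Gate.reset) ρ with hσ
  have h0 : ∀ f g : Q m, ¬ (f = (fun _ => false) ∧ g = fun _ => false) → σ f g = 0 := by
    intro f g h
    apply key m le_rfl
    by_contra hcon
    push Not at hcon
    refine h ⟨funext fun i => ?_, funext fun i => ?_⟩
    · simpa using (hcon i i.2).1
    · simpa using (hcon i i.2).2
  have h1 : σ = σ (fun _ => false) (fun _ => false) • zeros m := by
    ext f g
    by_cases h : f = (fun _ => false) ∧ g = fun _ => false
    · simp [h.1, h.2, zeros, ketbra]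
    · rw [h0 f g h]
      have : ¬ ((fun _ => false) = f ∧ (fun _ => false) = g) := fun h' => h ⟨h'.1.symm, h'.2.symm⟩
      simp [zeros, ketbra, this]
  have h2 : σ.trace = ρ.trace := Circuit.isTP_sem _ _ _
  rw [h1, Matrix.trace_smul, (zeros_isState m).2, smul_eq_mul, mul_one] at h2
  rw [← h2]
  exact h1

theorem sem_map_reset (n m : ℕ) (ρ : Matrix (Q n × Q m) (Q n × Q m) ℂ) :
    (split n m ∘ₗ Circuit.sem (n + m) ((List.range m).map fun i => Gate.reset (n + i)) ∘ₗ
      join n m) ρ = traceRight (Q n) (Q m) ρ ⊗ₖ zeros m := by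
  have hι : Function.Injective (Fin.natAdd n : Fin m → Fin (n + m)) := Fin.natAdd_injective m n
  have hc : ((List.range m).map fun i => Gate.reset (n + i)) =
      ((List.range m).map Gate.reset).map (Gate.map fun i => n + i) := by
    rw [List.map_map]
    rfl
  rw [hc, Circuit.sem_map (φ := fun i => n + i) hι (fun i i' h => by simpa using h) (fun _ => rfl)
    (fun i hi => by omega)]
  have hL : (Lens.onSnd (Q n) (Lens.refl (Q m))).pre (Fin.appendEquiv n m).symm =
      wireLens (Fin.natAdd n) hι := by
    apply Lens.eq_wireLens
    · intro f i
      simp [Lens.pre, Lens.comp, Lens.ofEquiv, Lens.onSnd, Lens.refl, Fin.appendEquiv]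
    · intro f A i hi
      revert hi
      refine Fin.addCases (fun i => ?_) (fun i => ?_) i
      · intro _
        simp [Lens.pre, Lens.comp, Lens.ofEquiv, Lens.onSnd, Fin.appendEquiv]
      · intro hi
        exact absurd rfl (hi i)
  rw [← hL, Lens.lift_pre]
  change relabel (Fin.appendEquiv n m).symm (relabel (Fin.appendEquiv n m)
    ((Lens.onSnd (Q n) (Lens.refl (Q m))).lift _ (relabel (Fin.appendEquiv n m).symm
      (relabel (Fin.appendEquiv n m) ρ)))) = _
  rw [relabel_symm_relabel, relabel_symm_relabel]
  ext ⟨f, g⟩ ⟨f', g'⟩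
  rw [Lens.lift_apply, sem_reset_range]
  change (∑ z, ρ (f, z) (f', z)) * zeros m g g' = _ * zeros m g g'
  rw [traceRight_apply]

end runs

/-! ## Initial states of the repetition -/

theorem zeros_apply {n : ℕ} (f g : Q n) :
    zeros n f g = if ∀ i, f i = false ∧ g i = false then 1 else 0 := by
  have : ((fun _ => false) = f ∧ (fun _ => false) = g) ↔ ∀ i, f i = false ∧ g i = false := by
    simp only [funext_iff, ← forall_and]
    exact forall_congr' fun i => and_congr eq_comm eq_comm
  simp only [zeros, ketbra, Matrix.single, Matrix.of_apply, this]

theorem prod_zeros {ι : Type} [Fintype ι] {n m : ℕ} (f g : Q n) (F G : ι → Q m)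
    (h : (∀ i, f i = false ∧ g i = false) ↔ ∀ j i, F j i = false ∧ G j i = false) :
    zeros n f g = ∏ j, zeros m (F j) (G j) := by
  simp only [zeros_apply, Finset.prod_boole, Finset.mem_univ, true_imp_iff]
  exact if_congr h rfl rfl

theorem join_kronecker_apply {m n : ℕ} (ρ : Matrix (Q m) (Q m) ℂ) (σ : Matrix (Q n) (Q n) ℂ)
    (f g : Q (m + n)) : join m n (ρ ⊗ₖ σ) f g =
      ρ (fun i => f (Fin.castAdd n i)) (fun i => g (Fin.castAdd n i)) *
        σ (fun i => f (Fin.natAdd m i)) (fun i => g (Fin.natAdd m i)) := rfl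

theorem zeros_runBlocks {M b n : ℕ} (h : n = M * 0 + M * b) (h₁ : b = 0 + b) (f g : Q n) :
    zeros n f g = ∏ j, zeros b (runBlocks h₁ h f j) (runBlocks h₁ h g j) := by
  apply prod_zeros
  simp only [runBlocks_apply]
  rw [← (runWireEquiv h₁ h).forall_congr_right, Prod.forall]

/-- Copy number `j * k + c` of the witness is copy `c` of run `j`, and the work qubits are grouped
likewise. So the initial state is a product over the runs, as `traceLeftOn_seqComp` requires. -/
theorem initState_eq {M k K m b : ℕ} (hK : K = M * k) (h : K * m + M * b = M * (k * m) + M * b)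
    (w : Matrix (Q m) (Q m) ℂ) (f g : Q (K * m + M * b)) :
    join (K * m) (M * b) (tensorPower K w ⊗ₖ zeros (M * b)) f g =
      ∏ j, join (k * m) b (tensorPower k w ⊗ₖ zeros b)
        (runBlocks rfl h f j) (runBlocks rfl h g j) := by
  subst hK
  simp only [join_kronecker_apply, Finset.prod_mul_distrib]
  congr 1
  · simp only [tensorPower, Matrix.of_apply]
    rw [← (finProdFinEquiv (m := M) (n := k)).prod_comp, Fintype.prod_prod_type]
    refine Finset.prod_congr rfl fun j _ => Finset.prod_congr rfl fun c _ => ?_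
    have e : ∀ i : Fin m, Fin.castAdd (M * b) (finProdFinEquiv (finProdFinEquiv (j, c), i)) =
        runWireEquiv rfl h (j, Fin.castAdd b (finProdFinEquiv (c, i))) := by
      intro i
      apply Fin.ext
      have hlt := (finProdFinEquiv (c, i)).2
      rw [runWireEquiv_val, Fin.val_castAdd, Fin.val_castAdd]
      simp only [finProdFinEquiv_apply_val] at hlt ⊢
      rw [runWire, if_pos hlt]
      ring
    simp only [runBlocks_apply, e]
  · apply prod_zeros
    rw [← (finProdFinEquiv (m := M) (n := b)).forall_congr_right, Prod.forall]
    refine forall_congr' fun j => forall_congr' fun i => ?_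
    have e : Fin.natAdd (M * k * m) (finProdFinEquiv (j, i)) =
        runWireEquiv rfl h (j, Fin.natAdd (k * m) i) := by
      apply Fin.ext
      rw [runWireEquiv_val, Fin.val_natAdd, Fin.val_natAdd]
      simp only [finProdFinEquiv_apply_val]
      rw [runWire, if_neg (by omega), if_pos (by omega), Nat.add_sub_cancel_left]
      ring
    simp only [runBlocks_apply, e]

theorem tensorPower_eq {m : ℕ} (k : ℕ) (w : Matrix (Q m) (Q m) ℂ) :
    tensorPower k w = relabel (((Equiv.curry (Fin k) (Fin m) Bool).symm.trans
      (finProdFinEquiv.arrowCongr (Equiv.refl Bool)))) (prodState k w) := by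
  ext f g
  simp only [tensorPower, relabel_apply, prodState, Matrix.of_apply]
  rfl

theorem tensorPower_isState {m : ℕ} {w : Matrix (Q m) (Q m) ℂ} (hw : IsState w) (k : ℕ) :
    IsState (tensorPower k w) := by
  rw [tensorPower_eq]
  exact (prodState_isState hw k).map (IsCP.relabel _) (IsTP.relabel _)

theorem initState_isState {m : ℕ} {w : Matrix (Q m) (Q m) ℂ} (hw : IsState w) (k b : ℕ) :
    IsState (join (k * m) b (tensorPower k w ⊗ₖ zeros b)) :=
  ((tensorPower_isState hw k).kronecker (zeros_isState b)).map (IsCP.relabel _) (IsTP.relabel _)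

/-! ## The accepting branch of an execution -/

section accept

variable {α μ β ι κ : Type}

open scoped Classical in
theorem traceLeftOn_tensorLeft [Fintype α] (S : α → Prop) (τ : Matrix α α ℂ) (ρ : Matrix β β ℂ) :
    traceLeftOn S (tensorLeft β τ ρ) = (∑ a with S a, τ a a) • ρ := by
  ext b b'
  rw [traceLeftOn_apply]
  change ∑ a with S a, τ a a * ρ b b' = (∑ a with S a, τ a a) * ρ b b'
  rw [Finset.sum_mul]

theorem traceLeft_tensorLeft [Fintype α] {τ : Matrix α α ℂ} (hτ : τ.trace = 1)
    (ρ : Matrix β β ℂ) : traceLeft α β (tensorLeft β τ ρ) = ρ := by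
  classical
  rw [traceLeft, traceLeftOn_tensorLeft]
  simp only [Finset.filter_true]
  change τ.trace • ρ = ρ
  rw [hτ, one_smul]

theorem actProver_blockLens {M : ℕ} (e : ι ≃ (Fin M → κ)) (j : Fin M)
    (Φ : SOp (κ × μ) (κ × μ)) :
    actProver β ((blockLens e j μ).lift Φ) = (blockLens e j (μ × β)).lift (actProver β Φ) := by
  rw [Lens.actProver_eq, Lens.actProver_eq, Lens.lift_lift, Lens.lift_lift]
  rfl

theorem actVerifier_blockLens {M : ℕ} (e : ι ≃ (Fin M → κ)) (j : Fin M)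
    (Ψ : SOp (β × μ) (β × μ)) :
    actVerifier ι Ψ = (blockLens e j (μ × β)).lift (actVerifier κ Ψ) := by
  rw [Lens.actVerifier_eq, Lens.actVerifier_eq, Lens.lift_lift]
  congr 1
  refine Lens.ext rfl ?_
  funext p a
  simp [Lens.comp, blockLens, Lens.verifierLens]

end accept

/-- The operation on the verifier's register given by an execution with the honest prover whose
final private register is measured with an outcome in `S`. -/
noncomputable def Protocol.accept (prot : Protocol) (x : List Bool) {n : ℕ}
    (w : Matrix (Q n) (Q n) ℂ) (S : Q (prot.privQubits x n) → Prop) {β : Type}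
    (V : ℕ → SOp (β × Q (prot.msg x)) (β × Q (prot.msg x))) : SOp β β :=
  traceLeft _ _ ∘ₗ traceLeftOn S ∘ₗ prot.execute x w V

theorem startMoves_zero {n m : ℕ} (start : Circuit) (l : List Circuit) :
    startMoves n m start l 0 = moves n m l 0 ∘ₗ
      (split n m ∘ₗ Circuit.sem (n + m) start ∘ₗ join n m) := by
  rw [startMoves, if_pos rfl, Circuit.sem_append, moves]
  ext1 ρ
  simp only [LinearMap.comp_apply]
  congr 2
  exact (relabel_relabel_symm (Fin.appendEquiv n m) _).symm

theorem startMoves_pos {n m : ℕ} (start : Circuit) (l : List Circuit) {t : ℕ} (ht : 0 < t) :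
    startMoves n m start l t = moves n m l t := by
  rw [startMoves, if_neg (by omega), List.nil_append, moves]

theorem startMoves_nil {n m : ℕ} (l : List Circuit) (t : ℕ) :
    startMoves n m [] l t = moves n m l t := by
  rw [startMoves, ite_self, List.nil_append, moves]

/-- The message register at the beginning of a run does not matter. -/
theorem traceLeft_run {n m : ℕ} {β : Type} (S : Q n → Prop) (τ : Matrix (Q n) (Q n) ℂ)
    (l : List Circuit) (U : ℕ → SOp (β × Q m) (β × Q m)) (r : ℕ) :
    traceLeft (Q m) β ∘ₗ (traceLeftOn S ∘ₗ interact (startMoves n m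
        ((List.range m).map fun i => Gate.reset (n + i)) l) U r ∘ₗ tensorLeft (Q m × β) τ) =
      (traceLeft (Q m) β ∘ₗ traceLeftOn S ∘ₗ interact (moves n m l) U r ∘ₗ
        tensorLeft (Q m × β) τ ∘ₗ tensorLeft β (zeros m)) ∘ₗ traceLeft (Q m) β := by
  cases r with
  -- Without rounds nothing is reset, but then the message register is merely discarded.
  | zero =>
    ext1 ρ
    change traceLeft (Q m) β (traceLeftOn S (tensorLeft _ τ ρ)) =
      traceLeft (Q m) β (traceLeftOn S (tensorLeft _ τ (tensorLeft β (zeros m) _)))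
    rw [traceLeftOn_tensorLeft, traceLeftOn_tensorLeft, map_smul, map_smul,
      traceLeft_tensorLeft (zeros_isState m).2]
  | succ r =>
    rw [interact_first (P := moves n m l) U _ (startMoves_zero _ _)
      (fun t ht => startMoves_pos _ _ ht)]
    -- Whatever the message register holds, the resets replace it by zeros, independently of the
    -- prover's fresh register.
    have h : actProver β (split n m ∘ₗ Circuit.sem (n + m)
        ((List.range m).map fun i => Gate.reset (n + i)) ∘ₗ join n m) ∘ₗ
          tensorLeft (Q m × β) τ =
        tensorLeft (Q m × β) τ ∘ₗ tensorLeft β (zeros m) ∘ₗ traceLeft (Q m) β := by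
      ext1 ρ
      ext ⟨f, g, b⟩ ⟨f', g', b'⟩
      rw [Lens.actProver_eq]
      change (split n m ∘ₗ Circuit.sem (n + m) ((List.range m).map fun i => Gate.reset (n + i)) ∘ₗ
        join n m) (Matrix.of fun p p' => τ p.1 p'.1 * ρ (p.2, b) (p'.2, b')) (f, g) (f', g') =
        τ f f' * (zeros m g g' * traceLeft (Q m) β ρ b b')
      rw [sem_map_reset]
      change traceRight (Q n) (Q m) _ f f' * zeros m g g' = _
      rw [traceRight_apply, traceLeft_apply]
      simp only [Matrix.of_apply]
      rw [← Finset.mul_sum]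
      ring
    ext1 ρ
    have h' := LinearMap.congr_fun h ρ
    simp only [LinearMap.comp_apply] at h' ⊢
    rw [h']

/-- Run `j` acts on block `j` of the prover's register and on the other two registers, so
`traceLeftOn_seqComp` removes the prover's register run by run. By `traceLeft_run` the message
register can then be discarded between runs too, which leaves operations on the verifier's register
alone. -/
theorem accept_repeat {M k K d m r : ℕ} {β : Type} (P : Party) (hK : K = M * k)
    (w : Matrix (Q d) (Q d) ℂ) (U : ℕ → SOp (β × Q m) (β × Q m)) (S : Q (k * d + P.work) → Prop)
    (T : Q (K * d + M * P.work) → Prop) (h : K * d + M * P.work = M * (k * d) + M * P.work)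
    (hT : ∀ f, T f ↔ ∀ j, S (runBlocks rfl h f j)) {start : Circuit}
    (hs : start = (List.range m).map fun i => Gate.reset (M * (k * d) + M * P.work + i)) :
    traceLeft (Q m) β ∘ₗ traceLeftOn T ∘ₗ
        (interact (moves (K * d + M * P.work) m (P.repeat M r (k * d) start).circs) U (M * r) ∘ₗ
        tensorLeft _ (join (K * d) (M * P.work) (tensorPower K w ⊗ₖ zeros (M * P.work))) ∘ₗ
        tensorLeft β (zeros m)) =
      seqComp (fun j => traceLeft (Q m) β ∘ₗ traceLeftOn S ∘ₗ
        (interact (moves (k * d + P.work) m P.circs) (fun t => U (j * r + t)) r ∘ₗ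
        tensorLeft _ (join (k * d) P.work (tensorPower k w ⊗ₖ zeros P.work)) ∘ₗ
        tensorLeft β (zeros m))) M := by
  set τ := join (k * d) P.work (tensorPower k w ⊗ₖ zeros P.work) with hτ
  let X : ℕ → SOp (Q (k * d + P.work) × Q m × β) (Q (k * d + P.work) × Q m × β) := fun j =>
    interact (startMoves (k * d + P.work) m
      ((List.range m).map fun i => Gate.reset (k * d + P.work + i)) P.circs)
      (fun t => U (j * r + t)) r
  rw [interact_mul]
  set Y := fun j => interact (fun t => moves (K * d + M * P.work) m
      (P.repeat M r (k * d) start).circs (j * r + t)) (fun t => U (j * r + t)) r with hYdef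
  have hY : ∀ j : Fin M, Y j = (blockLens (runBlocks rfl h) j (Q m × β)).lift (X j) := by
    intro j
    apply interact_lift
    · intro t ht
      rw [← actProver_blockLens]
      congr 1
      refine moves_repeat P _ _ rfl h j ht ?_
      rw [hs, List.map_map]
      refine List.map_congr_left fun i _ => ?_
      change Gate.reset _ = Gate.reset _
      -- Wire `k * d + P.work + i` is message wire `i`, which in the repetition comes after the
      -- private wires of all runs.
      rw [runWire_of_ge (by omega)]
      congr 1
      omega
    · intro t ht
      exact actVerifier_blockLens _ _ _
  have hmain := traceLeftOn_seqComp (ν := Q m × β) (runBlocks rfl h) S hT τ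
    (initState_eq hK h w) X Y hY
  have hint : traceLeft (Q m) β ∘ₗ
      seqComp (fun j => traceLeftOn S ∘ₗ X j ∘ₗ tensorLeft (Q m × β) τ) M =
      seqComp (fun j => traceLeft (Q m) β ∘ₗ traceLeftOn S ∘ₗ
        (interact (moves (k * d + P.work) m P.circs) (fun t => U (j * r + t)) r ∘ₗ
        tensorLeft _ τ ∘ₗ tensorLeft β (zeros m))) M ∘ₗ traceLeft (Q m) β :=
    seqComp_intertwine _ _ fun j _ => traceLeft_run S τ P.circs _ _
  ext1 ρ
  have h1 := LinearMap.congr_fun hmain (tensorLeft β (zeros m) ρ)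
  have h2 := LinearMap.congr_fun hint (tensorLeft β (zeros m) ρ)
  simp only [LinearMap.comp_apply] at h1 h2 ⊢
  rw [traceLeft_tensorLeft (zeros_isState _).2] at h2
  rw [← h2, ← h1]

theorem Protocol.privQubits_seqRep (prot : Protocol) (V : QMAVerifier) (N : Polynomial ℕ)
    (x : List Bool) (n : ℕ) : (prot.seqRep V N).privQubits x n =
      N.eval x.length * prot.inQubits x n + N.eval x.length * (prot.prover x).work := by
  change (N * prot.copies).eval x.length * n + _ = _
  rw [Polynomial.eval_mul, mul_assoc]
  rfl

/-- The verifier's moves are arbitrary, which covers honest and malicious verifiers at once. The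
trivial event serves completeness and computational zero-knowledge, the event of the prover's
acceptance serves the two properties that involve the prover's output. -/
theorem Protocol.accept_seqRep (prot : Protocol) (V : QMAVerifier) (N : Polynomial ℕ)
    (x : List Bool) (w : Matrix (Q (V.witQubits x)) (Q (V.witQubits x)) ℂ) {β : Type}
    (U : ℕ → SOp (β × Q (prot.msg x)) (β × Q (prot.msg x)))
    (S : Q (prot.privQubits x (V.witQubits x)) → Prop)
    (T : Q ((prot.seqRep V N).privQubits x (V.witQubits x)) → Prop)
    (hT : ∀ f, T f ↔ ∀ j, S (runBlocks rfl (prot.privQubits_seqRep V N x _) f j)) :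
    (prot.seqRep V N).accept x w T U =
      seqComp (fun j => prot.accept x w S fun t => U (j * prot.rounds x + t))
        (N.eval x.length) :=
  accept_repeat (prot.prover x) (Polynomial.eval_mul) w U S T
    (prot.privQubits_seqRep V N x _) hT rfl

theorem Protocol.accept_seqRep_true (prot : Protocol) (V : QMAVerifier) (N : Polynomial ℕ)
    (x : List Bool) (w : Matrix (Q (V.witQubits x)) (Q (V.witQubits x)) ℂ) {β : Type}
    (U : ℕ → SOp (β × Q (prot.msg x)) (β × Q (prot.msg x))) :
    (prot.seqRep V N).accept x w (fun _ => True) U =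
      seqComp (fun j => prot.accept x w (fun _ => True) fun t => U (j * prot.rounds x + t))
        (N.eval x.length) :=
  prot.accept_seqRep V N x w U _ _ fun _ => by simp

theorem Protocol.accept_seqRep_out (prot : Protocol) (V : QMAVerifier) (N : Polynomial ℕ)
    (x : List Bool) (w : Matrix (Q (V.witQubits x)) (Q (V.witQubits x)) ℂ) {β : Type}
    (U : ℕ → SOp (β × Q (prot.msg x)) (β × Q (prot.msg x))) :
    (prot.seqRep V N).accept x w (AllOnes ((prot.seqRep V N).prover x).out) U =
      seqComp (fun j => prot.accept x w (AllOnes (prot.prover x).out)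
        fun t => U (j * prot.rounds x + t)) (N.eval x.length) :=
  prot.accept_seqRep V N x w U _ _ fun f =>
    allOnes_repeat rfl (prot.privQubits_seqRep V N x _) (prot.prover x).out f

/-! ## Verifiers that act on a part of their register -/

section

variable {α μ β ι κ ν : Type}

/-- Block number `j`. -/
def singleBlock {M : ℕ} (e : ι ≃ (Fin M → κ)) (j : Fin M) : Lens ι κ where
  get f := e f j
  put f k := e.symm (Function.update (e f) j k)
  get_put := by simp
  put_get := by simp
  put_put := by simp

theorem interact_withSnd (L : Lens β κ) (P : ℕ → SOp (α × μ) (α × μ))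
    {V : ℕ → SOp (κ × μ) (κ × μ)} {V' : ℕ → SOp (β × μ) (β × μ)} (r : ℕ)
    (h : ∀ t < r, V' t = (L.withSnd μ).lift (V t)) :
    interact P V' r = ((L.withFst μ).withFst α).lift (interact P V r) := by
  apply interact_lift
  · intro t _
    rw [Lens.actProver_eq, Lens.actProver_eq, Lens.lift_lift]
    congr 1
    refine Lens.ext rfl ?_
    funext p a
    simp [Lens.comp, Lens.withFst, Lens.proverLens, L.put_get]
  · intro t ht
    rw [h t ht, Lens.actVerifier_eq, Lens.actVerifier_eq, Lens.lift_lift, Lens.lift_lift]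
    rfl

theorem amplify_seqComp (κ : Type) (Y : ℕ → SOp ι ι) (n : ℕ) :
    amplify κ (seqComp Y n) = seqComp (fun j => amplify κ (Y j)) n := by
  induction n with
  | zero => rfl
  | succ n ih =>
    change amplify κ (Y n) ∘ₗ amplify κ (seqComp Y n) = _
    rw [ih]
    rfl

-- Independent blocks give a product of probabilities. This is `traceLeftOn_seqComp` with a trivial
-- common system, on which each step is multiplication by the same scalar.
open scoped Classical in
theorem sum_seqComp_singleBlock [Fintype ι] [Fintype κ] {M : ℕ} (e : ι ≃ (Fin M → κ))
    (S : κ → Prop) {T : ι → Prop} (hT : ∀ f, T f ↔ ∀ j, S (e f j)) (τ : Matrix κ κ ℂ)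
    {ω : Matrix ι ι ℂ} (hω : ∀ f g, ω f g = ∏ j, τ (e f j) (e g j)) (C : SOp κ κ)
    (Y : ℕ → SOp ι ι) (hY : ∀ j : Fin M, Y j = (singleBlock e j).lift C) :
    ∑ f with T f, seqComp Y M ω f f = (∑ k with S k, C τ k k) ^ M := by
  have h := traceLeftOn_seqComp (ν := Unit) e S hT τ hω (fun _ => amplify Unit C)
    (fun j => amplify Unit (Y j)) fun j => by
      simp only [hY, ← Lens.lift_left, Lens.lift_lift]
      rfl
  rw [← amplify_seqComp] at h
  have hb : ∀ n, seqComp (fun _ => traceLeftOn S ∘ₗ amplify Unit C ∘ₗ tensorLeft Unit τ) n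
      (1 : Matrix Unit Unit ℂ) () () = (∑ k with S k, C τ k k) ^ n := by
    intro n
    induction n with
    | zero => simp [seqComp]
    | succ n ih =>
      set σ := seqComp (fun _ => traceLeftOn S ∘ₗ amplify Unit C ∘ₗ tensorLeft Unit τ) n
        (1 : Matrix Unit Unit ℂ) with hσ
      change traceLeftOn S (amplify Unit C (tensorLeft Unit τ σ)) () () = _
      have hm : (Matrix.of fun k k' => tensorLeft Unit τ σ (k, ()) (k', ())) = σ () () • τ := by
        ext k k'
        exact mul_comm _ _
      rw [traceLeftOn_apply]
      change ∑ k with S k, C (Matrix.of fun k k' => tensorLeft Unit τ σ (k, ()) (k', ())) k k = _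
      rw [hm, map_smul, ih, pow_succ, Finset.mul_sum]
      rfl
  rw [← hb M, ← h]
  simp only [LinearMap.comp_apply]
  rw [traceLeftOn_apply]
  refine Finset.sum_congr rfl fun f _ => ?_
  change _ = seqComp Y M (Matrix.of fun f f' => ω f f' * (1 : Matrix Unit Unit ℂ) () ()) f f
  have hm : (Matrix.of fun f f' => ω f f' * (1 : Matrix Unit Unit ℂ) () ()) = ω := by
    ext f f'
    simp
  rw [hm]

end

/-! ## Completeness -/

section honest

variable (prot : Protocol) (x : List Bool)

theorem Protocol.accept_lift {n : ℕ} (w : Matrix (Q n) (Q n) ℂ) (S : Q (prot.privQubits x n) → Prop)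
    {β κ : Type} (L : Lens β κ) {V : ℕ → SOp (κ × Q (prot.msg x)) (κ × Q (prot.msg x))}
    {V' : ℕ → SOp (β × Q (prot.msg x)) (β × Q (prot.msg x))}
    (h : ∀ t < prot.rounds x, V' t = (L.withSnd _).lift (V t)) :
    prot.accept x w S V' = L.lift (prot.accept x w S V) := by
  rw [Protocol.accept, Protocol.execute, interact_withSnd L _ _ h]
  rfl

theorem Protocol.accept_isCP {n : ℕ} {w : Matrix (Q n) (Q n) ℂ} (hw : IsState w)
    (S : Q (prot.privQubits x n) → Prop) {β : Type} [Fintype β] [DecidableEq β]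
    {V : ℕ → SOp (β × Q (prot.msg x)) (β × Q (prot.msg x))} (hV : ∀ t, IsCP (V t)) :
    IsCP (prot.accept x w S V) :=
  IsCP.traceLeft.comp ((IsCP.traceLeftOn S).comp ((IsCP.interact (moves_isCP _ _ _) hV _).comp
    ((IsCP.tensorLeft (initState_isState hw _ _).1).comp (IsCP.tensorLeft (zeros_isState _).1))))

theorem Protocol.accept_true_isTP {n : ℕ} {w : Matrix (Q n) (Q n) ℂ} (hw : IsState w)
    {β : Type} [Fintype β] [DecidableEq β]
    {V : ℕ → SOp (β × Q (prot.msg x)) (β × Q (prot.msg x))} (hV : ∀ t, IsTP (V t)) :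
    IsTP (prot.accept x w (fun _ => True) V) :=
  IsTP.traceLeft.comp (IsTP.traceLeft.comp ((IsTP.interact (moves_isTP _ _ _) hV _).comp
    ((IsTP.tensorLeft (initState_isState hw _ _).2).comp (IsTP.tensorLeft (zeros_isState _).2))))

open scoped Classical in
theorem verifierAccepts_eq {α μ : Type} [Fintype α] [Fintype μ] {n : ℕ} (out : List ℕ)
    (ρ : Matrix (α × μ × Q n) (α × μ × Q n) ℂ) : verifierAccepts out ρ =
      (∑ f with AllOnes out f, ∑ a, ∑ m, ρ (a, m, f) (a, m, f)).re := by
  rw [verifierAccepts, probLeft]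
  congr 1
  simp only [Matrix.trace, Matrix.diag_apply, traceLeftOn_apply, relabel_apply]
  rw [Finset.sum_comm' (t' := {p : Q n × μ | AllOnes out p.1}) (s' := fun _ => Finset.univ)
    (by simp), Finset.sum_filter, Fintype.sum_prod_type, Finset.sum_filter]
  refine Finset.sum_congr rfl fun f _ => ?_
  simp only
  split_ifs
  · exact Finset.sum_comm
  · simp

open scoped Classical in
theorem Protocol.verifierProb_eq {n : ℕ} (w : Matrix (Q n) (Q n) ℂ) : prot.verifierProb x w =
    (∑ f with AllOnes (prot.verifier x).out f, prot.accept x w (fun _ => True)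
      (moves (prot.verifier x).work (prot.msg x) (prot.verifier x).circs)
      (zeros (prot.verifier x).work) f f).re := by
  rw [Protocol.verifierProb, verifierAccepts_eq]
  congr 1
  refine Finset.sum_congr rfl fun f _ => ?_
  rw [Finset.sum_comm]
  simp only [Protocol.accept, LinearMap.comp_apply, traceLeft_apply, traceLeftOn_apply,
    Finset.filter_true]
  rfl

theorem Protocol.proverProb_eq {n : ℕ} (w : Matrix (Q n) (Q n) ℂ) : prot.proverProb x w =
    (∑ f, prot.accept x w (AllOnes (prot.prover x).out)
      (moves (prot.verifier x).work (prot.msg x) (prot.verifier x).circs)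
      (zeros (prot.verifier x).work) f f).re := by
  rw [Protocol.proverProb, probLeft]
  congr 1
  exact (IsTP.traceLeft _).symm

/-- Diagonal entries of a positive operator are real and nonnegative, so taking real parts commutes
with powers. -/
theorem re_sum_diag_pow {κ : Type} [Fintype κ] {σ : Matrix κ κ ℂ} (hσ : σ.PosSemidef)
    (s : Finset κ) (M : ℕ) : ((∑ k ∈ s, σ k k) ^ M).re = (∑ k ∈ s, σ k k).re ^ M ∧
      0 ≤ (∑ k ∈ s, σ k k).re := by
  have h : (0 : ℂ) ≤ ∑ k ∈ s, σ k k := Finset.sum_nonneg fun k _ => hσ.diag_nonneg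
  have h' := Complex.le_def.1 h
  refine ⟨?_, h'.1⟩
  have : ∑ k ∈ s, σ k k = ((∑ k ∈ s, σ k k).re : ℂ) := Complex.ext rfl (by simpa using h'.2.symm)
  conv_lhs => rw [this]
  rw [← Complex.ofReal_pow, Complex.ofReal_re]

variable (V : QMAVerifier) (N : Polynomial ℕ)

theorem verifier_moves_repeat (P : Party) {M r m : ℕ} (j : Fin M) {t : ℕ} (ht : t < r) :
    moves (M * P.work) m (P.repeat M r 0 []).circs (j * r + t) =
      ((singleBlock (runBlocks (n := M * P.work) (zero_add P.work).symm (by simp)) j).withSnd (Q m)).lift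
        (moves P.work m P.circs t) := by
  have h := moves_repeat (m := m) P [] [] (zero_add P.work).symm (n := M * P.work) (by simp) j ht rfl
  rw [startMoves_nil] at h
  exact h

/-- The honest verifier starts each run with a fresh block, on which alone the map of that run acts;
so the runs are independent. Nonnegativity is recorded for use in Bernoulli's inequality. -/
theorem Protocol.proverProb_seqRep {w : Matrix (Q (V.witQubits x)) (Q (V.witQubits x)) ℂ}
    (hw : IsState w) : (prot.seqRep V N).proverProb x w = prot.proverProb x w ^ N.eval x.length ∧
      0 ≤ prot.proverProb x w := by
  classical
  have hb := fun S => re_sum_diag_pow ((prot.accept_isCP x hw S (moves_isCP (prot.verifier x).work _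
    (prot.verifier x).circs)).posSemidef (zeros_isState (prot.verifier x).work).1)
    Finset.univ (N.eval x.length)
  refine ⟨?_, by rw [proverProb_eq]; exact (hb _).2⟩
  rw [proverProb_eq, proverProb_eq, ← (hb _).1]
  congr 1
  have hacc := prot.accept_seqRep_out V N x w (moves (N.eval x.length * (prot.verifier x).work)
    (prot.msg x) ((prot.verifier x).repeat (N.eval x.length) (prot.rounds x) 0 []).circs)
  have h := sum_seqComp_singleBlock (runBlocks (zero_add (prot.verifier x).work).symm
    (show N.eval x.length * (prot.verifier x).work = _ by rw [mul_zero, zero_add]))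
    (fun _ => True) (T := fun _ => True) (by simp) _
    (zeros_runBlocks _ (zero_add (prot.verifier x).work).symm)
    (prot.accept x w (AllOnes (prot.prover x).out) (moves (prot.verifier x).work (prot.msg x)
      (prot.verifier x).circs))
    (fun j => prot.accept x w (AllOnes (prot.prover x).out) fun t =>
      moves (N.eval x.length * (prot.verifier x).work) (prot.msg x) ((prot.verifier x).repeat
        (N.eval x.length) (prot.rounds x) 0 []).circs (j * prot.rounds x + t)) fun j => by
        exact prot.accept_lift x w _ _ (fun t ht => verifier_moves_repeat (prot.verifier x) j ht)
  rw [← hacc] at h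
  simp only [Finset.filter_true] at h
  exact h

theorem Protocol.verifierProb_seqRep {w : Matrix (Q (V.witQubits x)) (Q (V.witQubits x)) ℂ}
    (hw : IsState w) :
    (prot.seqRep V N).verifierProb x w = prot.verifierProb x w ^ N.eval x.length ∧
      0 ≤ prot.verifierProb x w := by
  classical
  have hb := fun s => re_sum_diag_pow ((prot.accept_isCP x hw (fun _ => True)
    (moves_isCP (prot.verifier x).work _ (prot.verifier x).circs)).posSemidef
      (zeros_isState (prot.verifier x).work).1) s (N.eval x.length)
  refine ⟨?_, by rw [verifierProb_eq]; exact (hb _).2⟩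
  rw [verifierProb_eq, verifierProb_eq, ← (hb _).1]
  congr 1
  have hacc := prot.accept_seqRep_true V N x w (moves (N.eval x.length * (prot.verifier x).work)
    (prot.msg x) ((prot.verifier x).repeat (N.eval x.length) (prot.rounds x) 0 []).circs)
  have h := sum_seqComp_singleBlock (runBlocks (zero_add (prot.verifier x).work).symm
    (show N.eval x.length * (prot.verifier x).work = _ by rw [mul_zero, zero_add]))
    (AllOnes (prot.verifier x).out) (allOnes_repeat _ _ (prot.verifier x).out) _
    (zeros_runBlocks _ (zero_add (prot.verifier x).work).symm)
    (prot.accept x w (fun _ => True) (moves (prot.verifier x).work (prot.msg x)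
      (prot.verifier x).circs))
    (fun j => prot.accept x w (fun _ => True) fun t =>
      moves (N.eval x.length * (prot.verifier x).work) (prot.msg x) ((prot.verifier x).repeat
        (N.eval x.length) (prot.rounds x) 0 []).circs (j * prot.rounds x + t)) fun j => by
        exact prot.accept_lift x w _ _ (fun t ht => verifier_moves_repeat (prot.verifier x) j ht)
  rw [← hacc] at h
  exact h

end honest

/-! ## Soundness -/

section soundness

variable {α μ β : Type}

/-- Move the verifier's register to the front. -/
def verifierFirst (α μ β : Type) : (α × μ × β) ≃ β × (α × μ) where
  toFun p := (p.2.2, (p.1, p.2.1))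
  invFun p := (p.2.1, p.2.2, p.1)
  left_inv _ := rfl
  right_inv _ := rfl

/-- One run against a prover who holds `σ`, as an operation on `σ`; the verifier's register is
fresh, and the outcome of measuring it at the end is in `S`. -/
noncomputable def runOp [Fintype β] (S : β → Prop) (τ : Matrix β β ℂ)
    (P : ℕ → SOp (α × μ) (α × μ)) (V : ℕ → SOp (β × μ) (β × μ)) (r : ℕ) :
    SOp (α × μ) (α × μ) :=
  traceLeftOn S ∘ₗ (relabel (verifierFirst α μ β) ∘ₗ interact P V r ∘ₗ
    relabel (verifierFirst α μ β).symm) ∘ₗ tensorLeft (α × μ) τ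

theorem verifierAccepts_runOp [Fintype α] [Fintype μ] {n : ℕ} (out : List ℕ)
    (ρ : Matrix (α × μ × Q n) (α × μ × Q n) ℂ) : verifierAccepts out ρ =
      (traceLeftOn (AllOnes out) (relabel (verifierFirst α μ (Q n)) ρ)).trace.re := by
  classical
  rw [verifierAccepts_eq]
  congr 1
  simp only [Matrix.trace, Matrix.diag_apply, traceLeftOn_apply, relabel_apply]
  conv_rhs => rw [Finset.sum_comm]
  refine Finset.sum_congr rfl fun f _ => ?_
  rw [Fintype.sum_prod_type]
  rfl

/-- Here it is the verifier's register that splits into fresh blocks. The common system consists of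
the prover's and the message register, which a cheating prover carries from one run to the next. -/
theorem verifierAccepts_repeat [Fintype α] [DecidableEq α] (Vp : Party) {M r m : ℕ}
    (ρ : Matrix α α ℂ) (P : ℕ → SOp (α × Q m) (α × Q m)) :
    verifierAccepts (Vp.repeat M r 0 []).out
      (interact P (moves (M * Vp.work) m (Vp.repeat M r 0 []).circs) (M * r)
        (ρ ⊗ₖ (zeros m ⊗ₖ zeros (M * Vp.work)))) =
    (seqComp (fun j => runOp (AllOnes Vp.out) (zeros Vp.work) (fun t => P (j * r + t))
      (moves Vp.work m Vp.circs) r) M (ρ ⊗ₖ zeros m)).trace.re := by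
  have h₀ : M * Vp.work = M * 0 + M * Vp.work := by simp
  let e := runBlocks (zero_add Vp.work).symm h₀
  let G := verifierFirst α (Q m) (Q (M * Vp.work))
  let run : ℕ → SOp (α × Q m × Q (M * Vp.work)) (α × Q m × Q (M * Vp.work)) := fun j =>
    interact (fun t => P (j * r + t))
      (fun t => moves (M * Vp.work) m (Vp.repeat M r 0 []).circs (j * r + t)) r
  let X : ℕ → SOp (Q Vp.work × (α × Q m)) (Q Vp.work × (α × Q m)) := fun j =>
    relabel (verifierFirst α (Q m) (Q Vp.work)) ∘ₗ
      interact (fun t => P (j * r + t)) (moves Vp.work m Vp.circs) r ∘ₗ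
        relabel (verifierFirst α (Q m) (Q Vp.work)).symm
  let Y : ℕ → SOp (Q (M * Vp.work) × (α × Q m)) (Q (M * Vp.work) × (α × Q m)) := fun j =>
    relabel G ∘ₗ run j ∘ₗ relabel G.symm
  have hY : ∀ j : Fin M, Y j = (blockLens e j (α × Q m)).lift (X j) := by
    intro j
    have hrun : run j = _ := interact_withSnd (singleBlock e j) (fun t => P (j * r + t)) r
      fun t ht => verifier_moves_repeat Vp j ht
    have hX : X j = (Lens.ofEquiv (verifierFirst α (Q m) (Q Vp.work)).symm).lift
      (interact (fun t => P (j * r + t)) (moves Vp.work m Vp.circs) r) := rfl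
    have hY' : Y j = (Lens.ofEquiv G.symm).lift (run j) := rfl
    rw [hY', hX, hrun, Lens.lift_lift, Lens.lift_lift]
    rfl
  have hmain := traceLeftOn_seqComp (ν := α × Q m) e (AllOnes Vp.out)
    (allOnes_repeat _ _ Vp.out) _ (zeros_runBlocks h₀ (zero_add Vp.work).symm) X Y hY
  have hseq : relabel G ∘ₗ seqComp run M = seqComp Y M ∘ₗ relabel G := by
    apply seqComp_intertwine
    intro j _
    ext1 σ
    simp [Y]
  rw [verifierAccepts_runOp, interact_mul]
  have h1 := LinearMap.congr_fun hseq (ρ ⊗ₖ (zeros m ⊗ₖ zeros (M * Vp.work)))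
  have h2 := LinearMap.congr_fun hmain (ρ ⊗ₖ zeros m)
  simp only [LinearMap.comp_apply] at h1 h2
  have h3 : relabel G (ρ ⊗ₖ (zeros m ⊗ₖ zeros (M * Vp.work))) =
      tensorLeft (α × Q m) (zeros (M * Vp.work)) (ρ ⊗ₖ zeros m) := by
    ext ⟨f, a, k⟩ ⟨f', a', k'⟩
    change ρ a a' * (zeros m k k' * zeros (M * Vp.work) f f') =
      zeros (M * Vp.work) f f' * (ρ a a' * zeros m k k')
    ring
  rw [h3] at h1
  have h4 := congrArg (fun σ => (traceLeftOn (AllOnes (Vp.repeat M r 0 []).out) σ).trace.re) h1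
  refine h4.trans (congrArg (fun σ => σ.trace.re) h2)

/-- A prover whose register contains the message register of an earlier run, and who starts by
restoring it. -/
noncomputable def restoring (P : ℕ → SOp (α × μ) (α × μ)) (t : ℕ) :
    SOp ((α × μ) × μ) ((α × μ) × μ) :=
  (Lens.withSnd μ (Lens.left α μ)).lift (P t) ∘ₗ
    if t = 0 then relabel ((Equiv.prodAssoc α μ μ).trans
      (((Equiv.refl α).prodCongr (Equiv.prodComm μ μ)).trans (Equiv.prodAssoc α μ μ).symm))
    else LinearMap.id

/-- Take apart the register of a prover who has restored the old message register. -/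
def spareFirst (α μ β : Type) : ((α × μ) × μ × β) ≃ μ × (β × (α × μ)) where
  toFun p := (p.1.2, p.2.2, p.1.1, p.2.1)
  invFun p := ((p.2.2.1, p.1), p.2.2.2, p.2.1)
  left_inv _ := rfl
  right_inv _ := rfl

theorem verifierAccepts_spareFirst [Fintype α] [Fintype μ] {n : ℕ} (out : List ℕ)
    (ρ : Matrix ((α × μ) × μ × Q n) ((α × μ) × μ × Q n) ℂ) : verifierAccepts out ρ =
      (traceLeftOn (AllOnes out) (traceLeft _ _ (relabel (spareFirst α μ (Q n)) ρ))).trace.re := by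
  classical
  rw [verifierAccepts_eq]
  congr 1
  simp only [Matrix.trace, Matrix.diag_apply, traceLeftOn_apply, traceLeft_apply, relabel_apply]
  conv_rhs => rw [Finset.sum_comm]
  refine Finset.sum_congr rfl fun f _ => ?_
  simp only [Fintype.sum_prod_type]
  refine Finset.sum_congr rfl fun a _ => ?_
  rw [Finset.sum_comm]
  rfl

/-- After the initial swap the old message is back in place, and the fresh zeros sit in the spare
register, which nothing touches until it is traced out. -/
theorem verifierAccepts_restoring [Fintype α] {m n : ℕ} (out : List ℕ)
    (τ : Matrix (Q n) (Q n) ℂ) (P : ℕ → SOp (α × Q m) (α × Q m))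
    (V : ℕ → SOp (Q n × Q m) (Q n × Q m)) (r : ℕ) (ω : Matrix (α × Q m) (α × Q m) ℂ) :
    verifierAccepts out (interact (restoring P) V r (ω ⊗ₖ (zeros m ⊗ₖ τ))) =
      (runOp (AllOnes out) τ P V r ω).trace.re := by
  have hz := traceLeft_tensorLeft (β := Q n × (α × Q m)) (zeros_isState m).2
  cases r with
  -- Without rounds the swap never happens; acceptance then depends on `τ` only, and both sides are
  -- the same multiple of the trace of `ω`.
  | zero =>
    have h : interact (restoring P) V 0 (ω ⊗ₖ (zeros m ⊗ₖ τ)) = ω ⊗ₖ (zeros m ⊗ₖ τ) := rfl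
    rw [h, verifierAccepts_runOp]
    have h' : relabel (verifierFirst (α × Q m) (Q m) (Q n)) (ω ⊗ₖ (zeros m ⊗ₖ τ)) =
        tensorLeft _ τ (ω ⊗ₖ zeros m) := by
      ext ⟨f, a, k⟩ ⟨f', a', k'⟩
      change ω a a' * (zeros m k k' * τ f f') = τ f f' * (ω a a' * zeros m k k')
      ring
    rw [h', runOp]
    simp only [LinearMap.comp_apply, traceLeftOn_tensorLeft, Matrix.trace_smul]
    have hc : (relabel (verifierFirst α (Q m) (Q n))) (interact P V 0
        ((relabel (verifierFirst α (Q m) (Q n)).symm) (tensorLeft _ τ ω))) = tensorLeft _ τ ω :=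
      relabel_relabel_symm (verifierFirst α (Q m) (Q n)) (tensorLeft _ τ ω)
    rw [hc, traceLeftOn_tensorLeft, Matrix.trace_smul, Matrix.trace_kronecker, (zeros_isState m).2,
      mul_one]
  | succ r =>
    rw [interact_first (P := fun t => (Lens.withSnd (Q m) (Lens.left α (Q m))).lift (P t)) V _ rfl
      (fun t ht => by rw [restoring, if_neg (by omega)]; rfl), LinearMap.comp_apply]
    let L : Lens ((α × Q m) × Q m × Q n) (α × Q m × Q n) :=
      ((Lens.ofEquiv (verifierFirst α (Q m) (Q n)).symm).onSnd (Q m)).pre (spareFirst α (Q m) (Q n))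
    have hL : interact (fun t => (Lens.withSnd (Q m) (Lens.left α (Q m))).lift (P t)) V (r + 1) =
        L.lift (interact P V (r + 1)) := by
      apply interact_lift
      · intro t _
        rw [Lens.actProver_eq, Lens.actProver_eq, Lens.lift_lift, Lens.lift_lift]
        rfl
      · intro t _
        rw [Lens.actVerifier_eq, Lens.actVerifier_eq, Lens.lift_lift]
        rfl
    rw [hL, verifierAccepts_spareFirst, Lens.lift_pre]
    have hs : relabel (spareFirst α (Q m) (Q n)) (actProver (Q n) (relabel
        ((Equiv.prodAssoc α (Q m) (Q m)).trans (((Equiv.refl α).prodCongr (Equiv.prodComm (Q m)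
          (Q m))).trans (Equiv.prodAssoc α (Q m) (Q m)).symm))) (ω ⊗ₖ (zeros m ⊗ₖ τ))) =
        tensorLeft _ (zeros m) (tensorLeft _ τ ω) := by
      ext ⟨l, f, a, k⟩ ⟨l', f', a', k'⟩
      change ω (a, k) (a', k') * (zeros m l l' * τ f f') =
        zeros m l l' * (τ f f' * ω (a, k) (a', k'))
      ring
    simp only [LinearMap.comp_apply, relabel_relabel_symm, if_true]
    rw [hs]
    have hT := LinearMap.congr_fun (Lens.lift_onSnd_tensorLeft (zeros m)
      (Lens.ofEquiv (verifierFirst α (Q m) (Q n)).symm) (interact P V (r + 1))) (tensorLeft _ τ ω)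
    simp only [LinearMap.comp_apply] at hT
    rw [hT, hz]
    rfl

variable {A : PromiseProblem} {s : ℕ → ℝ} {prot : Protocol}

theorem restoring_isChannel [Fintype α] [DecidableEq α] [Fintype μ] [DecidableEq μ]
    {P : ℕ → SOp (α × μ) (α × μ)} (hP : ∀ t, IsChannel (P t)) (t : ℕ) :
    IsChannel (restoring P t) := by
  apply isChannel_of_isCP_isTP
  · refine (IsCP.lift _ (hP t).isCP).comp ?_
    split_ifs
    exacts [IsCP.relabel _, IsCP.id]
  · refine (IsTP.lift _ (hP t).isTP).comp ?_
    split_ifs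
    exacts [IsTP.relabel _, IsTP.id]

theorem runOp_isCP [Fintype α] [DecidableEq α] [Fintype μ] [DecidableEq μ] [Fintype β]
    [DecidableEq β] (S : β → Prop) {τ : Matrix β β ℂ} (hτ : τ.PosSemidef)
    {P : ℕ → SOp (α × μ) (α × μ)} (hP : ∀ t, IsCP (P t)) {V : ℕ → SOp (β × μ) (β × μ)}
    (hV : ∀ t, IsCP (V t)) (r : ℕ) : IsCP (runOp S τ P V r) :=
  (IsCP.traceLeftOn S).comp (((IsCP.relabel _).comp ((IsCP.interact hP hV r).comp
    (IsCP.relabel _))).comp (IsCP.tensorLeft hτ))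

/-- Soundness speaks of normalised states and an empty message register. Linearity removes the first
restriction; `restoring`, with the old message as part of the prover's private register, removes the
second. -/
theorem Protocol.Sound.runOp_trace_le (h : prot.Sound A s) {x : List Bool} (hx : x ∈ A.no)
    [Fintype α] [DecidableEq α]
    {P : ℕ → SOp (α × Q (prot.msg x)) (α × Q (prot.msg x))} (hP : ∀ t, IsChannel (P t))
    {σ : Matrix (α × Q (prot.msg x)) (α × Q (prot.msg x)) ℂ} (hσ : σ.PosSemidef) :
    (runOp (AllOnes (prot.verifier x).out) (zeros (prot.verifier x).work) P
      (moves (prot.verifier x).work (prot.msg x) (prot.verifier x).circs) (prot.rounds x)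
      σ).trace.re ≤ s x.length * σ.trace.re := by
  rcases eq_or_ne σ 0 with rfl | h0
  · simp
  obtain ⟨ω, hω, hσω, hpos⟩ := eq_smul_state hσ h0
  have key := h x hx (α × Q (prot.msg x)) ω (restoring P) hω (restoring_isChannel hP)
  rw [verifierAccepts_restoring] at key
  rw [hσω, map_smul, Matrix.trace_smul, smul_eq_mul, Complex.re_ofReal_mul, ← hσω, mul_comm]
  exact mul_le_mul_of_nonneg_right key hpos.le

/-- The operator left after some accepted runs is positive and its trace is the probability of that
event; every further run costs a factor `s`. -/
theorem Protocol.Sound.seqRep (h : prot.Sound A s) (hs : ∀ n, 0 ≤ s n) (V : QMAVerifier)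
    (N : Polynomial ℕ) : (prot.seqRep V N).Sound A fun n => s n ^ N.eval n := by
  intro x hx α _ _ ρ P hρ hP
  set Y : ℕ → SOp (α × Q (prot.msg x)) (α × Q (prot.msg x)) := fun j =>
    runOp (AllOnes (prot.verifier x).out) (zeros (prot.verifier x).work)
      (fun t => P (j * prot.rounds x + t))
      (moves (prot.verifier x).work (prot.msg x) (prot.verifier x).circs) (prot.rounds x) with hY
  have hcp : ∀ j, IsCP (Y j) := fun j =>
    runOp_isCP _ (zeros_isState _).1 (fun t => (hP _).isCP) (moves_isCP _ _ _) _
  have hle : ∀ j σ, σ.PosSemidef → (Y j σ).trace.re ≤ s x.length * σ.trace.re := fun j σ hσ =>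
    h.runOp_trace_le hx (fun t => hP _) hσ
  have h0 : IsState (ρ ⊗ₖ zeros (prot.msg x)) := hρ.kronecker (zeros_isState _)
  have key : ∀ M : ℕ, (seqComp Y M (ρ ⊗ₖ zeros (prot.msg x))).trace.re ≤ s x.length ^ M := by
    intro M
    induction M with
    | zero =>
      change (ρ ⊗ₖ zeros (prot.msg x)).trace.re ≤ _
      rw [h0.2]
      simp
    | succ M ih =>
      refine (hle M _ ((IsCP.seqComp M fun j _ => hcp j).posSemidef h0.1)).trans ?_
      rw [pow_succ']
      exact mul_le_mul_of_nonneg_left ih (hs _)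
  refine le_trans (le_of_eq ?_) (key (N.eval x.length))
  exact verifierAccepts_repeat (prot.verifier x) ρ P

end soundness

/-! ## Negligible functions and probabilities -/

theorem eval_le_mul_pow (p : Polynomial ℕ) {n : ℕ} (hn : 1 ≤ n) :
    p.eval n ≤ p.eval 1 * n ^ p.natDegree := by
  rw [Polynomial.eval_eq_sum_range, Polynomial.eval_eq_sum_range, Finset.sum_mul]
  refine Finset.sum_le_sum fun i hi => ?_
  rw [one_pow, mul_one]
  exact Nat.mul_le_mul_left _ (Nat.pow_le_pow_right hn (Finset.mem_range_succ_iff.1 hi))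

/-- The definition of `Negligible` bounds from above only, so `ε` may be negative; hence the maximum
with 0. -/
theorem Negligible.poly_mul {ε : ℕ → ℝ} (h : Negligible ε) (p : Polynomial ℕ) :
    Negligible fun n => ((p.eval n : ℕ) : ℝ) * max (ε n) 0 := by
  intro c
  -- The degree absorbs the power in the bound for `p`, and the extra 1 absorbs the constant `p.eval
  -- 1`, which is below `n`.
  obtain ⟨n₀, hn₀⟩ := h (c + p.natDegree + 1)
  refine ⟨n₀ + p.eval 1, fun n hn => ?_⟩
  have hpos : (0 : ℝ) < n := by exact_mod_cast (by omega : 0 < n)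
  dsimp only
  rcases le_or_gt (ε n) 0 with he | he
  · rw [max_eq_right he, mul_zero]
    positivity
  rw [max_eq_left he.le]
  have h1 := hn₀ n (by omega)
  have h2 : ((p.eval n : ℕ) : ℝ) ≤ ((p.eval 1 : ℕ) : ℝ) * (n : ℝ) ^ p.natDegree := by
    exact_mod_cast eval_le_mul_pow p (by omega : 1 ≤ n)
  have h3 : ((p.eval 1 : ℕ) : ℝ) < n := by exact_mod_cast (by omega : p.eval 1 < n)
  have h4 : (0 : ℝ) < (n : ℝ) ^ (c + p.natDegree + 1) := by positivity
  calc ((p.eval n : ℕ) : ℝ) * ε n ≤ (((p.eval 1 : ℕ) : ℝ) * (n : ℝ) ^ p.natDegree) * ε n := by gcongr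
    _ ≤ (((p.eval 1 : ℕ) : ℝ) * (n : ℝ) ^ p.natDegree) * (1 / (n : ℝ) ^ (c + p.natDegree + 1)) := by gcongr
    _ = ((p.eval 1 : ℕ) : ℝ) / n * (1 / (n : ℝ) ^ c) := by field_simp; ring
    _ < 1 / (n : ℝ) ^ c := by
      have : ((p.eval 1 : ℕ) : ℝ) / n < 1 := (div_lt_one hpos).2 h3
      have h5 : (0 : ℝ) < 1 / (n : ℝ) ^ c := by positivity
      nlinarith

/-- Bernoulli's inequality. As `p ≤ 1` is not assumed, the case `1 < p` is treated separately. -/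
theorem one_sub_le_pow {p e : ℝ} (hp : 0 ≤ p) (h : 1 - e ≤ p) (M : ℕ) :
    1 - M * max e 0 ≤ p ^ M := by
  have hm : 1 - max e 0 ≤ p := by linarith [le_max_left e 0]
  induction M with
  | zero => simp
  | succ M ih =>
    rcases le_or_gt p 1 with h1 | h1
    · have h2 : p ^ M ≤ 1 := pow_le_one₀ hp h1
      rw [pow_succ]
      push_cast
      nlinarith [pow_nonneg hp M, le_max_right e 0]
    · have : 1 ≤ p ^ (M + 1) := one_le_pow₀ h1.le
      have : 0 ≤ ((M + 1 : ℕ) : ℝ) * max e 0 := by positivity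
      linarith

/-- From 1 - 1/q ≤ exp(-1/q) the power is at most exp(-N/q), and N/q eventually exceeds every
multiple of log n. -/
theorem negligible_pow {q N : ℕ → ℕ} (hq : ∀ n, 0 < q n)
    (h : Tendsto (fun n : ℕ => (N n : ℝ) / ((q n : ℝ) * Real.log n)) atTop atTop) :
    Negligible fun n => (1 - 1 / (q n : ℝ)) ^ N n := by
  intro c
  -- The exponent `c + 1` makes the final inequality strict; adding 2 to `n₀` makes the logarithm
  -- positive.
  obtain ⟨n₀, hn₀⟩ := eventually_atTop.1 (h.eventually_ge_atTop ((c : ℝ) + 1))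
  refine ⟨n₀ + 2, fun n hn => ?_⟩
  have hn1 : (1 : ℝ) < n := by exact_mod_cast (by omega : 1 < n)
  have hlog : 0 < Real.log n := Real.log_pos hn1
  have hq1 : (1 : ℝ) ≤ q n := by exact_mod_cast hq n
  have hqpos : (0 : ℝ) < q n := by linarith
  have h1 := hn₀ n (by omega)
  rw [le_div_iff₀ (by positivity)] at h1
  have h2 : ((c : ℝ) + 1) * Real.log n ≤ N n / q n := by
    rw [le_div_iff₀ hqpos]
    linarith
  have h3 : (1 : ℝ) - 1 / q n ≤ Real.exp (-(1 / q n)) := by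
    have := Real.add_one_le_exp (-(1 / (q n : ℝ)))
    linarith
  have h4 : (0 : ℝ) ≤ 1 - 1 / q n := by
    rw [sub_nonneg, div_le_one hqpos]
    exact hq1
  calc (1 - 1 / (q n : ℝ)) ^ N n ≤ Real.exp (-(1 / q n)) ^ N n := by gcongr
    _ = Real.exp (-(N n / q n)) := by
      rw [← Real.exp_nat_mul]
      congr 1
      ring
    _ ≤ Real.exp (-(((c : ℝ) + 1) * Real.log n)) := by
      apply Real.exp_le_exp.2
      linarith
    _ = 1 / (n : ℝ) ^ (c + 1) := by
      rw [Real.exp_neg, one_div]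
      congr 1
      rw [mul_comm, Real.exp_mul, Real.exp_log (by linarith)]
      exact_mod_cast Real.rpow_natCast (n : ℝ) (c + 1)
    _ < 1 / (n : ℝ) ^ c := by
      apply one_div_lt_one_div_of_lt (by positivity)
      exact pow_lt_pow_right₀ hn1 (by omega)

/-! ### Completeness of the repeated protocol -/

section

variable {A : PromiseProblem} {V : QMAVerifier} {prot : Protocol}

theorem Protocol.Complete.seqRep {ε : ℕ → ℝ} (h : prot.Complete A V fun n => 1 - ε n)
    (N : Polynomial ℕ) :
    (prot.seqRep V N).Complete A V fun n => 1 - ((N.eval n : ℕ) : ℝ) * max (ε n) 0 := by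
  intro i
  have hp := prot.verifierProb_seqRep i.x V N i.state
  rw [hp.1]
  exact one_sub_le_pow hp.2 (h i) _

theorem Protocol.ProverComplete.seqRep (h : prot.ProverComplete A V) (N : Polynomial ℕ) :
    (prot.seqRep V N).ProverComplete A V := by
  obtain ⟨ε, hε, h⟩ := h
  refine ⟨_, hε.poly_mul N, fun i => ?_⟩
  have hp := prot.proverProb_seqRep i.x V N i.state
  rw [hp.1]
  exact one_sub_le_pow hp.2 (h i) _

end

/-! ## Circuits on more wires -/

/-- Insert `k` wires in front of the wire number `n`. -/
def shiftFrom (n k i : ℕ) : ℕ := if i < n then i else i + k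

theorem shiftFrom_injective (n k : ℕ) : Function.Injective (shiftFrom n k) := by
  intro i j h
  simp only [shiftFrom] at h
  split_ifs at h <;> omega

theorem shiftFrom_of_lt {n k i : ℕ} (h : i < n) : shiftFrom n k i = i := if_pos h

theorem shiftFrom_of_le {n k i : ℕ} (h : n ≤ i) : shiftFrom n k i = i + k := if_neg (by omega)

/-- Common ground for adding ancillas and for adding input wires: wire `i` of the lens is wire `φ
i`, and all other wires are left alone. -/
theorem sem_map_lens {n b m a : ℕ} (L : Lens (Q n × Q b) (Q m × Q a)) {φ : ℕ → ℕ}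
    (hφ : Function.Injective φ) (hlt : ∀ i < m + a, φ i < n + b)
    (hout : ∀ i, m + a ≤ i → n + b ≤ φ i)
    (hget : ∀ (f : Q (n + b)) (i : Fin (m + a)), Fin.appendEquiv m a
      (L.get ((Fin.appendEquiv n b).symm f)) i = f ⟨φ i, hlt i i.2⟩)
    (hput : ∀ (f : Q (n + b)) (g : Q m × Q a) (i : Fin (n + b)), (∀ j < m + a, φ j ≠ i) →
      Fin.appendEquiv n b (L.put ((Fin.appendEquiv n b).symm f) g) i = f i) (c : Circuit) :
    split n b ∘ₗ Circuit.sem (n + b) (c.map (Gate.map φ)) ∘ₗ join n b =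
      L.lift (split m a ∘ₗ Circuit.sem (m + a) c ∘ₗ join m a) := by
  let ι : Fin (m + a) → Fin (n + b) := fun i => ⟨φ i, hlt i i.2⟩
  have hι : Function.Injective ι := fun i i' hii => Fin.ext (hφ (Fin.ext_iff.1 hii))
  rw [Circuit.sem_map hι hφ (fun _ => rfl) hout]
  have hL : (L.comp (Lens.ofEquiv (Fin.appendEquiv m a))).pre (Fin.appendEquiv n b).symm =
      wireLens ι hι := by
    apply Lens.eq_wireLens
    · exact hget
    · intro f A i hi
      exact hput f _ i fun j hj h => hi ⟨j, hj⟩ (Fin.ext h)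
  rw [← hL, Lens.lift_pre]
  change relabel (Fin.appendEquiv n b).symm ∘ₗ _ ∘ₗ relabel (Fin.appendEquiv n b) = _
  rw [← Lens.lift_lift, Lens.lift_ofEquiv]
  ext1 ρ
  simp only [LinearMap.comp_apply]
  exact (relabel_symm_relabel (Fin.appendEquiv n b) _).trans
    (congrArg _ (relabel_symm_relabel (Fin.appendEquiv n b) _))

/-- A circuit acting on its input and its ancillas. -/
noncomputable def circOp (n a : ℕ) (c : Circuit) : SOp (Q n × Q a) (Q n × Q a) :=
  split n a ∘ₗ Circuit.sem (n + a) c ∘ₗ join n a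

theorem circOp_isCP (n a : ℕ) (c : Circuit) : IsCP (circOp n a c) :=
  IsCP.lift (Lens.ofEquiv (Fin.appendEquiv n a)) (Circuit.isCP_sem _ _)

theorem circOp_isTP (n a : ℕ) (c : Circuit) : IsTP (circOp n a c) :=
  IsTP.lift (Lens.ofEquiv (Fin.appendEquiv n a)) (Circuit.isTP_sem _ _)

theorem circOp_append (n a : ℕ) (c d : Circuit) :
    circOp n a (c ++ d) = circOp n a d ∘ₗ circOp n a c := by
  rw [circOp, Circuit.sem_append]
  ext1 ρ
  simp only [circOp, LinearMap.comp_apply]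
  congr 2
  exact (relabel_relabel_symm (Fin.appendEquiv n a) _).symm

theorem AncCircuit.chan_eq (C : AncCircuit) (n : ℕ) (ρ : Matrix (Q n) (Q n) ℂ) :
    C.chan n ρ = traceRight (Q n) (Q C.anc) (circOp n C.anc C.gates (ρ ⊗ₖ zeros C.anc)) := rfl

theorem AncCircuit.chan_isCP (C : AncCircuit) (n : ℕ) : IsCP (C.chan n) :=
  IsCP.traceRight.comp ((circOp_isCP n _ _).comp (IsCP.tensorRight (zeros_isState _).1))

theorem AncCircuit.chan_isTP (C : AncCircuit) (n : ℕ) : IsTP (C.chan n) :=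
  IsTP.traceRight.comp ((circOp_isTP n _ _).comp (IsTP.tensorRight (zeros_isState _).2))

theorem sum_append {M : Type} [AddCommMonoid M] (a d : ℕ) (F : Q (a + d) → M) :
    ∑ h, F h = ∑ f : Q a, ∑ g : Q d, F (Fin.append f g) := by
  rw [← (Fin.appendEquiv a d).sum_comp, Fintype.sum_prod_type]
  rfl

theorem join_append (n a : ℕ) (σ : Matrix (Q n × Q a) (Q n × Q a) ℂ) (i j : Q n) (f g : Q a) :
    join n a σ (Fin.append i f) (Fin.append j g) = σ (i, f) (j, g) := by
  have : ∀ (i : Q n) (f : Q a), (Fin.appendEquiv n a).symm (Fin.append i f) = (i, f) :=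
    fun i f => (Fin.appendEquiv n a).symm_apply_apply (i, f)
  rw [join, relabel_apply, this, this]

open scoped Classical in
theorem AncCircuit.acceptProb_eq (C : AncCircuit) (n : ℕ) (ρ : Matrix (Q n) (Q n) ℂ) :
    C.acceptProb n ρ = ∑ i, ∑ f, if AllOnes [0] (Fin.append i f) then
      (circOp n C.anc C.gates (ρ ⊗ₖ zeros C.anc) (i, f) (i, f)).re else 0 := by
  have h : C.run n ρ = join n C.anc (circOp n C.anc C.gates (ρ ⊗ₖ zeros C.anc)) :=
    (relabel_relabel_symm (Fin.appendEquiv n C.anc) _).symm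
  rw [AncCircuit.acceptProb, Finset.sum_filter, sum_append, h]
  simp only [join_append]

/-! ### Unused ancillas -/

/-- The gates for use with `b` ancillas instead of `a`. -/
def padGates (n a b : ℕ) (c : Circuit) : Circuit := c.map (Gate.map (shiftFrom (n + a) b))

/-- All but the last `d` of the ancillas. -/
def ancLens (n a d : ℕ) : Lens (Q n × Q (a + d)) (Q n × Q a) where
  get p := (p.1, fun i => p.2 (Fin.castAdd d i))
  put p q := (q.1, Fin.append q.2 fun i => p.2 (Fin.natAdd a i))
  get_put p q := by simp
  put_get p := Prod.ext rfl (Fin.append_castAdd_natAdd)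
  put_put p q q' := by simp

/-- A gate may mention wires from `n + a` on, which do not exist. Shifting these by `a + d` keeps
them out of the added ancillas. -/
theorem circOp_padGates (n a d : ℕ) (c : Circuit) :
    circOp n (a + d) (padGates n a (a + d) c) = (ancLens n a d).lift (circOp n a c) := by
  refine sem_map_lens (ancLens n a d) (shiftFrom_injective _ _) (fun i hi => ?_) (fun i hi => ?_)
    (fun f i => ?_) (fun f g i hi => ?_) c
  · rw [shiftFrom_of_lt hi]
    omega
  · rw [shiftFrom_of_le hi]
    omega
  · have h : (⟨shiftFrom (n + a) (a + d) i, by rw [shiftFrom_of_lt i.2]; omega⟩ :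
        Fin (n + (a + d))) = ⟨i, by omega⟩ := Fin.ext (shiftFrom_of_lt i.2)
    rw [h]
    refine Fin.addCases (fun i => ?_) (fun i => ?_) i <;>
      simp [ancLens, Fin.appendEquiv] <;> rfl
  · revert hi
    refine Fin.addCases (fun i => ?_) (fun i => ?_) i
    · intro hi
      exact absurd (shiftFrom_of_lt (by omega)) (hi i (by omega))
    · refine Fin.addCases (fun i => ?_) (fun i => ?_) i
      · intro hi
        exact absurd (shiftFrom_of_lt (by simp)) (hi (n + i) (by simp))
      · intro _
        simp [ancLens, Fin.appendEquiv]

theorem zeros_append (a d : ℕ) (f f' : Q a) (g g' : Q d) :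
    zeros (a + d) (Fin.append f g) (Fin.append f' g') = zeros a f f' * zeros d g g' := by
  simp only [zeros_apply, ← ite_and, mul_ite, mul_one, mul_zero]
  refine if_congr ?_ rfl rfl
  constructor
  · intro h
    exact ⟨fun i => by simpa using h (Fin.natAdd a i), fun i => by simpa using h (Fin.castAdd d i)⟩
  · rintro ⟨h, h'⟩ i
    refine Fin.addCases (fun i => ?_) (fun i => ?_) i
    · simpa using h' i
    · simpa using h i

theorem circOp_padGates_apply (n a d : ℕ) (c : Circuit) (ρ : Matrix (Q n) (Q n) ℂ) (i j : Q n)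
    (f f' : Q a) (g g' : Q d) : circOp n (a + d) (padGates n a (a + d) c) (ρ ⊗ₖ zeros (a + d))
      (i, Fin.append f g) (j, Fin.append f' g') =
        zeros d g g' * circOp n a c (ρ ⊗ₖ zeros a) (i, f) (j, f') := by
  rw [circOp_padGates, Lens.lift_apply]
  have e : (Matrix.of fun p p' => (ρ ⊗ₖ zeros (a + d)) ((ancLens n a d).put (i, Fin.append f g) p)
      ((ancLens n a d).put (j, Fin.append f' g') p')) = zeros d g g' • (ρ ⊗ₖ zeros a) := by
    ext p p'
    simp only [Matrix.of_apply, ancLens, Matrix.kronecker_apply, Matrix.smul_apply, smul_eq_mul,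
      Fin.append_right, zeros_append]
    exact (mul_assoc _ _ _).symm.trans (mul_comm _ _)
  rw [e, map_smul]
  simp [ancLens]

theorem sum_zeros_diag (d : ℕ) : ∑ g : Q d, zeros d g g = 1 := (zeros_isState d).2

theorem traceRight_padGates (n : ℕ) {a b : ℕ} (hb : a ≤ b) (c : Circuit)
    (ρ : Matrix (Q n) (Q n) ℂ) :
    traceRight (Q n) (Q b) (circOp n b (padGates n a b c) (ρ ⊗ₖ zeros b)) =
      AncCircuit.chan ⟨a, c⟩ n ρ := by
  obtain ⟨d, rfl⟩ := Nat.exists_eq_add_of_le hb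
  ext i j
  rw [AncCircuit.chan_eq, traceRight_apply, traceRight_apply, sum_append]
  refine Finset.sum_congr rfl fun f _ => ?_
  simp only [circOp_padGates_apply]
  rw [← Finset.sum_mul, sum_zeros_diag, one_mul]

theorem exists_append {n m : ℕ} (c : ℕ) (i : Q n) (f : Q m) :
    (∃ k : Fin (n + m), c + k = 0 ∧ Fin.append i f k = true) ↔
      (∃ k : Fin n, c + k = 0 ∧ i k = true) ∨ ∃ k : Fin m, c + n + k = 0 ∧ f k = true := by
  constructor
  · rintro ⟨k, hk, h⟩
    revert hk h
    refine Fin.addCases (fun k => ?_) (fun k => ?_) k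
    · intro hk h
      exact Or.inl ⟨k, hk, by simpa using h⟩
    · intro hk h
      exact Or.inr ⟨k, by simpa [add_assoc] using hk, by simpa using h⟩
  · rintro (⟨k, hk, h⟩ | ⟨k, hk, h⟩)
    · exact ⟨Fin.castAdd m k, hk, by simpa using h⟩
    · exact ⟨Fin.natAdd n k, by simpa [add_assoc] using hk, by simpa using h⟩

/-- Only the degenerate case is delicate: without other wires, wire 0 is a padding ancilla. It holds
0, so the outcome is rejection, just as for a missing wire. -/
theorem allOnes_append_iff {n a d : ℕ} (i : Q n) (f : Q a) {g : Q d} (hg : ∀ k, g k = false) :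
    AllOnes [0] (Fin.append i (Fin.append f g)) ↔ AllOnes [0] (Fin.append i f) := by
  have h : ∀ {m : ℕ} (u : Q m), AllOnes [0] u ↔ ∃ k : Fin m, 0 + (k : ℕ) = 0 ∧ u k = true := by
    intro m u
    simp only [AllOnes, List.mem_singleton, forall_eq, zero_add]
    exact ⟨fun ⟨h, h'⟩ => ⟨⟨0, h⟩, rfl, h'⟩, fun ⟨⟨k, hk⟩, h, h'⟩ => by
      obtain rfl : k = 0 := h
      exact ⟨hk, h'⟩⟩
  simp only [h, exists_append]
  simp [hg]

theorem acceptProb_padGates (n : ℕ) {a b : ℕ} (hb : a ≤ b) (c : Circuit)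
    (ρ : Matrix (Q n) (Q n) ℂ) :
    AncCircuit.acceptProb ⟨b, padGates n a b c⟩ n ρ = AncCircuit.acceptProb ⟨a, c⟩ n ρ := by
  classical
  obtain ⟨d, rfl⟩ := Nat.exists_eq_add_of_le hb
  simp only [AncCircuit.acceptProb_eq]
  refine Finset.sum_congr rfl fun i _ => ?_
  rw [sum_append]
  refine Finset.sum_congr rfl fun f _ => ?_
  have e : ∀ g : Q d, (if AllOnes [0] (Fin.append i (Fin.append f g)) then
      (circOp n (a + d) (padGates n a (a + d) c) (ρ ⊗ₖ zeros (a + d))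
        (i, Fin.append f g) (i, Fin.append f g)).re else 0) =
      (zeros d g g * if AllOnes [0] (Fin.append i f) then
        circOp n a c (ρ ⊗ₖ zeros a) (i, f) (i, f) else 0).re := by
    intro g
    rw [circOp_padGates_apply]
    by_cases hg : zeros d g g = 0
    · simp [hg]
    · have hg' : ∀ k, g k = false := by
        rw [zeros_apply] at hg
        simpa using hg
      rw [if_congr (allOnes_append_iff i f hg') rfl rfl]
      split_ifs <;> simp
  simp only [e]
  rw [← Complex.re_sum, ← Finset.sum_mul, sum_zeros_diag, one_mul]
  split_ifs <;> rfl

/-! ### Circuits one after the other -/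

/-- The channels of the circuits in the list, applied from left to right. -/
noncomputable def compList (n : ℕ) : List AncCircuit → SOp (Q n) (Q n)
  | [] => LinearMap.id
  | C :: L => compList n L ∘ₗ C.chan n

theorem compList_append (n : ℕ) (L L' : List AncCircuit) :
    compList n (L ++ L') = compList n L' ∘ₗ compList n L := by
  induction L with
  | nil => rfl
  | cons C L ih =>
    change compList n (L ++ L') ∘ₗ C.chan n = _
    rw [ih]
    rfl

theorem compList_map_range (n : ℕ) (C : ℕ → AncCircuit) (M : ℕ) :
    compList n ((List.range M).map C) = seqComp (fun j => (C j).chan n) M := by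
  induction M with
  | zero => rfl
  | succ M ih =>
    rw [List.range_succ, List.map_append, compList_append, ih]
    rfl

theorem compList_isTP (n : ℕ) (L : List AncCircuit) : IsTP (compList n L) := by
  induction L with
  | nil => exact IsTP.id
  | cons C L ih => exact ih.comp (C.chan_isTP n)

/-- Total number of ancillas. -/
def ancTotal (L : List AncCircuit) : ℕ := (L.flatMap fun C => List.range C.anc).length

theorem anc_le_ancTotal {L : List AncCircuit} {C : AncCircuit} (h : C ∈ L) :
    C.anc ≤ ancTotal L := by
  simp only [ancTotal, List.length_flatMap, List.length_range]
  exact List.single_le_sum (by simp) _ (List.mem_map_of_mem h)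

/-- The circuits of the list one after the other, on the same `b` ancillas, which are reset after
each of them. -/
def chainGates (n b : ℕ) (L : List AncCircuit) : Circuit :=
  L.flatMap fun C => padGates n C.anc b C.gates ++ (List.range b).map fun i => Gate.reset (n + i)

/-- The circuits of the list and then `D`. -/
def chain (n : ℕ) (L : List AncCircuit) (D : AncCircuit) : AncCircuit :=
  ⟨ancTotal L + D.anc, chainGates n (ancTotal L + D.anc) L ++
    padGates n D.anc (ancTotal L + D.anc) D.gates⟩

theorem circOp_chainGates (n b : ℕ) (L : List AncCircuit) (hL : ∀ C ∈ L, C.anc ≤ b)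
    (ρ : Matrix (Q n) (Q n) ℂ) :
    circOp n b (chainGates n b L) (ρ ⊗ₖ zeros b) = compList n L ρ ⊗ₖ zeros b := by
  induction L generalizing ρ with
  | nil => exact relabel_symm_relabel (Fin.appendEquiv n b) (ρ ⊗ₖ zeros b)
  | cons C L ih =>
    have h : chainGates n b (C :: L) = (padGates n C.anc b C.gates ++
      (List.range b).map fun i => Gate.reset (n + i)) ++ chainGates n b L := rfl
    rw [h, circOp_append, circOp_append]
    have h' := sem_map_reset n b (circOp n b (padGates n C.anc b C.gates) (ρ ⊗ₖ zeros b))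
    rw [traceRight_padGates n (hL C (by simp))] at h'
    exact (congrArg (circOp n b (chainGates n b L)) h').trans
      (ih (fun D hD => hL D (by simp [hD])) _)

theorem circOp_chain (n : ℕ) (L : List AncCircuit) (D : AncCircuit) (ρ : Matrix (Q n) (Q n) ℂ) :
    circOp n (chain n L D).anc (chain n L D).gates (ρ ⊗ₖ zeros (chain n L D).anc) =
      circOp n (ancTotal L + D.anc) (padGates n D.anc (ancTotal L + D.anc) D.gates)
        (compList n L ρ ⊗ₖ zeros (ancTotal L + D.anc)) := by
  rw [← circOp_chainGates n (ancTotal L + D.anc) L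
    (fun C hC => (anc_le_ancTotal hC).trans (Nat.le_add_right _ _)), ← LinearMap.comp_apply,
    ← circOp_append]
  rfl

theorem chan_chain (n : ℕ) (L : List AncCircuit) (D : AncCircuit) :
    (chain n L D).chan n = D.chan n ∘ₗ compList n L := by
  ext1 ρ
  rw [AncCircuit.chan_eq, circOp_chain]
  exact traceRight_padGates n (Nat.le_add_left _ _) D.gates _

theorem acceptProb_chain (n : ℕ) (L : List AncCircuit) (D : AncCircuit)
    (ρ : Matrix (Q n) (Q n) ℂ) :
    (chain n L D).acceptProb n ρ = D.acceptProb n (compList n L ρ) := by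
  classical
  rw [← acceptProb_padGates n (Nat.le_add_left D.anc (ancTotal L)) D.gates, AncCircuit.acceptProb_eq,
    AncCircuit.acceptProb_eq, circOp_chain]
  rfl

/-! ### Additional wires -/

/-- The circuit on `n` wires, on the first `n` of `n + k` wires. -/
def AncCircuit.widen (C : AncCircuit) (n k : ℕ) : AncCircuit :=
  ⟨C.anc, C.gates.map (Gate.map (shiftFrom n k))⟩

/-- The first `n` wires and the ancillas. -/
def widenLens (n k a : ℕ) : Lens (Q (n + k) × Q a) (Q n × Q a) where
  get p := (fun i => p.1 (Fin.castAdd k i), p.2)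
  put p q := (Fin.append q.1 fun i => p.1 (Fin.natAdd n i), q.2)
  get_put p q := by simp
  put_get p := Prod.ext Fin.append_castAdd_natAdd rfl
  put_put p q q' := by simp

theorem circOp_widen (n k a : ℕ) (c : Circuit) :
    circOp (n + k) a (c.map (Gate.map (shiftFrom n k))) = (widenLens n k a).lift (circOp n a c) := by
  have hlt : ∀ i < n + a, shiftFrom n k i < n + k + a := by
    intro i hi
    simp only [shiftFrom]
    split_ifs <;> omega
  refine sem_map_lens (widenLens n k a) (shiftFrom_injective _ _) hlt (fun i hi => ?_)
    (fun f i => ?_) (fun f g i hi => ?_) c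
  · rw [shiftFrom_of_le (by omega)]
    omega
  · refine Fin.addCases (fun i => ?_) (fun i => ?_) i
    · have h : (⟨shiftFrom n k (Fin.castAdd a i), hlt _ (Fin.castAdd a i).2⟩ : Fin (n + k + a)) =
          Fin.castAdd a (Fin.castAdd k i) := Fin.ext (shiftFrom_of_lt i.2)
      rw [h]
      simp [widenLens, Fin.appendEquiv]
    · have h : (⟨shiftFrom n k (Fin.natAdd n i), hlt _ (Fin.natAdd n i).2⟩ : Fin (n + k + a)) =
          Fin.natAdd (n + k) i := Fin.ext ((shiftFrom_of_le (by simp)).trans (by simp; omega))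
      rw [h]
      simp [widenLens, Fin.appendEquiv]
  · revert hi
    refine Fin.addCases (fun i => ?_) (fun i => ?_) i
    · refine Fin.addCases (fun i => ?_) (fun i => ?_) i
      · intro hi
        exact absurd (shiftFrom_of_lt i.2) (hi i (by omega))
      · intro _
        simp [widenLens, Fin.appendEquiv]
    · intro hi
      exact absurd ((shiftFrom_of_le (by omega)).trans (by simp; omega)) (hi (n + i) (by omega))

/-- The shift moves the ancillas behind the `k` new wires, which therefore stay untouched. -/
theorem AncCircuit.chan_widen (C : AncCircuit) (n k : ℕ) :
    (C.widen n k).chan (n + k) ∘ₗ join n k = join n k ∘ₗ amplify (Q k) (C.chan n) := by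
  ext1 σ
  ext f g
  rw [LinearMap.comp_apply, AncCircuit.chan_eq, traceRight_apply]
  change ∑ h, circOp (n + k) C.anc (C.gates.map (Gate.map (shiftFrom n k)))
    (join n k σ ⊗ₖ zeros C.anc) (f, h) (g, h) = _
  rw [circOp_widen]
  change _ = traceRight (Q n) (Q C.anc) (circOp n C.anc C.gates
    ((Matrix.of fun a a' => σ (a, ((Fin.appendEquiv n k).symm f).2)
      (a', ((Fin.appendEquiv n k).symm g).2)) ⊗ₖ zeros C.anc))
        ((Fin.appendEquiv n k).symm f).1 ((Fin.appendEquiv n k).symm g).1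
  rw [traceRight_apply]
  refine Finset.sum_congr rfl fun h _ => ?_
  rw [Lens.lift_apply]
  have e : (Matrix.of fun p p' => (join n k σ ⊗ₖ zeros C.anc) ((widenLens n k C.anc).put (f, h) p)
      ((widenLens n k C.anc).put (g, h) p')) = (Matrix.of fun a a' =>
        σ (a, ((Fin.appendEquiv n k).symm f).2) (a', ((Fin.appendEquiv n k).symm g).2)) ⊗ₖ
          zeros C.anc := by
    ext p p'
    simp only [Matrix.of_apply, widenLens, Matrix.kronecker_apply, join_append]
    rfl
  rw [e]
  rfl

theorem compList_widen (n k : ℕ) (L : List AncCircuit) :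
    compList (n + k) (L.map fun C => C.widen n k) ∘ₗ join n k =
      join n k ∘ₗ amplify (Q k) (compList n L) := by
  induction L with
  | nil => rfl
  | cons C L ih =>
    change (compList (n + k) (L.map fun C => C.widen n k) ∘ₗ (C.widen n k).chan (n + k)) ∘ₗ _ =
      join n k ∘ₗ amplify (Q k) (compList n L) ∘ₗ amplify (Q k) (C.chan n)
    rw [LinearMap.comp_assoc, C.chan_widen, ← LinearMap.comp_assoc, ih, LinearMap.comp_assoc]

/-! ### Descriptions of circuits -/

namespace PolyTime

variable {γ : Type} [TreeData γ]

theorem shiftFrom {n k i : γ → ℕ} (hn : PolyTime n) (hk : PolyTime k) (hi : PolyTime i) :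
    PolyTime fun x => shiftFrom (n x) (k x) (i x) :=
  ite (lt hi hn) hi (add hi hk)

theorem padGates {n a b : γ → ℕ} {c : γ → Circuit} (hn : PolyTime n) (ha : PolyTime a)
    (hb : PolyTime b) (hc : PolyTime c) : PolyTime fun x => padGates (n x) (a x) (b x) (c x) :=
  circuit_map (φ := fun p : γ × ℕ => QZK.shiftFrom (n p.1 + a p.1) (b p.1) p.2)
    (shiftFrom ((hn.add ha).comp fst) (hb.comp fst) snd) hc

theorem ancTotal {L : γ → List AncCircuit} (hL : PolyTime L) : PolyTime fun x => ancTotal (L x) :=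
  length (flatMap (F := fun p : γ × AncCircuit => List.range p.2.anc) (range (anc snd)) hL)

theorem chainGates {n b : γ → ℕ} {L : γ → List AncCircuit} (hn : PolyTime n) (hb : PolyTime b)
    (hL : PolyTime L) : PolyTime fun x => chainGates (n x) (b x) (L x) :=
  flatMap (F := fun p : γ × AncCircuit => QZK.padGates (n p.1) p.2.anc (b p.1) p.2.gates ++
      (List.range (b p.1)).map fun i => Gate.reset (n p.1 + i))
    (append (padGates (hn.comp fst) (anc snd) (hb.comp fst) (gates snd))
      (map (F := fun p : (γ × AncCircuit) × ℕ => Gate.reset (n p.1.1 + p.2))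
        (gate_reset (add (hn.comp (fst.comp fst)) snd)) (range (hb.comp fst)))) hL

theorem chain {n : γ → ℕ} {L : γ → List AncCircuit} {D : γ → AncCircuit} (hn : PolyTime n)
    (hL : PolyTime L) (hD : PolyTime D) : PolyTime fun x => chain (n x) (L x) (D x) :=
  have hb := add (ancTotal hL) (anc hD)
  ancCircuit hb (append (chainGates hn hb hL) (padGates hn (anc hD) hb (gates hD)))

theorem widen {n k : γ → ℕ} {C : γ → AncCircuit} (hn : PolyTime n) (hk : PolyTime k)
    (hC : PolyTime C) : PolyTime fun x => (C x).widen (n x) (k x) :=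
  ancCircuit (anc hC) (circuit_map (φ := fun p : γ × ℕ => QZK.shiftFrom (n p.1) (k p.1) p.2)
    (shiftFrom (hn.comp fst) (hk.comp fst) snd) (gates hC))

end PolyTime

/-! ## Hybrid arguments -/

/-- Upper sets of reals are totally ordered by inclusion, so finitely many of them have a least one.
-/
theorem exists_forall_subset (U : ℕ → Set ℝ) (hU : ∀ j, IsUpperSet (U j)) (M : ℕ) :
    ∃ j₀, ∀ j < M, U j₀ ⊆ U j := by
  induction M with
  | zero => exact ⟨0, by simp⟩
  | succ M ih =>
    obtain ⟨j₀, h₀⟩ := ih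
    rcases (hU j₀).total (hU M) with h | h
    · refine ⟨j₀, fun j hj => ?_⟩
      rcases Nat.lt_succ_iff_lt_or_eq.1 hj with hj | rfl
      exacts [h₀ j hj, h]
    · refine ⟨M, fun j hj => ?_⟩
      rcases Nat.lt_succ_iff_lt_or_eq.1 hj with hj | rfl
      exacts [h.trans (h₀ j hj), subset_rfl]

/-- A bound that holds for every choice of an index on each instance holds for all indices. -/
theorem exists_negligible_forall {I : Type} (X : I → List Bool) (Good : I → ℕ → ℝ → Prop)
    (hmono : ∀ i j e e', e ≤ e' → Good i j e → Good i j e') (M : List Bool → ℕ)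
    (h : ∀ sel : List Bool → ℕ, ∃ ε : ℕ → ℝ, Negligible ε ∧
      ∀ i, Good i (sel (X i)) (ε (X i).length)) :
    ∃ ε : ℕ → ℝ, Negligible ε ∧ ∀ i, ∀ j < M (X i), Good i j (ε (X i).length) := by
  -- `sel x` is the worst run on `x`: any error admissible for it, for all indices `i` over `x`, is
  -- admissible for every run.
  choose sel hsel using fun x => exists_forall_subset
    (fun j => {e | ∀ i, X i = x → Good i j e})
    (fun j e e' hee he i hi => hmono i j e e' hee (he i hi)) (M x)
  obtain ⟨ε, hε, hgood⟩ := h sel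
  refine ⟨ε, hε, fun i j hj => hsel (X i) j hj ?_ i rfl⟩
  intro i' hi'
  rw [← hi']
  exact hgood i'

/-- Telescoping sum: hybrid `j` uses `a` in the first `j` steps and `b` afterwards. The comparison
in step `j` is only needed on the state that the `a`-steps produce. -/
theorem abs_sub_seqComp_le {α : Type} (a b : ℕ → SOp α α) (M : ℕ) (F : Matrix α α ℂ → ℝ) (e : ℝ)
    (ρ : Matrix α α ℂ)
    (h : ∀ j < M, |F (seqComp (fun l => b (j + 1 + l)) (M - 1 - j) (a j (seqComp a j ρ))) -
      F (seqComp (fun l => b (j + 1 + l)) (M - 1 - j) (b j (seqComp a j ρ)))| ≤ e) :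
    |F (seqComp a M ρ) - F (seqComp b M ρ)| ≤ M * e := by
  have key : ∀ j ≤ M, |F (seqComp (fun l => b (j + l)) (M - j) (seqComp a j ρ)) -
      F (seqComp b M ρ)| ≤ j * e := by
    intro j
    induction j with
    | zero =>
      intro _
      simp [seqComp]
    | succ j ih =>
      intro hj
      have h1 := ih (by omega)
      have h2 := h j (by omega)
      have e1 : M - (j + 1) = M - 1 - j := by omega
      have e2 : seqComp (fun l => b (j + l)) (M - j) (seqComp a j ρ) =
          seqComp (fun l => b (j + 1 + l)) (M - 1 - j) (b j (seqComp a j ρ)) := by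
        have : M - j = M - 1 - j + 1 := by omega
        rw [this, seqComp_succ']
        simp only [LinearMap.comp_apply, add_zero, add_assoc, add_comm 1]
      rw [e2] at h1
      rw [e1]
      push_cast
      calc _ ≤ _ := abs_sub_le _ (F (seqComp (fun l => b (j + 1 + l)) (M - 1 - j)
              (b j (seqComp a j ρ)))) _
        _ ≤ (j + 1) * e := by
          rw [add_mul, one_mul, add_comm]
          exact add_le_add h1 h2
  have := key M le_rfl
  rwa [Nat.sub_self] at this

/-! ## Computational zero-knowledge -/

/-- The malicious verifier after `j` moves. -/
abbrev MalVerifier.drop (W : MalVerifier) (j : ℕ) : MalVerifier := ⟨W.priv, W.circs.drop j⟩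

theorem MalVerifier.dataSize_drop_le (W : MalVerifier) (j : ℕ) :
    dataSize (W.drop j) ≤ dataSize W := by
  have := QZK.dataSize_drop_le W.circs j
  change 1 + dataSize W.priv + dataSize (W.circs.drop j) ≤ 1 + dataSize W.priv + dataSize W.circs
  omega

theorem PolyTime.mal_drop {γ : Type} [TreeData γ] {W : γ → MalVerifier} {j : γ → ℕ}
    (hW : PolyTime W) (hj : PolyTime j) : PolyTime fun x => (W x).drop (j x) :=
  malVerifier (priv hW) (drop (mal_circs hW) hj)

theorem moves_drop (n m : ℕ) (l : List Circuit) (s t : ℕ) :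
    moves n m (l.drop s) t = moves n m l (s + t) := by
  simp [moves, List.getD_eq_getElem?_getD]

theorem Protocol.outV_eq (prot : Protocol) (x : List Bool) {n : ℕ} (w : Matrix (Q n) (Q n) ℂ)
    (W : MalVerifier) : prot.outV x w W =
      prot.accept x w (fun _ => True) (moves W.priv (prot.msg x) W.circs) := rfl

theorem Protocol.outV_isCP (prot : Protocol) (x : List Bool) {n : ℕ} {w : Matrix (Q n) (Q n) ℂ}
    (hw : IsState w) (W : MalVerifier) : IsCP (prot.outV x w W) :=
  prot.accept_isCP x hw _ (moves_isCP _ _ _)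

theorem Protocol.outV_isTP (prot : Protocol) (x : List Bool) {n : ℕ} {w : Matrix (Q n) (Q n) ℂ}
    (hw : IsState w) (W : MalVerifier) : IsTP (prot.outV x w W) :=
  prot.accept_true_isTP x hw (moves_isTP _ _ _)

/-- In run `j` a malicious verifier behaves like one for the single protocol whose earlier moves are
deleted and whose input is what the previous runs left. -/
theorem Protocol.outV_seqRep (prot : Protocol) (V : QMAVerifier) (N : Polynomial ℕ)
    (x : List Bool) (w : Matrix (Q (V.witQubits x)) (Q (V.witQubits x)) ℂ) (W : MalVerifier) :
    (prot.seqRep V N).outV x w W =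
      seqComp (fun j => prot.outV x w (W.drop (j * prot.rounds x))) (N.eval x.length) := by
  refine (prot.accept_seqRep_true V N x w (moves W.priv (prot.msg x) W.circs)).trans
    (seqComp_congr _ fun j _ => ?_)
  rw [outV_eq]
  congr 1
  funext t
  exact (moves_drop _ _ _ _ _).symm

theorem dataSize_instance_le (x : List Bool) : dataSize x ≤ 1 + x.length * 4 := by
  refine dataSize_le_of_forall x 3 fun b _ => ?_
  cases b
  · exact (by decide : 1 ≤ 3)
  · exact le_rfl

theorem chan_nil (n : ℕ) : AncCircuit.chan ⟨0, []⟩ n = LinearMap.id := by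
  ext1 ρ
  ext i j
  rw [AncCircuit.chan_eq, traceRight_apply]
  have h : circOp n 0 [] (ρ ⊗ₖ zeros 0) = ρ ⊗ₖ zeros 0 :=
    relabel_symm_relabel (Fin.appendEquiv n 0) (ρ ⊗ₖ zeros 0)
  simp only [h, Matrix.kronecker_apply, ← Finset.mul_sum, sum_zeros_diag, mul_one]
  rfl

section simulator

variable (prot : Protocol) (S : List Bool × MalVerifier → AncCircuit)

/-- The simulators of the runs number `s, …, s + M - 1`. -/
def simulators (x : List Bool) (W : MalVerifier) (s M : ℕ) : List AncCircuit :=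
  (List.range M).map fun j => S (x, W.drop ((s + j) * prot.rounds x))

theorem PolyTime.simulators {γ : Type} [TreeData γ] (hr : PolyTime prot.rounds) (hS : PolyTime S)
    {x : γ → List Bool} {W : γ → MalVerifier} {s M : γ → ℕ} (hx : PolyTime x) (hW : PolyTime W)
    (hs : PolyTime s) (hM : PolyTime M) :
    PolyTime fun y => simulators prot S (x y) (W y) (s y) (M y) :=
  map (F := fun p : γ × ℕ => S (x p.1, (W p.1).drop ((s p.1 + p.2) * prot.rounds (x p.1))))
    (hS.comp (prod (hx.comp fst) (mal_drop (hW.comp fst)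
      (mul (add (hs.comp fst) snd) (hr.comp (hx.comp fst)))))) (range hM)

theorem compList_simulators (x : List Bool) (W : MalVerifier) (s M n : ℕ) :
    compList n (simulators prot S x W s M) =
      seqComp (fun j => (S (x, W.drop ((s + j) * prot.rounds x))).chan n) M :=
  compList_map_range n _ M

/-- The distinguisher that first simulates the runs number `s, …, s + M - 1`. -/
def simulateThen (x : List Bool) (W : MalVerifier) (s M k : ℕ) (D : AncCircuit) : AncCircuit :=
  chain (W.priv + k) ((simulators prot S x W s M).map fun C => C.widen W.priv k) D

theorem acceptProb_simulateThen (x : List Bool) (W : MalVerifier) (s M k : ℕ) (D : AncCircuit)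
    (τ : Matrix (Q W.priv × Q k) (Q W.priv × Q k) ℂ) :
    (simulateThen prot S x W s M k D).acceptProb (W.priv + k) (join W.priv k τ) =
      D.acceptProb (W.priv + k) (join W.priv k (seqComp (fun j => amplify (Q k)
        ((S (x, W.drop ((s + j) * prot.rounds x))).chan W.priv)) M τ)) := by
  rw [simulateThen, acceptProb_chain, ← amplify_seqComp, ← compList_simulators,
    ← LinearMap.comp_apply, compList_widen]
  rfl

/-- Outputs of polynomial-time functions have polynomial size. So prefixing a distinguisher with all
remaining simulations keeps it admissible. -/
theorem dataSize_simulateThen (hr : PolyTime prot.rounds) (hS : PolyTime S) :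
    ∃ p : Polynomial ℕ, ∀ x W s M k D, dataSize (simulateThen prot S x W s M k D) ≤
      p.eval (dataSize (x, W, s, M, k, D)) := by
  have h : PolyTime fun y : List Bool × MalVerifier × ℕ × ℕ × ℕ × AncCircuit =>
      simulateThen prot S y.1 y.2.1 y.2.2.1 y.2.2.2.1 y.2.2.2.2.1 y.2.2.2.2.2 := by
    have h1 : PolyTime fun y : List Bool × MalVerifier × ℕ × ℕ × ℕ × AncCircuit => y.2.1 :=
      .fst' .snd
    have h2 : PolyTime fun y : List Bool × MalVerifier × ℕ × ℕ × ℕ × AncCircuit => y.2.2 :=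
      .snd' .snd
    have h3 : PolyTime fun y : List Bool × MalVerifier × ℕ × ℕ × ℕ × AncCircuit => y.2.2.2.2.1 :=
      h2.snd'.snd'.fst'
    refine .chain (h1.priv.add h3) ?_ h2.snd'.snd'.snd'
    refine .map (F := fun p : (List Bool × MalVerifier × ℕ × ℕ × ℕ × AncCircuit) × AncCircuit =>
      p.2.widen p.1.2.1.priv p.1.2.2.2.2.1) ?_ ?_
    · exact .widen (h1.comp .fst).priv (h3.comp .fst) .snd
    · exact .simulators prot S hr hS .fst h1 h2.fst' h2.snd'.fst'
  obtain ⟨p, hp⟩ := h.polyBdd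
  exact ⟨p, fun x W s M k D => hp (x, W, s, M, k, D)⟩

end simulator

theorem PolySize.drop {W : List Bool → MalVerifier} (h : PolySize W) (s : List Bool → ℕ) :
    PolySize fun x => (W x).drop (s x) := by
  obtain ⟨b, hb⟩ := h
  exact ⟨b, fun x => ((W x).dataSize_drop_le _).trans (hb x)⟩

/-- Hybrid argument with real runs first. The non-uniform form of indistinguishability matters
twice: the real runs may prepare any state, and the worst run may depend arbitrarily on the
instance. -/
theorem Protocol.CompZK.seqRep {A : PromiseProblem} {V : QMAVerifier} {prot : Protocol}
    (h : prot.CompZK A V) (hq : prot.IsQPT) (N : Polynomial ℕ) :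
    (prot.seqRep V N).CompZK A V := by
  obtain ⟨S, hS, hsim⟩ := h
  have hr := hq.2.1
  -- `chain` expects a final circuit; the empty one adds nothing.
  refine ⟨fun y => chain y.2.priv (simulators prot S y.1 y.2 0 (N.eval y.1.length)) ⟨0, []⟩,
    .chain (PolyTime.snd.priv) (.simulators prot S hr hS .fst .snd (.const 0)
      (.polyEval (.length .fst) N)) (.const _), fun W hW s => ?_⟩
  obtain ⟨p, hp⟩ := dataSize_simulateThen prot S hr hS
  obtain ⟨bW, hbW⟩ := hW
  -- Bounds the data from which the extended distinguisher is computed: a bit of the instance takes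
  -- at most 4 nodes, a number `n` takes `2 * n + 1`, and the constant 20 leaves room for the
  -- pairing.
  let size : Polynomial ℕ := Polynomial.C 20 + Polynomial.C 4 * Polynomial.X + bW +
    Polynomial.C 4 * N + Polynomial.C 3 * s
  obtain ⟨ε, hε, hgood⟩ := exists_negligible_forall (fun i : WitnessedYes A V => i.x)
    (fun i j e => ∀ (k : ℕ) (σ : Matrix (Q (W i.x).priv × Q k) (Q (W i.x).priv × Q k) ℂ)
      (D : AncCircuit), k ≤ (s + p.comp size).eval i.x.length → IsState σ →
      dataSize D ≤ (s + p.comp size).eval i.x.length →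
      |D.acceptProb ((W i.x).priv + k) (join (W i.x).priv k (amplify (Q k)
          (prot.outV i.x i.w ((W i.x).drop (j * prot.rounds i.x))) σ)) -
        D.acceptProb ((W i.x).priv + k) (join (W i.x).priv k (amplify (Q k)
          ((S (i.x, (W i.x).drop (j * prot.rounds i.x))).chan (W i.x).priv) σ))| ≤ e)
    (fun i j e e' hee hG k σ D hk hσ hD => (hG k σ D hk hσ hD).trans hee)
    (fun x => N.eval x.length) fun sel =>
      hsim _ (PolySize.drop ⟨bW, hbW⟩ fun x => sel x * prot.rounds x) (s + p.comp size)
  refine ⟨_, hε.poly_mul N, fun i k (σ : Matrix (Q (W i.x).priv × Q k)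
    (Q (W i.x).priv × Q k) ℂ) D hk hσ hD => ?_⟩
  dsimp only at hk hD ⊢
  rw [prot.outV_seqRep, chan_chain, chan_nil, LinearMap.id_comp, compList_simulators,
    amplify_seqComp, amplify_seqComp]
  refine abs_sub_seqComp_le _ _ _ (fun τ => D.acceptProb ((W i.x).priv + k)
    (join (W i.x).priv k τ)) _ σ fun j hj => ?_
  have hf : ∀ l, (0 : ℕ) + (j + 1 + l) = j + 1 + l := fun l => zero_add _
  simp only [hf, ← acceptProb_simulateThen]
  rw [zero_add]
  -- The state is the outcome of the first `j` real runs, and the distinguisher simulates the runs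
  -- after `j` before it applies `D`.
  refine (hgood i j hj k _ _ ?_ ?_ ?_).trans (le_max_left _ _)
  · rw [Polynomial.eval_add]
    omega
  · have hcp : ∀ l, IsCP (amplify (Q k)
        (prot.outV i.x i.w ((W i.x).drop (l * prot.rounds i.x)))) :=
      fun l => IsCP.amplify (prot.outV_isCP i.x i.state _)
    have htp : ∀ l, IsTP (amplify (Q k)
        (prot.outV i.x i.w ((W i.x).drop (l * prot.rounds i.x)))) :=
      fun l => IsTP.amplify (prot.outV_isTP i.x i.state _)
    exact IsState.map (IsCP.seqComp j fun l _ => hcp l) (IsTP.seqComp j fun l _ => htp l) hσ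
  · refine (hp _ _ _ _ _ _).trans ?_
    rw [Polynomial.eval_add, Polynomial.eval_comp]
    refine le_trans (polyEval_mono p ?_) (Nat.le_add_left _ _)
    have h1 := dataSize_instance_le i.x
    have h2 := hbW i.x
    simp only [dataSize_prod, dataSize_nat, size, Polynomial.eval_add, Polynomial.eval_mul,
      Polynomial.eval_C, Polynomial.eval_X]
    omega

/-! ## Classical gates with one more wire -/

section withBit

variable {n : ℕ}

/-- The bit string `x` followed by the bit `b`. -/
def withBit (x : Q n) (b : Bool) : Q (n + 1) := Fin.append x fun _ : Fin 1 => b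

theorem withBit_of_lt (x : Q n) (b : Bool) {i : ℕ} (hi : i < n + 1) (hi' : i < n) :
    withBit x b ⟨i, hi⟩ = x ⟨i, hi'⟩ := Fin.append_left x _ ⟨i, hi'⟩

theorem withBit_last (x : Q n) (b : Bool) (hn : n < n + 1) : withBit x b ⟨n, hn⟩ = b :=
  Fin.append_right x (fun _ : Fin 1 => b) 0

theorem update_withBit_of_lt (x : Q n) (b c : Bool) {i : ℕ} (hi : i < n + 1) (hi' : i < n) :
    Function.update (withBit x b) ⟨i, hi⟩ c = withBit (Function.update x ⟨i, hi'⟩ c) b := by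
  funext ⟨j, hj⟩
  rcases Nat.lt_succ_iff_lt_or_eq.1 hj with hj' | rfl
  · rw [withBit_of_lt _ _ hj hj', Function.update_apply, Function.update_apply,
      withBit_of_lt _ _ hj hj']
    simp only [Fin.mk.injEq]
  · rw [withBit_last, Function.update_of_ne (by simp; omega), withBit_last]

theorem update_withBit_last (x : Q n) (b c : Bool) (hn : n < n + 1) :
    Function.update (withBit x b) ⟨n, hn⟩ c = withBit x c := by
  funext ⟨j, hj⟩
  rcases Nat.lt_succ_iff_lt_or_eq.1 hj with hj' | rfl
  · rw [withBit_of_lt _ _ hj hj', Function.update_of_ne (by simp; omega), withBit_of_lt _ _ hj hj']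
  · rw [withBit_last, Function.update_self]

theorem withBit_surj (f : Q (n + 1)) : ∃ x b, f = withBit x b := by
  obtain ⟨⟨x, h⟩, rfl⟩ := (Fin.appendEquiv n 1).surjective f
  exact ⟨x, h 0, congrArg (Fin.append x) (funext fun i => by rw [Subsingleton.elim i 0])⟩

theorem sum_withBit {M : Type} [AddCommMonoid M] (F : Q (n + 1) → M) :
    ∑ f, F f = ∑ x : Q n, ∑ b : Bool, F (withBit x b) := by
  rw [sum_append]
  refine Finset.sum_congr rfl fun x _ => ?_
  exact (Equiv.funUnique (Fin 1) Bool).symm.sum_comp (fun h => F (Fin.append x h)) |>.symm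

theorem kronecker_zeros_withBit (ρ : Matrix (Q n) (Q n) ℂ) (x y : Q n) (b c : Bool) :
    join n 1 (ρ ⊗ₖ zeros 1) (withBit x b) (withBit y c) =
      if b = false ∧ c = false then ρ x y else 0 := by
  rw [withBit, withBit, join_append, Matrix.kronecker_apply, zeros_apply]
  simp

theorem kronecker_ketbra_true_withBit (ρ : Matrix (Q n) (Q n) ℂ) (x y : Q n) (b c : Bool) :
    join n 1 (ρ ⊗ₖ ketbra fun _ : Fin 1 => true) (withBit x b) (withBit y c) =
      if b = true ∧ c = true then ρ x y else 0 := by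
  rw [withBit, withBit, join_append, Matrix.kronecker_apply, ketbra, Matrix.single_apply]
  have : ∀ b : Bool, ((fun _ : Fin 1 => true) = fun _ => b) ↔ b = true := fun b =>
    ⟨fun h => (congrFun h 0).symm, fun h => by rw [h]⟩
  simp [this]

theorem zeros_withBit (x y : Q n) (b c : Bool) : zeros (n + 1) (withBit x b) (withBit y c) =
    if b = false ∧ c = false then zeros n x y else 0 := by
  rw [withBit, withBit, zeros_append, zeros_apply (n := 1)]
  simp

theorem chan_one_anc (c : Circuit) (ρ : Matrix (Q n) (Q n) ℂ) (x y : Q n) :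
    AncCircuit.chan ⟨1, c⟩ n ρ x y = ∑ b : Bool,
      Circuit.sem (n + 1) c (join n 1 (ρ ⊗ₖ zeros 1)) (withBit x b) (withBit y b) := by
  rw [AncCircuit.chan_eq, traceRight_apply]
  exact (Equiv.funUnique (Fin 1) Bool).symm.sum_comp (fun h =>
    circOp n 1 c (ρ ⊗ₖ zeros 1) (x, h) (y, h)) |>.symm

/-- The part of the operator on which the last wire is `b`. -/
def block (n : ℕ) (b : Bool) : SOp (Q (n + 1)) (Q n) where
  toFun ρ := Matrix.of fun x y => ρ (withBit x b) (withBit y b)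
  map_add' _ _ := rfl
  map_smul' _ _ := rfl

theorem block_apply (b : Bool) (ρ : Matrix (Q (n + 1)) (Q (n + 1)) ℂ) (x y : Q n) :
    block n b ρ x y = ρ (withBit x b) (withBit y b) := rfl

theorem block_isCP (b : Bool) : IsCP (block n b) := by
  have : block n b = conj (Matrix.of fun x f => if f = withBit x b then 1 else 0) := by
    ext1 ρ
    ext x y
    rw [conj_apply_apply]
    simp [apply_ite, block_apply]
  rw [this]
  exact IsCP.conj _

theorem trace_block (ρ : Matrix (Q (n + 1)) (Q (n + 1)) ℂ) :
    (block n true ρ).trace + (block n false ρ).trace = ρ.trace := by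
  simp only [Matrix.trace, Matrix.diag_apply, block_apply]
  rw [sum_withBit, ← Finset.sum_add_distrib]
  simp

end withBit

/-! ## Flags -/

/-- With main wires `0, …, m - 1` and the fail flag `m`: record in the fail flag that the wire `f`
is `0`, and turn `f` into `0` if the fail flag is `0`. -/
def collectFlag (m f : ℕ) : AncCircuit :=
  ⟨1, [.x f, .toffoli f m (m + 1), .cnot f m, .cnot (m + 1) m]⟩

/-- Erase the wire `i` if the fail flag is `1`. -/
def eraseIf (m i : ℕ) : AncCircuit :=
  ⟨1, [.toffoli m i (m + 1), .toffoli m (m + 1) i]⟩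

/-- Set the wire `f` to `1` if the fail flag is `0`. -/
def setFlag (m f : ℕ) : AncCircuit :=
  ⟨1, [.x f, .cnot m f]⟩

section flags

variable {m : ℕ} (ρ : Matrix (Q (m + 1)) (Q (m + 1)) ℂ) (x y : Q m)

/-- The ancilla holds the product of the two bits, and a ⊕ b ⊕ ab is their disjunction. Only the
branch without failure is described, since the other one will be erased. -/
theorem chan_collectFlag {f : ℕ} (hf : f < m) :
    (collectFlag m f).chan (m + 1) ρ (withBit x false) (withBit y false) =
      if x ⟨f, hf⟩ = false ∧ y ⟨f, hf⟩ = false then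
        ρ (withBit (Function.update x ⟨f, hf⟩ true) false)
          (withBit (Function.update y ⟨f, hf⟩ true) false) else 0 := by
  rw [collectFlag, chan_one_anc]
  have h1 : m < m + 1 + 1 := by omega
  have h2 : f < m + 1 + 1 := by omega
  have h3 : m + 1 < m + 1 + 1 := by omega
  simp only [Circuit.sem, LinearMap.comp_apply, LinearMap.id_apply]
  simp only [sem_cnot_apply h3 h1 (by omega), sem_cnot_apply h2 h1 (by omega),
    sem_toffoli_apply h2 h1 h3 (by omega) (by omega) (by omega), sem_x_apply h2,
    withBit_last, withBit_of_lt _ _ h1 (by omega : m < m + 1),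
    withBit_of_lt _ _ h2 (by omega : f < m + 1), update_withBit_last,
    update_withBit_of_lt _ _ _ h1 (by omega : m < m + 1),
    update_withBit_of_lt _ _ _ h2 (by omega : f < m + 1),
    withBit_of_lt _ _ (by omega : f < m + 1) hf,
    update_withBit_of_lt _ _ _ (by omega : f < m + 1) hf,
    Fintype.sum_bool, kronecker_zeros_withBit]
  cases hx : x ⟨f, hf⟩ <;> cases hy : y ⟨f, hf⟩ <;> simp

theorem chan_eraseIf_false {i : ℕ} (hi : i < m) :
    (eraseIf m i).chan (m + 1) ρ (withBit x false) (withBit y false) =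
      ρ (withBit x false) (withBit y false) := by
  rw [eraseIf, chan_one_anc]
  have h1 : m < m + 1 + 1 := by omega
  have h2 : i < m + 1 + 1 := by omega
  have h3 : m + 1 < m + 1 + 1 := by omega
  simp only [Circuit.sem, LinearMap.comp_apply, LinearMap.id_apply]
  simp only [sem_toffoli_apply h1 h3 h2 (by omega) (by omega) (by omega),
    sem_toffoli_apply h1 h2 h3 (by omega) (by omega) (by omega),
    withBit_last, withBit_of_lt _ _ h1 (by omega : m < m + 1),
    withBit_of_lt _ _ h2 (by omega : i < m + 1), update_withBit_last,
    update_withBit_of_lt _ _ _ h2 (by omega : i < m + 1),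
    withBit_of_lt _ _ (by omega : i < m + 1) hi,
    update_withBit_of_lt _ _ _ (by omega : i < m + 1) hi,
    Fintype.sum_bool, kronecker_zeros_withBit]
  simp

/-- The bit is copied to the ancilla and then cancelled against its copy; discarding the ancilla
sums over its old value. -/
theorem chan_eraseIf_true {i : ℕ} (hi : i < m) :
    (eraseIf m i).chan (m + 1) ρ (withBit x true) (withBit y true) =
      if x ⟨i, hi⟩ = false ∧ y ⟨i, hi⟩ = false then
        ∑ b, ρ (withBit (Function.update x ⟨i, hi⟩ b) true)
          (withBit (Function.update y ⟨i, hi⟩ b) true) else 0 := by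
  rw [eraseIf, chan_one_anc]
  have h1 : m < m + 1 + 1 := by omega
  have h2 : i < m + 1 + 1 := by omega
  have h3 : m + 1 < m + 1 + 1 := by omega
  simp only [Circuit.sem, LinearMap.comp_apply, LinearMap.id_apply]
  simp only [sem_toffoli_apply h1 h3 h2 (by omega) (by omega) (by omega),
    sem_toffoli_apply h1 h2 h3 (by omega) (by omega) (by omega),
    withBit_last, withBit_of_lt _ _ h1 (by omega : m < m + 1),
    withBit_of_lt _ _ h2 (by omega : i < m + 1), update_withBit_last,
    update_withBit_of_lt _ _ _ h2 (by omega : i < m + 1),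
    withBit_of_lt _ _ (by omega : i < m + 1) hi,
    update_withBit_of_lt _ _ _ (by omega : i < m + 1) hi, Function.update_self,
    Fintype.sum_bool, kronecker_zeros_withBit]
  cases hx : x ⟨i, hi⟩ <;> cases hy : y ⟨i, hi⟩ <;> simp

theorem chan_setFlag {f : ℕ} (hf : f < m) (b : Bool) :
    (setFlag m f).chan (m + 1) ρ (withBit x b) (withBit y b) =
      ρ (withBit (Function.update x ⟨f, hf⟩ (x ⟨f, hf⟩ ^^ !b)) b)
        (withBit (Function.update y ⟨f, hf⟩ (y ⟨f, hf⟩ ^^ !b)) b) := by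
  rw [setFlag, chan_one_anc]
  have h1 : m < m + 1 + 1 := by omega
  have h2 : f < m + 1 + 1 := by omega
  simp only [Circuit.sem, LinearMap.comp_apply, LinearMap.id_apply]
  simp only [sem_cnot_apply h1 h2 (by omega), sem_x_apply h2,
    withBit_last, withBit_of_lt _ _ h1 (by omega : m < m + 1),
    withBit_of_lt _ _ h2 (by omega : f < m + 1),
    update_withBit_of_lt _ _ _ h2 (by omega : f < m + 1),
    withBit_of_lt _ _ (by omega : f < m + 1) hf,
    update_withBit_of_lt _ _ _ (by omega : f < m + 1) hf, Function.update_self,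
    Function.update_idem, Fintype.sum_bool, kronecker_zeros_withBit]
  cases b <;> simp

end flags

/-! ### Erasing -/

section erase

variable {m : ℕ}

/-- Erase all the main wires if the fail flag is `1`. -/
def eraseAll (m : ℕ) : List AncCircuit := (List.range m).map (eraseIf m)

theorem block_false_eraseAll (ρ : Matrix (Q (m + 1)) (Q (m + 1)) ℂ) :
    block m false (compList (m + 1) (eraseAll m) ρ) = block m false ρ := by
  rw [eraseAll, compList_map_range]
  have key : ∀ k ≤ m, block m false (seqComp (fun i => (eraseIf m i).chan (m + 1)) k ρ) =
      block m false ρ := by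
    intro k
    induction k with
    | zero => intro _; rfl
    | succ k ih =>
      intro hk
      rw [← ih (by omega)]
      ext x y
      exact chan_eraseIf_false _ x y (by omega : k < m)
  exact key m le_rfl

theorem eq_trace_smul_zeros {σ : Matrix (Q m) (Q m) ℂ}
    (h : ∀ f g : Q m, (∃ i, f i = true ∨ g i = true) → σ f g = 0) : σ = σ.trace • zeros m := by
  have h1 : σ = σ (fun _ => false) (fun _ => false) • zeros m := by
    ext f g
    by_cases h' : ∃ i, f i = true ∨ g i = true
    · have h0 : zeros m f g = 0 := by
        rw [zeros_apply, if_neg]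
        rintro h2
        obtain ⟨i, hi⟩ := h'
        simp [h2 i] at hi
      rw [h f g h', Matrix.smul_apply, h0, smul_zero]
    · push Not at h'
      have hf : f = fun _ => false := funext fun i => by simpa using (h' i).1
      have hg : g = fun _ => false := funext fun i => by simpa using (h' i).2
      rw [hf, hg]
      simp [zeros, ketbra]
  have h2 := congrArg Matrix.trace h1
  rw [Matrix.trace_smul, (zeros_isState m).2, smul_eq_mul, mul_one] at h2
  rw [h2]
  exact h1

/-- As for `sem_reset_range`, only the all-zero entry survives. Its weight is the complement of that
of the other branch, because the total trace is preserved. -/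
theorem block_true_eraseAll (ρ : Matrix (Q (m + 1)) (Q (m + 1)) ℂ) :
    block m true (compList (m + 1) (eraseAll m) ρ) =
      (ρ.trace - (block m false ρ).trace) • zeros m := by
  have ht : (block m true (compList (m + 1) (eraseAll m) ρ)).trace =
      ρ.trace - (block m false ρ).trace := by
    have h := trace_block (compList (m + 1) (eraseAll m) ρ)
    rw [block_false_eraseAll, compList_isTP (m + 1) (eraseAll m) ρ] at h
    exact eq_sub_of_add_eq h
  rw [← ht]
  apply eq_trace_smul_zeros
  rw [eraseAll, compList_map_range]
  have key : ∀ k ≤ m, ∀ f g : Q m, (∃ i : Fin m, (i : ℕ) < k ∧ (f i = true ∨ g i = true)) →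
      block m true (seqComp (fun i => (eraseIf m i).chan (m + 1)) k ρ) f g = 0 := by
    intro k
    induction k with
    | zero => simp
    | succ k ih =>
      rintro hk f g ⟨i, hi, hfg⟩
      refine (chan_eraseIf_true _ f g (by omega : k < m)).trans ?_
      by_cases hik : (i : ℕ) = k
      · have : (⟨k, by omega⟩ : Fin m) = i := Fin.ext hik.symm
        rw [this, if_neg]
        rcases hfg with h | h <;> simp [h]
      · split_ifs
        · refine Finset.sum_eq_zero fun b _ => ih (by omega) _ _ ⟨i, by omega, ?_⟩
          have : i ≠ ⟨k, by omega⟩ := fun h => hik (by rw [h])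
          rwa [Function.update_of_ne this, Function.update_of_ne this]
        · rfl
  exact fun f g ⟨i, hi⟩ => key m le_rfl f g ⟨i, i.2, hi⟩

end erase

/-! ### Simulation of several runs -/

section simulate

variable {p : ℕ}

/-- Add a wire in state `|0⟩`. -/
noncomputable def addZero (n : ℕ) : SOp (Q n) (Q (n + 1)) := join n 1 ∘ₗ tensorRight (Q n) (zeros 1)

theorem addZero_withBit {n : ℕ} (ρ : Matrix (Q n) (Q n) ℂ) (x y : Q n) (b c : Bool) :
    addZero n ρ (withBit x b) (withBit y c) = if b = false ∧ c = false then ρ x y else 0 :=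
  kronecker_zeros_withBit ρ x y b c

theorem addZero_isCP (n : ℕ) : IsCP (addZero n) :=
  (IsCP.relabel _).comp (IsCP.tensorRight (zeros_isState 1).1)

theorem addZero_isTP (n : ℕ) : IsTP (addZero n) :=
  (IsTP.relabel _).comp (IsTP.tensorRight (zeros_isState 1).2)

theorem block_addZero (n : ℕ) : block n false ∘ₗ addZero n = LinearMap.id := by
  ext1 ρ
  ext x y
  exact (addZero_withBit ρ x y _ _).trans (if_pos ⟨rfl, rfl⟩)

/-- Keep the input with the flag `1`. -/
noncomputable def success (p : ℕ) : SOp (Q p) (Q (p + 1)) :=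
  join p 1 ∘ₗ tensorRight (Q p) (ketbra fun _ : Fin 1 => true)

theorem success_withBit (ρ : Matrix (Q p) (Q p) ℂ) (x y : Q p) (b c : Bool) :
    success p ρ (withBit x b) (withBit y c) = if b = true ∧ c = true then ρ x y else 0 :=
  kronecker_ketbra_true_withBit ρ x y b c

/-- Discard the input and output `|0…0⟩`. -/
noncomputable def failure (n p : ℕ) : SOp (Q n) (Q p) :=
  (Matrix.traceLinearMap (Q n) ℂ ℂ).smulRight (zeros p)

theorem failure_apply (n p : ℕ) (ρ : Matrix (Q n) (Q n) ℂ) :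
    failure n p ρ = ρ.trace • zeros p := rfl

/-- The channel that applies `a` and sets a flag; where `a` loses trace it fails. -/
noncomputable def flagged (a : SOp (Q p) (Q p)) : SOp (Q p) (Q (p + 1)) :=
  (success p - failure p (p + 1)) ∘ₗ a + failure p (p + 1)

theorem block_chan_widen (C : AncCircuit) (n : ℕ) :
    block n false ∘ₗ (C.widen n 1).chan (n + 1) = C.chan n ∘ₗ block n false := by
  ext1 ρ
  obtain ⟨σ, rfl⟩ : ∃ σ, ρ = join n 1 σ := ⟨split n 1 ρ, (relabel_relabel_symm _ _).symm⟩
  have h := LinearMap.congr_fun (C.chan_widen n 1) σ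
  simp only [LinearMap.comp_apply] at h ⊢
  rw [h]
  ext x y
  rw [block_apply, withBit, withBit, join_append]
  refine congrArg (fun τ => C.chan n τ x y) ?_
  ext a a'
  simp only [Matrix.of_apply, block_apply, withBit, join_append]

theorem block_chan_collectFlag (ρ : Matrix (Q (p + 1 + 1)) (Q (p + 1 + 1)) ℂ) :
    block (p + 1) false ((collectFlag (p + 1) p).chan (p + 1 + 1) ρ) =
      addZero p (block p true (block (p + 1) false ρ)) := by
  ext x y
  obtain ⟨x, b, rfl⟩ := withBit_surj x
  obtain ⟨y, c, rfl⟩ := withBit_surj y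
  rw [block_apply, chan_collectFlag _ _ _ (by omega : p < p + 1), addZero_withBit, withBit_last,
    withBit_last, update_withBit_last, update_withBit_last]
  rfl

/-- One simulated run: the successful part of what the simulator `C` outputs. -/
noncomputable def succeeding (p : ℕ) (C : AncCircuit) : SOp (Q p) (Q p) :=
  block p true ∘ₗ C.chan (p + 1) ∘ₗ addZero p

/-- The simulators `C 0, …, C (M - 1)` one after the other; only if all of them succeed the output is
kept. -/
def repeatSim (p M : ℕ) (C : ℕ → AncCircuit) : AncCircuit :=
  chain (p + 1 + 1) (((List.range M).flatMap fun j => [(C j).widen (p + 1) 1, collectFlag (p + 1) p])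
    ++ eraseAll (p + 1)) (setFlag (p + 1) p)

/-- As long as nothing has failed, `collectFlag` returns the success flag to 0, the value that the
next simulator expects on that wire. -/
theorem block_compList_flatMap (C : ℕ → AncCircuit) (M : ℕ)
    {ρ : Matrix (Q (p + 1 + 1)) (Q (p + 1 + 1)) ℂ} {σ : Matrix (Q p) (Q p) ℂ}
    (h : block (p + 1) false ρ = addZero p σ) :
    block (p + 1) false (compList (p + 1 + 1) ((List.range M).flatMap fun j =>
      [(C j).widen (p + 1) 1, collectFlag (p + 1) p]) ρ) =
        addZero p (seqComp (fun j => succeeding p (C j)) M σ) := by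
  induction M with
  | zero => exact h
  | succ M ih =>
    rw [List.range_succ, List.flatMap_append, compList_append]
    simp only [List.flatMap_cons, List.flatMap_nil, List.append_nil, LinearMap.comp_apply, compList,
      LinearMap.id_apply]
    rw [block_chan_collectFlag]
    have h' := LinearMap.congr_fun (block_chan_widen (C M) (p + 1)) (compList (p + 1 + 1)
      ((List.range M).flatMap fun j => [(C j).widen (p + 1) 1, collectFlag (p + 1) p]) ρ)
    simp only [LinearMap.comp_apply] at h'
    rw [h', ih]
    rfl

/-- Adding the two blocks discards the fail flag. The block without failure carries the successful
output and its flag is raised at the end; the other block is erased to zeros and carries all the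
remaining trace. -/
theorem chan_repeatSim (C : ℕ → AncCircuit) (M : ℕ) (ρ : Matrix (Q p) (Q p) ℂ) :
    block (p + 1) true ((repeatSim p M C).chan (p + 1 + 1) (addZero (p + 1) (addZero p ρ))) +
      block (p + 1) false ((repeatSim p M C).chan (p + 1 + 1) (addZero (p + 1) (addZero p ρ))) =
      flagged (seqComp (fun j => succeeding p (C j)) M) ρ := by
  rw [repeatSim, chan_chain, compList_append]
  simp only [LinearMap.comp_apply]
  set τ := compList (p + 1 + 1) ((List.range M).flatMap fun j =>
    [(C j).widen (p + 1) 1, collectFlag (p + 1) p]) (addZero (p + 1) (addZero p ρ)) with hτ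
  set σ := seqComp (fun j => succeeding p (C j)) M ρ with hσ
  have h0 : block (p + 1) false τ = addZero p σ :=
    block_compList_flatMap C M (LinearMap.congr_fun (block_addZero (p + 1)) (addZero p ρ))
  have ht : τ.trace = ρ.trace := by
    rw [hτ, compList_isTP, addZero_isTP, addZero_isTP]
  have h1 := block_true_eraseAll τ
  have h2 := block_false_eraseAll τ
  rw [h0, addZero_isTP, ht] at h1
  rw [h0] at h2
  ext x y
  obtain ⟨x, b, rfl⟩ := withBit_surj x
  obtain ⟨y, c, rfl⟩ := withBit_surj y
  simp only [Matrix.add_apply, block_apply, chan_setFlag _ _ _ (by omega : p < p + 1), withBit_last,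
    update_withBit_last]
  simp only [← block_apply, h1, h2]
  have hfl : flagged (seqComp (fun j => succeeding p (C j)) M) ρ =
      success p σ - σ.trace • zeros (p + 1) + ρ.trace • zeros (p + 1) := rfl
  rw [hfl]
  simp only [Matrix.add_apply, Matrix.sub_apply, Matrix.smul_apply, addZero_withBit,
    success_withBit, smul_eq_mul]
  cases b <;> cases c <;> simp <;> ring

end simulate

/-! ### Using a wire as an ancilla -/

/-- The circuit on `n + 1` wires as a circuit on `n` wires. -/
def AncCircuit.hide (C : AncCircuit) : AncCircuit := ⟨1 + C.anc, C.gates⟩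

/-- Equal numbers of wires. -/
def castWires {n m : ℕ} (h : n = m) : Q n ≃ Q m := (finCongr h).arrowCongr (Equiv.refl Bool)

theorem sem_castWires {n m : ℕ} (h : n = m) (c : Circuit) (ρ : Matrix (Q n) (Q n) ℂ) :
    Circuit.sem m c (relabel (castWires h) ρ) = relabel (castWires h) (Circuit.sem n c ρ) := by
  subst h
  rfl

theorem castWires_append {n a : ℕ} (x : Q n) (u : Q 1) (v : Q a)
    (h : n + 1 + a = n + (1 + a)) :
    castWires h (Fin.append (Fin.append x u) v) = Fin.append x (Fin.append u v) := by
  funext i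
  change Fin.append (Fin.append x u) v (Fin.cast h.symm i) = _
  rw [Fin.append_assoc]
  rfl

/-- Wire `n` simply counts as the first ancilla: it starts at 0 and is discarded, and no gate needs
renaming. The proof only reassociates the wires. -/
theorem AncCircuit.chan_hide (C : AncCircuit) (n : ℕ) (ρ : Matrix (Q n) (Q n) ℂ) :
    C.hide.chan n ρ = block n true (C.chan (n + 1) (addZero n ρ)) +
      block n false (C.chan (n + 1) (addZero n ρ)) := by
  have h : n + 1 + C.anc = n + (1 + C.anc) := by omega
  have hsymm : ∀ (x : Q n) (u : Q 1) (v : Q C.anc),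
      (castWires h).symm (Fin.append x (Fin.append u v)) = Fin.append (Fin.append x u) v :=
    fun x u v => by rw [Equiv.symm_apply_eq, castWires_append]
  have hin : join n (1 + C.anc) (ρ ⊗ₖ zeros (1 + C.anc)) =
      relabel (castWires h) (join (n + 1) C.anc (addZero n ρ ⊗ₖ zeros C.anc)) := by
    ext f g
    obtain ⟨⟨x, u⟩, rfl⟩ := (Fin.appendEquiv n (1 + C.anc)).surjective f
    obtain ⟨⟨y, v⟩, rfl⟩ := (Fin.appendEquiv n (1 + C.anc)).surjective g
    obtain ⟨⟨u, u'⟩, rfl⟩ := (Fin.appendEquiv 1 C.anc).surjective u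
    obtain ⟨⟨v, v'⟩, rfl⟩ := (Fin.appendEquiv 1 C.anc).surjective v
    change join n (1 + C.anc) (ρ ⊗ₖ zeros (1 + C.anc)) (Fin.append x (Fin.append u u'))
      (Fin.append y (Fin.append v v')) = join (n + 1) C.anc (addZero n ρ ⊗ₖ zeros C.anc)
        ((castWires h).symm (Fin.append x (Fin.append u u')))
        ((castWires h).symm (Fin.append y (Fin.append v v')))
    rw [hsymm, hsymm, join_append, join_append, Matrix.kronecker_apply, Matrix.kronecker_apply,
      zeros_append]
    change _ = join n 1 (ρ ⊗ₖ zeros 1) (Fin.append x u) (Fin.append y v) * _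
    rw [join_append, Matrix.kronecker_apply, mul_assoc]
  ext x y
  rw [AncCircuit.chan_eq, traceRight_apply]
  change ∑ w : Q (1 + C.anc), Circuit.sem (n + (1 + C.anc)) C.gates
    (join n (1 + C.anc) (ρ ⊗ₖ zeros (1 + C.anc))) (Fin.append x w) (Fin.append y w) = _
  rw [hin, sem_castWires, sum_append]
  change ∑ u : Q 1, ∑ v : Q C.anc, Circuit.sem (n + 1 + C.anc) C.gates
    (join (n + 1) C.anc (addZero n ρ ⊗ₖ zeros C.anc))
      ((castWires h).symm (Fin.append x (Fin.append u v)))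
      ((castWires h).symm (Fin.append y (Fin.append u v))) = _
  simp only [hsymm]
  rw [← (Equiv.funUnique (Fin 1) Bool).symm.sum_comp, Fintype.sum_bool]
  simp only [Matrix.add_apply, block_apply, AncCircuit.chan_eq, traceRight_apply]
  rfl

/-! ## Certified everlasting zero-knowledge -/

section flagged

variable {p : ℕ}

theorem success_isCP (p : ℕ) : IsCP (success p) :=
  (IsCP.relabel _).comp (IsCP.tensorRight (ketbra_isState _).1)

theorem success_isTP (p : ℕ) : IsTP (success p) :=
  (IsTP.relabel _).comp (IsTP.tensorRight (ketbra_isState _).2)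

theorem failure_isCP (n p : ℕ) : IsCP (failure n p) := IsCP.traceSMul (zeros_isState p).1

theorem failure_isTP (n p : ℕ) : IsTP (failure n p) := fun ρ => by
  rw [failure_apply, Matrix.trace_smul, (zeros_isState p).2, smul_eq_mul, mul_one]

theorem block_success (ρ : Matrix (Q p) (Q p) ℂ) : block p true (success p ρ) = ρ := by
  ext x y
  exact (success_withBit ρ x y _ _).trans (if_pos ⟨rfl, rfl⟩)

theorem block_failure (n : ℕ) (ρ : Matrix (Q n) (Q n) ℂ) :
    block p true (failure n (p + 1) ρ) = 0 := by
  ext x y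
  rw [failure_apply, block_apply, Matrix.smul_apply, zeros_withBit]
  simp

theorem flagged_apply (a : SOp (Q p) (Q p)) (ρ : Matrix (Q p) (Q p) ℂ) :
    flagged a ρ = success p (a ρ) - failure p (p + 1) (a ρ) + failure p (p + 1) ρ := rfl

theorem flagged_isTP (a : SOp (Q p) (Q p)) : IsTP (flagged a) := fun ρ => by
  rw [flagged_apply, Matrix.trace_add, Matrix.trace_sub, success_isTP, failure_isTP, failure_isTP,
    sub_self, zero_add]

theorem block_flagged (a : SOp (Q p) (Q p)) : block p true ∘ₗ flagged a = a := by
  ext1 ρ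
  rw [LinearMap.comp_apply, flagged_apply, map_add, map_sub, block_success, block_failure,
    block_failure, sub_zero, add_zero]

/-- After a run with a flag: continue with `X` if the flag is `1`, otherwise fail. -/
noncomputable def continueWith (X : SOp (Q p) (Q p)) : SOp (Q (p + 1)) (Q (p + 1)) :=
  (success p - failure p (p + 1)) ∘ₗ X ∘ₗ block p true + failure (p + 1) (p + 1)

/-- After a run with a flag: apply `Φ` if the flag is `1`, otherwise fail. -/
noncomputable def continueChan (Φ : SOp (Q p) (Q (p + 1))) : SOp (Q (p + 1)) (Q (p + 1)) :=
  Φ ∘ₗ block p true + failure p (p + 1) ∘ₗ block p false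

theorem failure_comp {a b : ℕ} {Φ : SOp (Q a) (Q b)} (h : IsTP Φ) (c : ℕ) :
    failure b c ∘ₗ Φ = failure a c := by
  ext1 ρ
  rw [LinearMap.comp_apply, failure_apply, h, failure_apply]

theorem continueChan_isCP {Φ : SOp (Q p) (Q (p + 1))} (h : IsCP Φ) : IsCP (continueChan Φ) :=
  (h.comp (block_isCP _)).add ((failure_isCP _ _).comp (block_isCP _))

theorem continueChan_isTP {Φ : SOp (Q p) (Q (p + 1))} (h : IsTP Φ) : IsTP (continueChan Φ) :=
  fun ρ => by
    change (Φ (block p true ρ) + failure p (p + 1) (block p false ρ)).trace = _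
    rw [Matrix.trace_add, h, failure_isTP, trace_block]

theorem continueWith_comp (X : SOp (Q p) (Q p)) {Φ : SOp (Q p) (Q (p + 1))} (h : IsTP Φ) :
    continueWith X ∘ₗ Φ = flagged (X ∘ₗ block p true ∘ₗ Φ) := by
  rw [continueWith, LinearMap.add_comp, failure_comp h]
  rfl

/-- A failure that has already occurred contributes nothing to the block with flag 1, which is all
that `X` sees. -/
theorem continueWith_comp_continueChan (X : SOp (Q p) (Q p)) {Φ : SOp (Q p) (Q (p + 1))}
    (h : IsTP Φ) :
    continueWith X ∘ₗ continueChan Φ = continueWith (X ∘ₗ block p true ∘ₗ Φ) := by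
  have hb : block p true ∘ₗ continueChan Φ = block p true ∘ₗ Φ ∘ₗ block p true := by
    ext1 ρ
    change block p true (Φ (block p true ρ) + failure p (p + 1) (block p false ρ)) = _
    rw [map_add, block_failure, add_zero]
    rfl
  rw [continueWith, LinearMap.add_comp, failure_comp (continueChan_isTP h), LinearMap.comp_assoc,
    LinearMap.comp_assoc, hb]
  rfl

theorem continueWith_id : continueWith (LinearMap.id : SOp (Q p) (Q p)) =
    continueChan (success p) := by
  ext1 ρ
  change success p (block p true ρ) - failure p (p + 1) (block p true ρ) +
    failure (p + 1) (p + 1) ρ = success p (block p true ρ) + failure p (p + 1) (block p false ρ)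
  rw [failure_apply, failure_apply, failure_apply, ← trace_block ρ, add_smul]
  abel

/-- Complete positivity is hidden by the minus sign in `continueWith`. It appears once the map is
factored into single continuations `continueChan`. -/
theorem continueWith_seqComp {Φ : ℕ → SOp (Q p) (Q (p + 1))} (hcp : ∀ j, IsCP (Φ j))
    (htp : ∀ j, IsTP (Φ j)) (n : ℕ) :
    IsCP (continueWith (seqComp (fun j => block p true ∘ₗ Φ j) n)) ∧
      IsTP (continueWith (seqComp (fun j => block p true ∘ₗ Φ j) n)) := by
  induction n generalizing Φ with
  | zero =>
    change IsCP (continueWith LinearMap.id) ∧ IsTP (continueWith LinearMap.id)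
    rw [continueWith_id]
    exact ⟨continueChan_isCP (success_isCP p), continueChan_isTP (success_isTP p)⟩
  | succ n ih =>
    rw [seqComp_succ', ← continueWith_comp_continueChan _ (htp 0)]
    obtain ⟨h1, h2⟩ := ih (fun j => hcp (j + 1)) fun j => htp (j + 1)
    exact ⟨h1.comp (continueChan_isCP (hcp 0)), h2.comp (continueChan_isTP (htp 0))⟩

/-- The complementary branch `a'` takes away a nonnegative part of the trace in every step. -/
theorem trace_seqComp_le {α : Type} [Fintype α] [DecidableEq α] {a a' : ℕ → SOp α α}
    (ha : ∀ j, IsCP (a j)) (ha' : ∀ j, IsCP (a' j)) (h : ∀ j, IsTP (a j + a' j)) (n : ℕ)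
    {σ : Matrix α α ℂ} (hσ : IsState σ) :
    (seqComp a n σ).PosSemidef ∧ (seqComp a n σ).trace.re ≤ 1 := by
  have hpos : ∀ n, (seqComp a n σ).PosSemidef := fun n =>
    (IsCP.seqComp n fun j _ => ha j).posSemidef hσ.1
  refine ⟨hpos n, ?_⟩
  induction n with
  | zero =>
    change σ.trace.re ≤ 1
    rw [hσ.2, Complex.one_re]
  | succ n ih =>
    refine le_trans ?_ ih
    have h1 := congrArg Complex.re (h n (seqComp a n σ))
    rw [LinearMap.add_apply, Matrix.trace_add, Complex.add_re] at h1
    have h2 := posSemidef_trace_re_nonneg ((ha' n).posSemidef (hpos n))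
    change (a n (seqComp a n σ)).trace.re ≤ _
    linarith

/-- The hybrid argument takes place on accepting branches, `a j` for a real run and `block p true ∘ₗ
Φ j` for a simulated one. The hypothesis concerns whole channels, so the simulated rest and the
measurement `E` have to be combined into one measurement on the output of run `j`. -/
theorem flagged_seqComp_close {k M : ℕ} {a a' : ℕ → SOp (Q p) (Q p)}
    {Φ : ℕ → SOp (Q p) (Q (p + 1))} (ha : ∀ j, IsCP (a j)) (ha' : ∀ j, IsCP (a' j))
    (haa : ∀ j, IsTP (a j + a' j)) (hcp : ∀ j, IsCP (Φ j)) (htp : ∀ j, IsTP (Φ j)) {e : ℝ}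
    (he : 0 ≤ e)
    (h : ∀ j < M, ∀ (σ : Matrix (Q p × Q k) (Q p × Q k) ℂ)
      (E : Matrix (Q (p + 1) × Q k) (Q (p + 1) × Q k) ℂ), IsState σ → E.PosSemidef →
      (1 - E).PosSemidef → |(E * amplify (Q k) (flagged (a j)) σ).trace.re -
        (E * amplify (Q k) (Φ j) σ).trace.re| ≤ e)
    {σ : Matrix (Q p × Q k) (Q p × Q k) ℂ} {E : Matrix (Q (p + 1) × Q k) (Q (p + 1) × Q k) ℂ}
    (hσ : IsState σ) (hE : E.PosSemidef) (hE' : (1 - E).PosSemidef) :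
    |(E * amplify (Q k) (flagged (seqComp a M)) σ).trace.re -
      (E * amplify (Q k) (flagged (seqComp (fun j => block p true ∘ₗ Φ j) M)) σ).trace.re| ≤
        M * e := by
  set s : ℕ → SOp (Q p) (Q p) := fun j => block p true ∘ₗ Φ j with hs
  set F : Matrix (Q p × Q k) (Q p × Q k) ℂ → ℝ := fun τ =>
    (E * amplify (Q k) (success p - failure p (p + 1)) τ).trace.re with hF
  set c : Matrix (Q p × Q k) (Q p × Q k) ℂ → ℝ := fun τ =>
    (E * amplify (Q k) (failure p (p + 1)) τ).trace.re with hc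
  -- `flagged` is affine in the branch, and its constant part `c` cancels in differences.
  have hfl : ∀ (A : SOp (Q p) (Q p)) τ, (E * amplify (Q k) (flagged A) τ).trace.re =
      F (amplify (Q k) A τ) + c τ := by
    intro A τ
    have h1 : amplify (Q k) (flagged A) τ = amplify (Q k) (success p - failure p (p + 1))
        (amplify (Q k) A τ) + amplify (Q k) (failure p (p + 1)) τ := rfl
    rw [h1, Matrix.mul_add, Matrix.trace_add, Complex.add_re]
  rw [hfl, hfl, add_sub_add_right_eq_sub, amplify_seqComp, amplify_seqComp]
  refine abs_sub_seqComp_le _ _ _ F e σ fun j hj => ?_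
  obtain ⟨hτ, hτ1⟩ := trace_seqComp_le (a := fun j => amplify (Q k) (a j))
    (a' := fun j => amplify (Q k) (a' j)) (fun j => (ha j).amplify) (fun j => (ha' j).amplify)
    (fun j => (haa j).amplify) j hσ
  set τ := seqComp (fun j => amplify (Q k) (a j)) j σ with hτdef
  set X : SOp (Q p) (Q p) := seqComp (fun l => s (j + 1 + l)) (M - 1 - j) with hX
  obtain ⟨hXcp, hXtp⟩ := continueWith_seqComp (Φ := fun l => Φ (j + 1 + l)) (fun l => hcp _)
    (fun l => htp _) (M - 1 - j)
  obtain ⟨G, hG, hG', hEG⟩ := exists_effect (hXcp.amplify (κ := Q k)) (hXtp.amplify (κ := Q k))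
    hE hE'
  have hX' : seqComp (fun l => amplify (Q k) (s (j + 1 + l))) (M - 1 - j) = amplify (Q k) X :=
    (amplify_seqComp _ _ _).symm
  -- `G` is `E` pulled back along `continueWith X`. Both neighbouring hybrids have this form, with
  -- `Ψ` the real or the simulated run, and the term `c τ` is the same.
  have hmove : ∀ {Ψ : SOp (Q p) (Q (p + 1))}, IsTP Ψ →
      F (amplify (Q k) X (amplify (Q k) (block p true ∘ₗ Ψ) τ)) =
        (G * amplify (Q k) Ψ τ).trace.re - c τ := by
    intro Ψ hΨ
    rw [← hEG, ← LinearMap.comp_apply, ← amplify_comp]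
    have := hfl (X ∘ₗ block p true ∘ₗ Ψ) τ
    rw [← continueWith_comp X hΨ] at this
    exact eq_sub_of_add_eq this.symm
  rw [hX', ← block_flagged (a j), hmove (flagged_isTP _), hmove (htp j), sub_sub_sub_cancel_right]
  -- The state after `j` accepted runs has trace at most 1, so rescaling it to a normalised state
  -- does not increase the bound.
  rcases eq_or_ne τ 0 with h0 | h0
  · simpa [h0] using he
  · obtain ⟨ω, hω, hτω, hpos⟩ := eq_smul_state hτ h0
    have hscale : ∀ Ψ : SOp (Q p) (Q (p + 1)), (G * amplify (Q k) Ψ τ).trace.re =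
        τ.trace.re * (G * amplify (Q k) Ψ ω).trace.re := by
      intro Ψ
      conv_lhs => rw [hτω]
      rw [map_smul, Matrix.mul_smul, Matrix.trace_smul, smul_eq_mul, Complex.re_ofReal_mul]
    rw [hscale, hscale, ← mul_sub, abs_mul, abs_of_pos hpos]
    calc τ.trace.re * _ ≤ 1 * e :=
          mul_le_mul hτ1 (h j hj ω G hω hG hG') (abs_nonneg _) zero_le_one
      _ = e := one_mul e

end flagged

theorem traceLeftOn_add_not {α β : Type} [Fintype α] (S : α → Prop) :
    (traceLeftOn S + traceLeftOn (fun a => ¬ S a) : SOp (α × β) β) = traceLeft α β := by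
  classical
  ext1 ρ
  ext b b'
  rw [traceLeft_apply, LinearMap.add_apply, Matrix.add_apply, traceLeftOn_apply, traceLeftOn_apply]
  convert Finset.sum_filter_add_sum_filter_not (Finset.univ : Finset α) S
    (fun a => ρ (a, b) (a, b')) using 2
  exact Finset.sum_congr (by congr) fun _ _ => rfl

theorem Protocol.accept_add_not (prot : Protocol) (x : List Bool) {n : ℕ}
    (w : Matrix (Q n) (Q n) ℂ) (S : Q (prot.privQubits x n) → Prop) {β : Type}
    (V : ℕ → SOp (β × Q (prot.msg x)) (β × Q (prot.msg x))) :
    prot.accept x w S V + prot.accept x w (fun f => ¬ S f) V = prot.accept x w (fun _ => True) V := by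
  have h := traceLeftOn_add_not (β := Q (prot.msg x) × β) S
  rw [Protocol.accept, Protocol.accept, Protocol.accept, ← LinearMap.comp_add, ← LinearMap.add_comp,
    h]
  rfl

/-- The rejecting branch enters only through its trace, which is that of the input minus that of the
accepting branch. So the accepting branch determines the whole output. -/
theorem Protocol.outPV_eq (prot : Protocol) (x : List Bool) {n : ℕ} {w : Matrix (Q n) (Q n) ℂ}
    (hw : IsState w) (W : MalVerifier) : prot.outPV x w W =
      flagged (prot.accept x w (AllOnes (prot.prover x).out)
        (moves W.priv (prot.msg x) W.circs)) := by
  ext1 ρ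
  set U := moves W.priv (prot.msg x) W.circs
  have hz : join W.priv 1 (zeros W.priv ⊗ₖ zeros 1) = zeros (W.priv + 1) := by
    ext f g
    obtain ⟨⟨x, u⟩, rfl⟩ := (Fin.appendEquiv W.priv 1).surjective f
    obtain ⟨⟨y, v⟩, rfl⟩ := (Fin.appendEquiv W.priv 1).surjective g
    exact (join_append _ _ _ _ _ _ _).trans (zeros_append _ _ _ _ _ _).symm
  have ht : (traceLeftOn (fun f => ¬ AllOnes (prot.prover x).out f)
      (prot.malExecute x w W ρ)).trace =
      ρ.trace - (prot.accept x w (AllOnes (prot.prover x).out) U ρ).trace := by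
    rw [eq_sub_iff_add_eq', ← prot.accept_true_isTP x hw (moves_isTP W.priv (prot.msg x) W.circs) ρ,
      ← prot.accept_add_not x w (AllOnes (prot.prover x).out), LinearMap.add_apply,
      Matrix.trace_add]
    congr 1
    exact (IsTP.traceLeft _).symm
  change join W.priv 1 (tensorRight (Q W.priv) (ketbra fun _ : Fin 1 => true)
    (prot.accept x w (AllOnes (prot.prover x).out) U ρ) +
    (traceLeftOn (fun f => ¬ AllOnes (prot.prover x).out f) (prot.malExecute x w W ρ)).trace •
      (zeros W.priv ⊗ₖ zeros 1)) = _
  rw [map_add, map_smul, hz, ht, flagged_apply, failure_apply, failure_apply, sub_smul]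
  change success W.priv _ + _ = _
  abel

theorem Protocol.outPV_seqRep (prot : Protocol) (V : QMAVerifier) (N : Polynomial ℕ)
    (x : List Bool) {w : Matrix (Q (V.witQubits x)) (Q (V.witQubits x)) ℂ} (hw : IsState w)
    (W : MalVerifier) : (prot.seqRep V N).outPV x w W =
      flagged (seqComp (fun j => prot.accept x w (AllOnes (prot.prover x).out)
        (moves W.priv (prot.msg x) (W.drop (j * prot.rounds x)).circs)) (N.eval x.length)) := by
  rw [Protocol.outPV_eq _ _ hw]
  congr 1
  refine (prot.accept_seqRep_out V N x w (moves W.priv (prot.msg x) W.circs)).trans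
    (seqComp_congr _ fun j _ => ?_)
  congr 1
  funext t
  exact (moves_drop _ _ _ _ _).symm

/-! ### Polynomial-time description of the certified everlasting simulator -/

namespace PolyTime

variable {γ : Type} [TreeData γ]

theorem collectFlag {m f : γ → ℕ} (hm : PolyTime m) (hf : PolyTime f) :
    PolyTime fun x => collectFlag (m x) (f x) :=
  ancCircuit (const 1) (cons (gate_x hf) (cons (gate_toffoli hf hm hm.succ)
    (cons (gate_cnot hf hm) (cons (gate_cnot hm.succ hm) (const [])))))

theorem eraseAll {m : γ → ℕ} (hm : PolyTime m) : PolyTime fun x => eraseAll (m x) :=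
  map (F := fun p : γ × ℕ => eraseIf (m p.1) p.2) (ancCircuit (const 1)
    (cons (gate_toffoli (hm.comp fst) snd (hm.comp fst).succ)
      (cons (gate_toffoli (hm.comp fst) (hm.comp fst).succ snd) (const [])))) (range hm)

theorem setFlag {m f : γ → ℕ} (hm : PolyTime m) (hf : PolyTime f) :
    PolyTime fun x => setFlag (m x) (f x) :=
  ancCircuit (const 1) (cons (gate_x hf) (cons (gate_cnot hm hf) (const [])))

theorem repeatSim {p M : γ → ℕ} {C : γ × ℕ → AncCircuit} (hp : PolyTime p) (hM : PolyTime M)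
    (hC : PolyTime C) : PolyTime fun x => repeatSim (p x) (M x) fun j => C (x, j) := by
  refine chain hp.succ.succ (append ?_ (eraseAll hp.succ)) (setFlag hp.succ hp)
  refine flatMap (F := fun y : γ × ℕ => [(C y).widen (p y.1 + 1) 1,
    QZK.collectFlag (p y.1 + 1) (p y.1)]) ?_ (range hM)
  exact cons (widen (hp.comp fst).succ (const 1) hC)
    (cons (collectFlag (hp.comp fst).succ (hp.comp fst)) (const []))

theorem hide {C : γ → AncCircuit} (hC : PolyTime C) : PolyTime fun x => (C x).hide :=
  ancCircuit (add (const 1) (anc hC)) (gates hC)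

end PolyTime

/-- If the simulators `C j` are `e`-close to the single runs, then their repetition is close to
the repeated protocol. -/
theorem Protocol.outPV_seqRep_close (prot : Protocol) (V : QMAVerifier) (N : Polynomial ℕ)
    (x : List Bool) {w : Matrix (Q (V.witQubits x)) (Q (V.witQubits x)) ℂ} (hw : IsState w)
    (W : MalVerifier) (C : ℕ → AncCircuit) {k : ℕ} {e : ℝ} (he : 0 ≤ e)
    (h : ∀ j < N.eval x.length, ∀ (σ : Matrix (Q W.priv × Q k) (Q W.priv × Q k) ℂ)
      (E : Matrix (Q (W.priv + 1) × Q k) (Q (W.priv + 1) × Q k) ℂ), IsState σ → E.PosSemidef →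
      (1 - E).PosSemidef →
      |(E * amplify (Q k) (prot.outPV x w (W.drop (j * prot.rounds x))) σ).trace.re -
        (E * amplify (Q k) ((C j).chan (W.priv + 1) ∘ₗ addZero W.priv) σ).trace.re| ≤ e)
    {σ : Matrix (Q W.priv × Q k) (Q W.priv × Q k) ℂ}
    {E : Matrix (Q (W.priv + 1) × Q k) (Q (W.priv + 1) × Q k) ℂ}
    (hσ : IsState σ) (hE : E.PosSemidef) (hE' : (1 - E).PosSemidef) :
    |(E * amplify (Q k) ((prot.seqRep V N).outPV x w W) σ).trace.re -
      (E * amplify (Q k) (flagged (seqComp (fun j => succeeding W.priv (C j))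
        (N.eval x.length))) σ).trace.re| ≤ N.eval x.length * e := by
  rw [prot.outPV_seqRep V N x hw W]
  have hacc : ∀ (T : Q (prot.privQubits x (V.witQubits x)) → Prop) (j : ℕ), IsCP
      (prot.accept x w T (moves W.priv (prot.msg x) (W.drop (j * prot.rounds x)).circs)) :=
    fun T j => prot.accept_isCP x hw T (moves_isCP _ _ _)
  have hsum : ∀ j, IsTP (prot.accept x w (AllOnes (prot.prover x).out)
        (moves W.priv (prot.msg x) (W.drop (j * prot.rounds x)).circs) +
      prot.accept x w (fun f => ¬ AllOnes (prot.prover x).out f)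
        (moves W.priv (prot.msg x) (W.drop (j * prot.rounds x)).circs)) := fun j => by
    rw [prot.accept_add_not]
    exact prot.accept_true_isTP x hw (moves_isTP _ _ _)
  have hcp : ∀ j, IsCP ((C j).chan (W.priv + 1) ∘ₗ addZero W.priv) :=
    fun j => (AncCircuit.chan_isCP _ _).comp (addZero_isCP _)
  have htp : ∀ j, IsTP ((C j).chan (W.priv + 1) ∘ₗ addZero W.priv) :=
    fun j => (AncCircuit.chan_isTP _ _).comp (addZero_isTP _)
  refine flagged_seqComp_close (hacc _) (hacc _) hsum hcp htp he (fun j hj σ E hσ hE hE' => ?_)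
    hσ hE hE'
  have := h j hj σ E hσ hE hE'
  rwa [prot.outPV_eq x hw] at this

theorem AncCircuit.chan_hide_repeatSim (p M : ℕ) (C : ℕ → AncCircuit) :
    (repeatSim p M C).hide.chan (p + 1) ∘ₗ join p 1 ∘ₗ tensorRight (Q p) (zeros 1) =
      flagged (seqComp (fun j => succeeding p (C j)) M) := by
  change (repeatSim p M C).hide.chan (p + 1) ∘ₗ addZero p = _
  ext1 ρ
  rw [LinearMap.comp_apply, AncCircuit.chan_hide, chan_repeatSim]

/-- The fail flag is hidden among the ancillas, so that the simulator has exactly the verifier's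
wires and the success flag. Selecting the worst run gives one error bound for all runs, and the
hybrid argument multiplies it by their number. -/
theorem Protocol.CertEverlastingZK.seqRep {A : PromiseProblem} {V : QMAVerifier} {prot : Protocol}
    (h : prot.CertEverlastingZK A V) (hq : prot.IsQPT) (N : Polynomial ℕ) :
    (prot.seqRep V N).CertEverlastingZK A V := by
  obtain ⟨S, hS, hsim⟩ := h
  have hr := hq.2.1
  refine ⟨fun y => (repeatSim y.2.priv (N.eval y.1.length) fun j =>
    S (y.1, y.2.drop (j * prot.rounds y.1))).hide, ?_, fun W hW => ?_⟩
  · have f1 : PolyTime fun z : (List Bool × MalVerifier) × ℕ => z.1.1 := .fst' .fst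
    have f2 : PolyTime fun z : (List Bool × MalVerifier) × ℕ => z.1.2 := .snd' .fst
    have f3 : PolyTime fun z : (List Bool × MalVerifier) × ℕ => prot.rounds z.1.1 := hr.comp f1
    have f4 : PolyTime fun z : (List Bool × MalVerifier) × ℕ =>
        S (z.1.1, z.1.2.drop (z.2 * prot.rounds z.1.1)) :=
      hS.comp (f1.prod (.mal_drop f2 (.mul .snd f3)))
    have f5 : PolyTime fun y : List Bool × MalVerifier => N.eval y.1.length :=
      .polyEval (.length .fst) N
    have f6 : PolyTime fun y : List Bool × MalVerifier => y.2.priv := .priv .snd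
    exact .hide (.repeatSim (C := fun z : (List Bool × MalVerifier) × ℕ =>
      S (z.1.1, z.1.2.drop (z.2 * prot.rounds z.1.1))) f6 f5 f4)
  obtain ⟨ε, hε, hgood⟩ := exists_negligible_forall (fun i : WitnessedYes A V => i.x)
    (fun i j e => ∀ (k : ℕ) (σ : Matrix (Q (W i.x).priv × Q k) (Q (W i.x).priv × Q k) ℂ)
      (E : Matrix (Q ((W i.x).priv + 1) × Q k) (Q ((W i.x).priv + 1) × Q k) ℂ),
      IsState σ → E.PosSemidef → (1 - E).PosSemidef →
      |(E * amplify (Q k) (prot.outPV i.x i.w ((W i.x).drop (j * prot.rounds i.x))) σ).trace.re -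
        (E * amplify (Q k) ((S (i.x, (W i.x).drop (j * prot.rounds i.x))).chan ((W i.x).priv + 1) ∘ₗ
          join (W i.x).priv 1 ∘ₗ tensorRight (Q (W i.x).priv) (zeros 1)) σ).trace.re| ≤ e)
    (fun i j e e' hee hG k σ E hσ hE hE' => (hG k σ E hσ hE hE').trans hee)
    (fun x => N.eval x.length) fun sel => by
      obtain ⟨ε, hε, hi⟩ := hsim (fun x => (W x).drop (sel x * prot.rounds x))
        (PolySize.drop hW fun x => sel x * prot.rounds x)
      exact ⟨ε, hε, fun i k σ E hσ hE hE' => hi i k σ E hσ hE hE'⟩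
  refine ⟨_, hε.poly_mul N, fun i k (σ : Matrix (Q (W i.x).priv × Q k) (Q (W i.x).priv × Q k) ℂ)
    (E : Matrix (Q ((W i.x).priv + 1) × Q k) (Q ((W i.x).priv + 1) × Q k) ℂ) hσ hE hE' => ?_⟩
  dsimp only
  rw [AncCircuit.chan_hide_repeatSim]
  exact prot.outPV_seqRep_close V N i.x i.state (W i.x) _ (le_max_right (ε i.x.length) 0)
    (fun j hj σ E hσ hE hE' => (hgood i j hj k σ E hσ hE hE').trans (le_max_left _ _)) hσ hE hE'

end QZK

/-! ### The repetition theorem -/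

theorem mainTheorem2 (A : PromiseProblem) (V : QMAVerifier) (hV : V.Decides A)
    (prot : Protocol) (ε : ℕ → ℝ) (hε : Negligible ε)
    (q : Polynomial ℕ) (hq : ∀ n : ℕ, 0 < q.eval n)
    (hprot : prot.IsCEZKProof A V (fun n => 1 - ε n) (fun n => 1 - 1 / ((q.eval n : ℕ) : ℝ)))
    (N : Polynomial ℕ) :
    (∃ δ : ℕ → ℝ, Negligible δ ∧
      (prot.seqRep V N).IsCEZKProof A V (fun n => 1 - δ n)
        (fun n => (1 - 1 / ((q.eval n : ℕ) : ℝ)) ^ N.eval n)) ∧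
    (Tendsto (fun n : ℕ => ((N.eval n : ℕ) : ℝ) / (((q.eval n : ℕ) : ℝ) * Real.log n)) atTop atTop →
      ∃ δ η : ℕ → ℝ, Negligible δ ∧ Negligible η ∧
        (prot.seqRep V N).IsCEZKProof A V (fun n => 1 - δ n) η) := by
  -- A positive integer value of `q` is at least 1, so the soundness bound is a nonnegative factor.
  have hs : ∀ n, (0 : ℝ) ≤ 1 - 1 / ((q.eval n : ℕ) : ℝ) := fun n => by
    rw [sub_nonneg, div_le_one (by exact_mod_cast hq n)]
    exact_mod_cast hq n
  have h : (prot.seqRep V N).IsCEZKProof A V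
      (fun n => 1 - ((N.eval n : ℕ) : ℝ) * max (ε n) 0)
      (fun n => (1 - 1 / ((q.eval n : ℕ) : ℝ)) ^ N.eval n) :=
    { qpt := hprot.qpt.seqRep V N
      complete := hprot.complete.seqRep N
      sound := hprot.sound.seqRep hs V N
      compZK := hprot.compZK.seqRep hprot.qpt N
      proverComplete := hprot.proverComplete.seqRep N
      certEverlastingZK := hprot.certEverlastingZK.seqRep hprot.qpt N }
  -- The second claim uses the same proof system; its soundness error is itself negligible under the
  -- growth condition.
  exact ⟨⟨_, hε.poly_mul N, h⟩, fun hN => ⟨_, _, hε.poly_mul N, negligible_pow hq hN, h⟩⟩
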